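/- **Setting.** There are $n$ items, $m$ attributes and $p\ge 1$ groups. The latent utilities are $W\in\mathbb R_{\ge 0}^{n\times m}$, and $g_1,\dots,g_m:\mathbb R_{\ge0}\to\mathbb R_{\ge0}$ are increasing (possibly not strictly) and concave. Let $F(S)=\sum_{j=1}^m g_j\big(\sum_{i\in S}W_{ij}\big)$, $\mathrm{OPT}=\max_{|S|\le k}F(S)$ and $C_j=\{i: W_{ij}>0\}$. The items are divided into disjoint groups $G_1,\dots,G_p$ of prescribed sizes, uniformly at random: $G_1$ is drawn uniformly without replacement, then $G_2$ from the remaining items, and so on. The observed utilities are $\widehat W_{ij}=\phi_\ell(W_{ij})$ for $i\in G_\ell$, where $\phi_\ell:\mathbb R_{\ge0}\to\mathbb R_{\ge0}$. **Algorithm.** Input: $\widehat W$, $k$, the groups $G_\ell$, the sets $C_j$, and evaluation oracles for the $g_j$ (neither $W$ nor the $\phi_\ell$ are given). Put $r=\lfloor\sqrt k\rfloor$, call an attribute $j$ active if $C_j\ne\emptyset$, and let $a$ be the number of active attributes. *Part 1.* Put $\widetilde F(T)=\sum_j g_j\big(\frac{n}{|G_1|}\sum_{i\in T\cap G_1}\widehat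 W_{ij}\big)$. For every active $j$, put into $\widetilde S$ the first $\min\{r,|C_j\cap G_1|\}$ items $i$ of $C_j\cap G_1$ in decreasing order of $\widetilde F(\{i\})-\widetilde F(\emptyset)$. Then, $\max\{\lfloor k|G_1|/n\rfloor-ar,0\}$ times or until no item is left, add to $\widetilde S$ an unused item of $G_1\cap\bigcup_jC_j$ with the highest marginal gain of $\widetilde F$. Put $k_j=\big\lfloor \frac{n}{|G_1|}\max\{r,|\widetilde S\cap C_j|\}\big\rfloor$. *Part 2.* For every active $j$, build $S_j\subseteq C_j$ greedily from $\emptyset$ in at most $k_j$ steps. In each step add, among the unused items of $C_j$ whose group $G_\ell$ keeps at most $k_j|G_\ell|/n$ items in $S_j$ and at most $k|G_\ell|/n$ items in the whole output, an item $i$ with the highest marginal gain $g_j\big(\widehat W_{ij}+\sum_{t\in S_j}\widehat W_{tj}\big)-g_j\big(\sum_{t\in S_j}\widehat W_{tj}\big)$; stop if there is none. In both parts, ties are broken in favour of the larger observed utility. Finally, enlarge $\bigcup_jS_j$ by arbitrary items, first giving every group $\lfloor k|G_\ell|/n\rfloor$ items, and then giving groups at most $\lceil k|G_\ell|/n\rceil$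 items, until there are $k$ items. The result is the output $S$. **Theorem 2.** Assume that $\phi_1$ is the identity, that $\phi_2,\dots,\phi_p$ are arbitrary strictly increasing functions, and that $C_1,\dots,C_m$ are disjoint. 1. For all $1\le k\le n$, the output $S$ has exactly $k$ items and satisfies proportional representation: $\lfloor k|G_\ell|/n\rfloor\le |S\cap G_\ell|\le\lceil k|G_\ell|/n\rceil$ for every $\ell$ (so $|S\cap G_\ell|=k|G_\ell|/n$ if this is an integer). The algorithm makes $O(nk)$ evaluations of each $g_j$ and $O(nk\log (n+1))$ additional arithmetic operations and comparisons, with absolute constants. 2. There is a function $k_0(\varepsilon,\gamma,m,\tau)=\widetilde O(\varepsilon^{-4}\tau^{-4}\gamma^{-10}m^8)$, where $\widetilde O$ hides an absolute constant and an absolute power of $\log\big(2+\frac{m}{\varepsilon\tau\gamma}\big)$, such that the following holds for all $\varepsilon,\tau,\gamma>0$ and $m$, and all $n$, $p$, $W$, $g_j$, $\phi_\ell$ and group sizes as above. If every $W_{ij}$ is $0$ or satisfies $\tau<W_{ij}<1/\tau$, if $|G_\ell|\ge\gamma n$ for every $\ell$, and if $k_0(\varepsilon,\gamma,m,\tau)\le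 k\le n$ with $k\ge1$, then, with probability at least $1-\varepsilon$ over the random groups, $F(S)\ge(1-\varepsilon)\cdot\mathrm{OPT}$. -/

import Mathlib

open Finset

noncomputable section

namespace FairGreedy

/-! ### The model: utilities, biases, random groups

Items are `Fin n`, attributes are `Fin m`, groups are `Fin p`; `0 : Fin p` is the first
group, whose utilities are observed without bias. A division of the items into disjoint
groups is a map `G : Fin n → Fin p`. -/

section Model

variable {n m p : ℕ}

/-- The items of group `l`. -/
def members (G : Fin n → Fin p) (l : Fin p) : Finset (Fin n) :=
  univ.filter fun i => G i = l

/-- All divisions of the items into disjoint groups of the prescribed sizes. Drawing the first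
group uniformly without replacement, the second one uniformly from the remaining items, and so on,
gives the uniform distribution on this set. -/
def divisions (n : ℕ) {p : ℕ} (size : Fin p → ℕ) : Set (Fin n → Fin p) :=
  {G | ∀ l, (members G l).card = size l}

/-- The set `C j` of items with positive latent utility for attribute `j`. -/
def category (W : Fin n → Fin m → ℝ) (j : Fin m) : Finset (Fin n) :=
  univ.filter fun i => 0 < W i j

/-- The latent utility `F(S) = ∑ j, g j (∑ i ∈ S, W i j)`. -/
def utility (g : Fin m → ℝ → ℝ) (W : Fin n → Fin m → ℝ) (S : Finset (Fin n)) : ℝ :=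
  ∑ j, g j (∑ i ∈ S, W i j)

/-- `OPT = max {F(S) : |S| ≤ k}`. -/
def opt (g : Fin m → ℝ → ℝ) (W : Fin n → Fin m → ℝ) (k : ℕ) : ℝ :=
  (univ.filter fun S : Finset (Fin n) => S.card ≤ k).sup' ⟨∅, by simp⟩ (utility g W)

/-- The observed utilities: an item of group `l` is seen through the bias function `φ l`. -/
def observed (φ : Fin p → ℝ → ℝ) (G : Fin n → Fin p) (W : Fin n → Fin m → ℝ) :
    Fin n → Fin m → ℝ :=
  fun i j => φ (G i) (W i j)

/-- Proportional representation of a set that is to have `k` items: every group `l` receives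
`k * |G l| / n` items, rounded down or up. -/
def IsProportional (G : Fin n → Fin p) (k : ℕ) (S : Finset (Fin n)) : Prop :=
  ∀ l, k * (members G l).card / n ≤ (S ∩ members G l).card ∧
    (S ∩ members G l).card ≤ ⌈((k : ℝ) * (members G l).card) / n⌉₊

/-- Hypotheses on the functions `g j`: nonnegative, increasing (in the weak sense) and concave on
the nonnegative reals. -/
structure IsGain (g : ℝ → ℝ) : Prop where
  nonneg : ∀ x, 0 ≤ x → 0 ≤ g x
  mono : MonotoneOn g (Set.Ici 0)
  concave : ConcaveOn ℝ (Set.Ici 0) g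

/-- Hypotheses on the bias functions: nonnegative and increasing on the nonnegative reals. -/
structure IsBias (φ : ℝ → ℝ) : Prop where
  nonneg : ∀ x, 0 ≤ x → 0 ≤ φ x
  strictMono : StrictMonoOn φ (Set.Ici 0)

end Model

/-! ### Computations with a record of their cost -/

/-- A value together with the cost of computing it: the number `calls j` of evaluations of each
function `g j`, and the number `ops` of arithmetic operations and comparisons of numbers. -/
structure Counted (m : ℕ) (α : Type) where
  val : α
  calls : Fin m → ℕ
  ops : ℕ

instance (m : ℕ) : Monad (Counted m) where
  pure a := ⟨a, 0, 0⟩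
  bind x f := ⟨(f x.val).val, x.calls + (f x.val).calls, x.ops + (f x.val).ops⟩

section Algorithm

variable {n m p : ℕ}

/-- One arithmetic operation or comparison, with result `a`. -/
def op {α : Type} (a : α) : Counted m α := ⟨a, 0, 1⟩

/-- One evaluation of the oracle for `g j`. -/
def eval (g : Fin m → ℝ → ℝ) (j : Fin m) (x : ℝ) : Counted m ℝ := ⟨g j x, Pi.single j 1, 0⟩

/-- The marginal gain `g j (base + scale * w) - g j base`. -/
def marginal (g : Fin m → ℝ → ℝ) (j : Fin m) (scale base w : ℝ) : Counted m ℝ := do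
  let a ← op (scale * w)
  let b ← op (base + a)
  let u ← eval g j b
  let v ← eval g j base
  op (u - v)

/-- Whether gain `x` beats gain `y`; equal gains are compared by the observed utilities `v`, `w`. -/
def beats (x v y w : ℝ) : Counted m Bool := do
  let b₁ ← op (decide (y < x))
  let b₂ ← op (decide (x = y))
  let b₃ ← op (decide (w < v))
  pure (b₁ || (b₂ && b₃))

/-- Among the pairs (category `j`, item `i`) of a list that pass the test `ok`, one with the
highest marginal gain `g j (base j + scale * What i j) - g j (base j)`, and this gain. Ties are
broken in favour of the larger observed utility. -/
def best (g : Fin m → ℝ → ℝ) (What : Fin n → Fin m → ℝ) (scale : ℝ) (base : Fin m → ℝ)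
    (ok : Fin n → Counted m Bool) :
    List (Fin m × Fin n) → Counted m (Option ((Fin m × Fin n) × ℝ))
  | [] => pure none
  | c :: cs => do
    let rest ← best g What scale base ok cs
    let b ← ok c.2
    if b then do
      let x ← marginal g c.1 scale (base c.1) (What c.2 c.1)
      match rest with
      | none => pure (some (c, x))
      | some (d, y) => do
        let t ← beats x (What c.2 c.1) y (What d.2 d.1)
        pure (if t then some (c, x) else some (d, y))
    else pure rest

/-- The items of category `j` as a list of pairs (category, item). -/
def pairs (C : Fin m → Finset (Fin n)) (j : Fin m) : List (Fin m × Fin n) :=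
  ((C j).sort (· ≤ ·)).map fun i => (j, i)

/-- The attributes whose category is not empty. -/
def active (C : Fin m → Finset (Fin n)) : List (Fin m) :=
  (List.finRange m).filter fun j => (C j).Nonempty

/-- The group sizes. -/
def sizes (G : Fin n → Fin p) : List (Fin n) → Counted m (Fin p → ℕ)
  | [] => pure 0
  | i :: is => do
    let s ← sizes G is
    let c ← op (s (G i) + 1)
    pure (Function.update s (G i) c)

/-! #### Part 1: how many items each category should receive -/

/-- The set built in the first part, with the running values of the scaled sum
`scale * ∑ i, What i j` over its items from category `j` and of the number of these items. -/
structure State₁ (n m : ℕ) where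
  S : Finset (Fin n)
  base : Fin m → ℝ
  cnt : Fin m → ℕ

def push₁ (What : Fin n → Fin m → ℝ) (scale : ℝ) (s : State₁ n m) (c : Fin m × Fin n) :
    Counted m (State₁ n m) := do
  let a ← op (scale * What c.2 c.1)
  let b ← op (s.base c.1 + a)
  let t ← op (s.cnt c.1 + 1)
  pure ⟨insert c.2 s.S, Function.update s.base c.1 b, Function.update s.cnt c.1 t⟩

/-- At most `t` times: among the listed items of the reference group that were not chosen before,
add the one of highest marginal gain with respect to the base values `rank s`. -/
def greedy₁ [NeZero p] (g : Fin m → ℝ → ℝ) (What : Fin n → Fin m → ℝ) (G : Fin n → Fin p)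
    (scale : ℝ) (rank : State₁ n m → Fin m → ℝ) (cands : List (Fin m × Fin n)) :
    ℕ → State₁ n m → Counted m (State₁ n m)
  | 0, s => pure s
  | t + 1, s => do
    let o ← best g What scale (rank s) (fun i => op (decide (G i = 0 ∧ i ∉ s.S))) cands
    match o with
    | none => pure s
    | some (c, _) => do
      let s' ← push₁ What scale s c
      greedy₁ g What G scale rank cands t s'

/-- For every active attribute, the first `r` items of the reference group in its category (all of
them, if there are fewer), in decreasing order of their individual gain. -/
def initial₁ [NeZero p] (g : Fin m → ℝ → ℝ) (What : Fin n → Fin m → ℝ) (G : Fin n → Fin p)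
    (C : Fin m → Finset (Fin n)) (scale : ℝ) (r : ℕ) :
    List (Fin m) → State₁ n m → Counted m (State₁ n m)
  | [], s => pure s
  | j :: js, s => do
    let s' ← greedy₁ g What G scale (fun _ _ => 0) (pairs C j) r s
    initial₁ g What G C scale r js s'

/-- The first part: a greedy set in the reference group for the rescaled objective
`T ↦ ∑ j, g j (n / |G 0| * ∑ i ∈ T ∩ G 0, What i j)`, started with `r = ⌊√k⌋` items from every
category. The budget is `k * |G 0| / n` items, of which every category is allotted `r` at the
start, whether or not it has that many items in the reference group. For disjoint categories,
the items without an attribute never raise the objective and are left out. -/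
def part₁ [NeZero p] (g : Fin m → ℝ → ℝ) (What : Fin n → Fin m → ℝ) (k : ℕ) (G : Fin n → Fin p)
    (C : Fin m → Finset (Fin n)) (size₀ r : ℕ) : Counted m (State₁ n m) := do
  let scale ← op ((n : ℝ) / (size₀ : ℝ))
  let s ← initial₁ g What G C scale r (active C) ⟨∅, 0, 0⟩
  let a ← op (k * size₀)
  let b ← op (a / n)
  let c ← op ((active C).length * r)
  let t ← op (b - c)
  greedy₁ g What G scale State₁.base ((active C).flatMap (pairs C)) t s

/-! #### Part 2: proportional selection inside every category -/

/-- The output under construction, with its size and the number of its items from each group. -/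
structure State₂ (n p : ℕ) where
  S : Finset (Fin n)
  total : ℕ
  cnt : Fin p → ℕ

def push₂ (G : Fin n → Fin p) (s : State₂ n p) (i : Fin n) : Counted m (State₂ n p) := do
  let a ← op (s.total + 1)
  let b ← op (s.cnt (G i) + 1)
  pure ⟨insert i s.S, a, Function.update s.cnt (G i) b⟩

/-- Whether a group of size `size`, of which `c` items were chosen, may receive one more item
without getting more than its proportional share `k * size / n`. -/
def fits (n : ℕ) (k size c : ℕ) : Counted m Bool := do
  let a ← op (c + 1)
  let b ← op (n * a)
  let d ← op (k * size)
  op (decide (b ≤ d))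

/-- Item `i` can be added: it is not chosen, and its group stays within its proportional share
both of the `kj` items of the category (`cj` counts the items chosen from the category) and of
the `k` items of the whole output. -/
def canAdd (G : Fin n → Fin p) (size : Fin p → ℕ) (k kj : ℕ) (s : State₂ n p) (cj : Fin p → ℕ)
    (i : Fin n) : Counted m Bool := do
  let b₀ ← op (decide (i ∉ s.S))
  let b₁ ← fits n kj (size (G i)) (cj (G i))
  let b₂ ← fits n k (size (G i)) (s.cnt (G i))
  pure (b₀ && b₁ && b₂)

/-- At most `t` times: among the items of category `j` that can be added, add the one of highest
marginal observed utility. Here `base` is the observed utility collected in the category. -/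
def greedy₂ (g : Fin m → ℝ → ℝ) (What : Fin n → Fin m → ℝ) (k : ℕ) (G : Fin n → Fin p)
    (C : Fin m → Finset (Fin n)) (size : Fin p → ℕ) (j : Fin m) (kj : ℕ) :
    ℕ → ℝ → (Fin p → ℕ) → State₂ n p → Counted m (State₂ n p)
  | 0, _, _, s => pure s
  | t + 1, base, cj, s => do
    let o ← best g What 1 (fun _ => base) (canAdd G size k kj s cj) (pairs C j)
    match o with
    | none => pure s
    | some (c, _) => do
      let s' ← push₂ G s c.2
      let base' ← op (base + What c.2 j)
      let a ← op (cj (G c.2) + 1)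
      greedy₂ g What k G C size j kj t base' (Function.update cj (G c.2) a) s'

/-- The second part, over all active attributes. The number of items of category `j` is
`n / |G 0|` times the number of slots that category `j` received in the first part. -/
def part₂ (g : Fin m → ℝ → ℝ) (What : Fin n → Fin m → ℝ) (k : ℕ) (G : Fin n → Fin p)
    (C : Fin m → Finset (Fin n)) (size : Fin p → ℕ) (size₀ r : ℕ) (s₁ : State₁ n m) :
    List (Fin m) → State₂ n p → Counted m (State₂ n p)
  | [], s => pure s
  | j :: js, s => do
    let a ← op (max r (s₁.cnt j))
    let b ← op (n * a)
    let kj ← op (b / size₀)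
    let s' ← greedy₂ g What k G C size j kj kj 0 0 s
    part₂ g What k G C size size₀ r s₁ js s'

/-! #### Filling up to `k` items -/

/-- Fill up every group to its proportional share, rounded down. -/
def fillDown (k : ℕ) (G : Fin n → Fin p) (size : Fin p → ℕ) :
    List (Fin n) → State₂ n p → Counted m (State₂ n p)
  | [], s => pure s
  | i :: is, s => do
    let b₀ ← op (decide (i ∉ s.S))
    let b₁ ← fits n k (size (G i)) (s.cnt (G i))
    let s' ← if b₀ && b₁ then push₂ G s i else pure s
    fillDown k G size is s'

/-- While there are fewer than `k` items, fill up every group to its proportional share, rounded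
up. -/
def fillUp (k : ℕ) (G : Fin n → Fin p) (size : Fin p → ℕ) :
    List (Fin n) → State₂ n p → Counted m (State₂ n p)
  | [], s => pure s
  | i :: is, s => do
    let b₀ ← op (decide (i ∉ s.S))
    let b₁ ← op (decide (s.total < k))
    let a ← op (n * s.cnt (G i))
    let b ← op (k * size (G i))
    let b₂ ← op (decide (a < b))
    let s' ← if b₀ && b₁ && b₂ then push₂ G s i else pure s
    fillUp k G size is s'

/-- The whole algorithm. Its input consists of the observed utilities `What`, the number `k`, the
groups `G`, the categories `C`, and evaluation oracles for the functions `g j`. The integer part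
of a square root counts as one operation. -/
def fairGreedy [NeZero p] (g : Fin m → ℝ → ℝ) (What : Fin n → Fin m → ℝ) (k : ℕ)
    (G : Fin n → Fin p) (C : Fin m → Finset (Fin n)) : Counted m (Finset (Fin n)) := do
  let size ← sizes G (List.finRange n)
  let r ← op (Nat.sqrt k)
  let s₁ ← part₁ g What k G C (size 0) r
  let s ← part₂ g What k G C size (size 0) r s₁ (active C) ⟨∅, 0, 0⟩
  let s' ← fillDown k G size (List.finRange n) s
  let s'' ← fillUp k G size (List.finRange n) s'
  pure s''.S

end Algorithm

end FairGreedy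

end

open FairGreedy

/-! Size, proportionality and cost hold for every division. The second part never lets a group
exceed its exact share of the output, so it selects at most `k` items. This also bounds its work,
since a search either adds an item or ends a category. As `k ≤ n`, every group has enough items for
filling up, and if this ended with fewer than `k` items, every group would have at least its exact
share although the shares add up to `k` (`fairGreedy_spec`, `costLE_fairGreedy`).

Randomness enters the utility bound through one event, `Concentrated`: for every category and every
`y ≤ k`, the `y` best items are spread over the groups in proportion to the group sizes, up to a
factor `1 ± δ` and an additive error `b`. Membership of single items in a set of groups is
negatively correlated (`card_capturing_le`), so Chernoff bounds and a union bound apply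
(`card_not_concentrated_le`). The rest is deterministic (`Regular.opt_le`).

A nonnegative concave function loses at most the factor `c` when its argument is multiplied by `c ≤
1` (`IsGain.mul_le`), so it suffices to compare utility sums within each category. In the first
group the utilities are unbiased, and disjoint categories make the objective a separable concave
one, for which greedy selection is exactly optimal (`exchange`, `greedy₁_optimal`). It therefore
beats the following competitor: if an optimal set takes `x j` items of category `j`, take slightly
fewer of the best items of each category and restrict them to the first group. By concentration the
competitor fits into the budget and its rescaled value is close to the optimum. So the targets
derived from the first part are nearly the right numbers.

The second part needs no comparison between groups. The shares fix how many items each group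
contributes to a category, and inside a group a strictly increasing bias preserves the order, so
every group contributes its best items (`greedy₂_spec`). By concentration they are nearly as good as
the best items overall (`Regular.bestSum_le_of_upper`).

The `r` reserved slots handle the additive errors. A category with more than `r` items in the first
group has at least `r` selected items there, each worth at least `τ`, which makes an error of order
`b / τ` relative. A category with at most `r` items there is nearly exhausted by its target alone
(`Regular.bestSum_le_of_card_le`). The losses multiply to `(1 - 2 * δ) ^ 4 ≥ 1 - 8 * δ`, and `δ = ε
/ 8`. -/

namespace FairGreedy

/-! ### Cost bounds and correctness of the search for a best candidate -/

section Cost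

variable {n m p : ℕ} {α β : Type}

@[simp] lemma bind_val (x : Counted m α) (f : α → Counted m β) :
    (x >>= f).val = (f x.val).val := rfl

@[simp] lemma pure_val (a : α) : (pure a : Counted m α).val = a := rfl

@[simp] lemma op_val (a : α) : (op a : Counted m α).val = a := rfl

/-- The computation makes at most `c` evaluations of each function and at most `c` operations. -/
def CostLE (x : Counted m α) (c : ℕ) : Prop := (∀ j, x.calls j ≤ c) ∧ x.ops ≤ c

lemma CostLE.mono {x : Counted m α} {a b : ℕ} (h : CostLE x a) (hab : a ≤ b) : CostLE x b :=
  ⟨fun j => (h.1 j).trans hab, h.2.trans hab⟩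

lemma CostLE.pure (a : α) : CostLE (pure a : Counted m α) 0 := ⟨fun _ => le_rfl, le_rfl⟩

lemma CostLE.op (a : α) : CostLE (op a : Counted m α) 1 := ⟨fun _ => Nat.zero_le _, le_rfl⟩

lemma CostLE.bind {x : Counted m α} {f : α → Counted m β} {a b : ℕ} (hx : CostLE x a)
    (hf : CostLE (f x.val) b) : CostLE (x >>= f) (a + b) :=
  ⟨fun j => add_le_add (hx.1 j) (hf.1 j), add_le_add hx.2 hf.2⟩

lemma CostLE.bind_of_le {x : Counted m α} {f : α → Counted m β} {a b c : ℕ} (hx : CostLE x a)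
    (hf : CostLE (f x.val) b) (h : a + b ≤ c) : CostLE (x >>= f) c :=
  (hx.bind hf).mono h

lemma CostLE.op_bind {a : α} {f : α → Counted m β} {b : ℕ} (hf : CostLE (f a) b) :
    CostLE (FairGreedy.op a >>= f) (b + 1) :=
  (CostLE.bind (CostLE.op a) hf).mono (by omega)

lemma costLE_marginal (g : Fin m → ℝ → ℝ) (j : Fin m) (scale base w : ℝ) :
    CostLE (marginal g j scale base w) 3 := by
  refine ⟨fun j' => ?_, le_rfl⟩
  change (0 + (0 + (Pi.single j 1 + (Pi.single j 1 + 0))) : Fin m → ℕ) j' ≤ 3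
  by_cases h : j' = j
  · subst h; simp
  · simp [h]

lemma costLE_beats (x v y w : ℝ) : CostLE (beats x v y w : Counted m Bool) 3 :=
  ⟨fun _ => Nat.zero_le _, le_rfl⟩

lemma costLE_fits (n k s c : ℕ) : CostLE (fits n k s c : Counted m Bool) 4 :=
  ⟨fun _ => Nat.zero_le _, le_rfl⟩

lemma costLE_canAdd (G : Fin n → Fin p) (size : Fin p → ℕ) (k kj : ℕ) (s : State₂ n p)
    (cj : Fin p → ℕ) (i : Fin n) : CostLE (canAdd G size k kj s cj i : Counted m Bool) 9 :=
  ⟨fun _ => Nat.zero_le _, le_rfl⟩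

lemma costLE_push₁ (What : Fin n → Fin m → ℝ) (scale : ℝ) (s : State₁ n m) (c : Fin m × Fin n) :
    CostLE (push₁ What scale s c) 3 :=
  ⟨fun _ => Nat.zero_le _, le_rfl⟩

lemma costLE_push₂ (G : Fin n → Fin p) (s : State₂ n p) (i : Fin n) :
    CostLE (push₂ G s i : Counted m _) 2 :=
  ⟨fun _ => Nat.zero_le _, le_rfl⟩

/-- Each entry costs at most 9 for the test (the cost of `canAdd`, the dearest one used), 3 for the
marginal gain and 3 for the comparison. -/
lemma costLE_best (g : Fin m → ℝ → ℝ) (What : Fin n → Fin m → ℝ) (scale : ℝ) (base : Fin m → ℝ)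
    (ok : Fin n → Counted m Bool) (hok : ∀ i, CostLE (ok i) 9) (cs : List (Fin m × Fin n)) :
    CostLE (best g What scale base ok cs) (15 * cs.length) := by
  induction cs with
  | nil => exact CostLE.pure _
  | cons c cs ih =>
    refine CostLE.bind_of_le (b := 15) ih ?_ (by rw [List.length_cons]; omega)
    refine CostLE.bind_of_le (b := 6) (hok _) ?_ le_rfl
    split
    · refine CostLE.bind_of_le (b := 3) (costLE_marginal ..) ?_ le_rfl
      split
      · exact (CostLE.pure _).mono (Nat.zero_le _)
      · exact CostLE.bind_of_le (costLE_beats ..) (CostLE.pure _) le_rfl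
    · exact (CostLE.pure _).mono (Nat.zero_le _)

lemma beats_val (x v y w : ℝ) :
    (beats x v y w : Counted m Bool).val = true ↔ y < x ∨ (x = y ∧ w < v) := by
  simp [beats]

/-- The marginal gain of a pair (category, item), as computed by `best`. -/
def gain (g : Fin m → ℝ → ℝ) (What : Fin n → Fin m → ℝ) (scale : ℝ) (base : Fin m → ℝ)
    (c : Fin m × Fin n) : ℝ :=
  g c.1 (base c.1 + scale * What c.2 c.1) - g c.1 (base c.1)

/-- The tie-break belongs to the statement because `g j` is only weakly increasing: where it is
constant, gains do not order the items. Both alternatives together will show that the winner has the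
largest observed utility among the admissible candidates of its own category. -/
lemma best_val (g : Fin m → ℝ → ℝ) (What : Fin n → Fin m → ℝ) (scale : ℝ) (base : Fin m → ℝ)
    (ok : Fin n → Counted m Bool) (cs : List (Fin m × Fin n)) :
    match (best g What scale base ok cs).val with
    | none => ∀ c ∈ cs, (ok c.2).val = false
    | some (d, y) => d ∈ cs ∧ (ok d.2).val = true ∧ y = gain g What scale base d ∧
        ∀ c ∈ cs, (ok c.2).val = true → gain g What scale base c < gain g What scale base d ∨
          (gain g What scale base c = gain g What scale base d ∧ What c.2 c.1 ≤ What d.2 d.1) := by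
  induction cs with
  | nil => simp [best]
  | cons c cs ih =>
    simp only [best, bind_val]
    by_cases hc : (ok c.2).val = true
    · simp only [hc, if_true, bind_val]
      have hm : (marginal g c.1 scale (base c.1) (What c.2 c.1)).val
        = gain g What scale base c := rfl
      cases h : (best g What scale base ok cs).val with
      | none =>
        rw [h] at ih
        simp only [pure_val, hm]
        refine ⟨by simp, hc, trivial, ?_⟩
        intro c' hc' hok
        rcases List.mem_cons.1 hc' with rfl | hc'
        · exact Or.inr ⟨rfl, le_rfl⟩
        · rw [ih c' hc'] at hok; simp at hok
      | some dy =>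
        obtain ⟨d, y⟩ := dy
        rw [h] at ih
        obtain ⟨hd, hdok, hy, hmax⟩ := ih
        simp only [bind_val, hm, pure_val]
        by_cases hb : (beats (m := m) (gain g What scale base c) (What c.2 c.1) y
          (What d.2 d.1)).val = true
        · simp only [hb, if_true]
          refine ⟨by simp, hc, trivial, ?_⟩
          rw [beats_val, hy] at hb
          intro c' hc' hok
          rcases List.mem_cons.1 hc' with rfl | hc'
          · exact Or.inr ⟨rfl, le_rfl⟩
          · rcases hmax c' hc' hok with h1 | ⟨h1, h2⟩ <;> rcases hb with h3 | ⟨h3, h4⟩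
            · exact Or.inl (h1.trans h3)
            · exact Or.inl (by rw [h3]; exact h1)
            · exact Or.inl (by rw [h1]; exact h3)
            · exact Or.inr ⟨h1.trans h3.symm, h2.trans h4.le⟩
        · simp only [hb, if_false, Bool.false_eq_true]
          refine ⟨List.mem_cons_of_mem _ hd, hdok, hy, ?_⟩
          rw [beats_val, hy, not_or, not_and] at hb
          intro c' hc' hok
          rcases List.mem_cons.1 hc' with rfl | hc'
          · rcases lt_or_eq_of_le (not_lt.1 hb.1) with h1 | h1
            · exact Or.inl h1
            · exact Or.inr ⟨h1, not_lt.1 (hb.2 h1)⟩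
          · exact hmax c' hc' hok
    · simp only [hc, if_false, Bool.false_eq_true, pure_val]
      cases h : (best g What scale base ok cs).val with
      | none =>
        rw [h] at ih
        intro c' hc'
        rcases List.mem_cons.1 hc' with rfl | hc'
        · simpa using hc
        · exact ih c' hc'
      | some dy =>
        obtain ⟨d, y⟩ := dy
        rw [h] at ih
        obtain ⟨hd, hdok, hy, hmax⟩ := ih
        refine ⟨List.mem_cons_of_mem _ hd, hdok, hy, ?_⟩
        intro c' hc' hok
        rcases List.mem_cons.1 hc' with rfl | hc'
        · exact absurd hok hc
        · exact hmax c' hc' hok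

lemma best_none {g : Fin m → ℝ → ℝ} {What : Fin n → Fin m → ℝ} {scale : ℝ} {base : Fin m → ℝ}
    {ok : Fin n → Counted m Bool} {cs : List (Fin m × Fin n)}
    (h : (best g What scale base ok cs).val = none) : ∀ c ∈ cs, (ok c.2).val = false := by
  have := best_val g What scale base ok cs
  rwa [h] at this

lemma best_some {g : Fin m → ℝ → ℝ} {What : Fin n → Fin m → ℝ} {scale : ℝ} {base : Fin m → ℝ}
    {ok : Fin n → Counted m Bool} {cs : List (Fin m × Fin n)} {d : Fin m × Fin n} {y : ℝ}
    (h : (best g What scale base ok cs).val = some (d, y)) :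
    d ∈ cs ∧ (ok d.2).val = true ∧
        ∀ c ∈ cs, (ok c.2).val = true → gain g What scale base c < gain g What scale base d ∨
          (gain g What scale base c = gain g What scale base d ∧
            What c.2 c.1 ≤ What d.2 d.1) := by
  have := best_val g What scale base ok cs
  rw [h] at this
  exact ⟨this.1, this.2.1, this.2.2.2⟩

lemma costLE_greedy₁ [NeZero p] (g : Fin m → ℝ → ℝ) (What : Fin n → Fin m → ℝ) (G : Fin n → Fin p)
    (scale : ℝ) (rank : State₁ n m → Fin m → ℝ) (cands : List (Fin m × Fin n)) (t : ℕ)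
    (s : State₁ n m) :
    CostLE (greedy₁ g What G scale rank cands t s) (t * (15 * cands.length + 3)) := by
  induction t generalizing s with
  | zero => exact (CostLE.pure _).mono (Nat.zero_le _)
  | succ t ih =>
    refine CostLE.bind_of_le (b := 3 + t * (15 * cands.length + 3))
      (costLE_best g What scale _ _ (fun i => (CostLE.op _).mono (by omega)) cands) ?_
      (le_of_eq (by ring))
    split
    · exact (CostLE.pure _).mono (Nat.zero_le _)
    · exact CostLE.bind (costLE_push₁ ..) (ih _)

lemma length_pairs (C : Fin m → Finset (Fin n)) (j : Fin m) : (pairs C j).length = (C j).card := by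
  simp [pairs]

lemma mem_pairs {C : Fin m → Finset (Fin n)} {j : Fin m} {c : Fin m × Fin n} :
    c ∈ pairs C j ↔ c.1 = j ∧ c.2 ∈ C j := by
  obtain ⟨a, b⟩ := c
  simp [pairs, Prod.ext_iff]
  tauto

lemma mem_active {C : Fin m → Finset (Fin n)} {j : Fin m} : j ∈ active C ↔ (C j).Nonempty := by
  simp [active]

lemma nodup_active (C : Fin m → Finset (Fin n)) : (active C).Nodup :=
  (List.nodup_finRange m).filter _

lemma sum_card_le (C : Fin m → Finset (Fin n)) (hC : ∀ j j', j ≠ j' → Disjoint (C j) (C j')) :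
    ∑ j, (C j).card ≤ n := by
  rw [← card_biUnion (fun j _ j' _ h => hC j j' h)]
  simpa using card_le_univ (univ.biUnion C)

lemma sum_active (C : Fin m → Finset (Fin n)) (f : Fin m → ℕ) :
    ((active C).map f).sum = ∑ j ∈ univ.filter fun j => (C j).Nonempty, f j := by
  rw [← List.sum_toFinset f (nodup_active C)]
  congr 1
  ext j
  simp [mem_active]

lemma sum_active_card_le (C : Fin m → Finset (Fin n))
    (hC : ∀ j j', j ≠ j' → Disjoint (C j) (C j')) :
    ((active C).map fun j => (C j).card).sum ≤ n := by
  rw [sum_active]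
  exact (sum_le_univ_sum_of_nonneg (fun _ => Nat.zero_le _)).trans (sum_card_le C hC)

lemma length_active_le (C : Fin m → Finset (Fin n))
    (hC : ∀ j j', j ≠ j' → Disjoint (C j) (C j')) : (active C).length ≤ n := by
  have h := sum_active C (fun _ => 1)
  rw [List.map_const', List.sum_replicate, smul_eq_mul, mul_one] at h
  rw [h]
  refine (sum_le_sum fun j hj => ?_).trans
    ((sum_le_univ_sum_of_nonneg (fun _ => Nat.zero_le _)).trans (sum_card_le C hC))
  exact card_pos.2 (mem_filter.1 hj).2

lemma length_cands_le (C : Fin m → Finset (Fin n))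
    (hC : ∀ j j', j ≠ j' → Disjoint (C j) (C j')) : ((active C).flatMap (pairs C)).length ≤ n := by
  rw [List.length_flatMap]
  simp only [length_pairs]
  exact sum_active_card_le C hC

lemma costLE_initial₁ [NeZero p] (g : Fin m → ℝ → ℝ) (What : Fin n → Fin m → ℝ)
    (G : Fin n → Fin p) (C : Fin m → Finset (Fin n)) (scale : ℝ) (r : ℕ) (js : List (Fin m))
    (s : State₁ n m) :
    CostLE (initial₁ g What G C scale r js s)
      (r * (15 * (js.map fun j => (C j).card).sum + 3 * js.length)) := by
  induction js generalizing s with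
  | nil => exact (CostLE.pure _).mono (Nat.zero_le _)
  | cons j js ih =>
    refine CostLE.bind_of_le (costLE_greedy₁ ..) (ih _) (le_of_eq ?_)
    simp only [length_pairs, List.map_cons, List.sum_cons, List.length_cons]
    ring

lemma costLE_part₁ [NeZero p] (g : Fin m → ℝ → ℝ) (What : Fin n → Fin m → ℝ) (k : ℕ)
    (G : Fin n → Fin p) (C : Fin m → Finset (Fin n)) (size₀ r : ℕ)
    (hC : ∀ j j', j ≠ j' → Disjoint (C j) (C j')) (hs : size₀ ≤ n) (hr : r ≤ k) :
    CostLE (part₁ g What k G C size₀ r) (36 * (n * k) + 3 * k + 5) := by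
  refine CostLE.mono (CostLE.op_bind (CostLE.bind (costLE_initial₁ ..) (CostLE.op_bind
    (CostLE.op_bind (CostLE.op_bind (CostLE.op_bind (costLE_greedy₁ ..))))))) ?_
  have h1 := sum_active_card_le C hC
  have h2 := length_active_le C hC
  have h3 := length_cands_le C hC
  have h4 : k * size₀ / n - (active C).length * r ≤ k := by
    refine (Nat.sub_le _ _).trans (Nat.div_le_of_le_mul ?_)
    rw [mul_comm]
    exact Nat.mul_le_mul_right _ hs
  have h5 := Nat.mul_le_mul hr (add_le_add (Nat.mul_le_mul_left 15 h1) (Nat.mul_le_mul_left 3 h2))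
  have h6 := Nat.mul_le_mul h4 (Nat.add_le_add_right (Nat.mul_le_mul_left 15 h3) 3)
  nlinarith

lemma sizes_val (G : Fin n → Fin p) (is : List (Fin n)) (l : Fin p) :
    (sizes G is : Counted m _).val l = (is.filter fun i => G i = l).length := by
  induction is with
  | nil => rfl
  | cons i is ih =>
    simp only [sizes, bind_val, op_val, pure_val]
    by_cases h : G i = l
    · subst h; simp [ih]
    · rw [Function.update_of_ne (Ne.symm h), ih, List.filter_cons_of_neg (by simpa using h)]

lemma sizes_finRange_val (G : Fin n → Fin p) :
    (sizes G (List.finRange n) : Counted m _).val = fun l => (members G l).card := by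
  funext l
  rw [sizes_val, members, ← List.toFinset_card_of_nodup ((List.nodup_finRange n).filter _)]
  congr 1
  ext i
  simp

lemma costLE_sizes (G : Fin n → Fin p) (is : List (Fin n)) :
    CostLE (sizes G is : Counted m _) is.length := by
  induction is with
  | nil => exact CostLE.pure _
  | cons i is ih => exact CostLE.bind ih (CostLE.op_bind (CostLE.pure _))

end Cost

/-! ### Proportional representation and the total cost -/

section Proportional

variable {n m p : ℕ}

lemma mem_members {G : Fin n → Fin p} {l : Fin p} {i : Fin n} : i ∈ members G l ↔ G i = l := by
  simp [members]

lemma card_insert_inter_members (G : Fin n → Fin p) {S : Finset (Fin n)} {i : Fin n} (hi : i ∉ S)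
    (l : Fin p) : (insert i S ∩ members G l).card =
      (S ∩ members G l).card + if G i = l then 1 else 0 := by
  by_cases h : G i = l
  · rw [insert_inter_of_mem (mem_members.2 h), card_insert_of_notMem (by simp [hi]), if_pos h]
  · rw [insert_inter_of_notMem (fun h' => h (mem_members.1 h')), if_neg h, add_zero]

lemma sum_card_inter_members (G : Fin n → Fin p) (S : Finset (Fin n)) :
    ∑ l, (S ∩ members G l).card = S.card := by
  rw [card_eq_sum_card_fiberwise (f := G) (t := univ) (fun _ _ => by simp)]
  refine sum_congr rfl fun l _ => congrArg card ?_
  ext i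
  simp [mem_members]

lemma sum_card_members (G : Fin n → Fin p) : ∑ l, (members G l).card = n := by
  simpa using sum_card_inter_members G univ

/-- The counters of a state are correct, and no group has more than its share of `k` items. -/
structure Valid (k : ℕ) (G : Fin n → Fin p) (s : State₂ n p) : Prop where
  total : s.total = s.S.card
  cnt : ∀ l, s.cnt l = (s.S ∩ members G l).card
  share : ∀ l, n * s.cnt l ≤ k * (members G l).card

/-- The share bounds are summed over the groups, whose sizes add up to `n`. Besides the size of the
output, this controls the number of searches in the second part. -/
lemma Valid.total_le {k : ℕ} {G : Fin n → Fin p} {s : State₂ n p} (h : Valid k G s)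
    (hn : 0 < n) : s.total ≤ k := by
  have h1 : n * s.total ≤ n * k := by
    rw [h.total, ← sum_card_inter_members G s.S, mul_sum]
    calc ∑ l, n * (s.S ∩ members G l).card ≤ ∑ l, k * (members G l).card :=
          sum_le_sum fun l _ => by rw [← h.cnt]; exact h.share l
      _ = n * k := by rw [← mul_sum, sum_card_members, mul_comm]
  exact Nat.le_of_mul_le_mul_left h1 hn

lemma valid_empty (k : ℕ) (G : Fin n → Fin p) : Valid k G ⟨∅, 0, 0⟩ :=
  ⟨rfl, fun l => by simp, fun l => by simp⟩

@[simp] lemma fits_val (k size c : ℕ) :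
    (fits n k size c : Counted m Bool).val = decide (n * (c + 1) ≤ k * size) := rfl

lemma canAdd_val {G : Fin n → Fin p} {size : Fin p → ℕ} {k kj : ℕ} {s : State₂ n p}
    {cj : Fin p → ℕ} {i : Fin n} : (canAdd G size k kj s cj i : Counted m Bool).val = true ↔
      i ∉ s.S ∧ n * (cj (G i) + 1) ≤ kj * size (G i) ∧
        n * (s.cnt (G i) + 1) ≤ k * size (G i) := by
  simp [canAdd, and_assoc]

lemma push₂_val (G : Fin n → Fin p) (s : State₂ n p) (i : Fin n) :
    (push₂ G s i : Counted m _).val =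
      ⟨insert i s.S, s.total + 1, Function.update s.cnt (G i) (s.cnt (G i) + 1)⟩ := rfl

lemma update_cnt_eq {G : Fin n → Fin p} {S : Finset (Fin n)} {i : Fin n} {cnt : Fin p → ℕ}
    (hcnt : ∀ l, cnt l = (S ∩ members G l).card) (hi : i ∉ S) (l : Fin p) :
    Function.update cnt (G i) (cnt (G i) + 1) l = (insert i S ∩ members G l).card := by
  rw [card_insert_inter_members G hi, ← hcnt]
  by_cases hl : G i = l
  · subst hl; simp
  · rw [Function.update_of_ne (Ne.symm hl), if_neg hl, add_zero]

lemma Valid.push {k : ℕ} {G : Fin n → Fin p} {s : State₂ n p} (h : Valid k G s) {i : Fin n}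
    (hi : i ∉ s.S) (hf : n * (s.cnt (G i) + 1) ≤ k * (members G (G i)).card) :
    Valid k G (push₂ G s i : Counted m _).val := by
  rw [push₂_val]
  refine ⟨?_, fun l => update_cnt_eq h.cnt hi l, fun l => ?_⟩
  · simp only [h.total, card_insert_of_notMem hi]
  · by_cases hl : G i = l
    · subst hl; simpa using hf
    · simp only [Function.update_of_ne (Ne.symm hl)]
      exact h.share l

lemma valid_greedy₂ (g : Fin m → ℝ → ℝ) (What : Fin n → Fin m → ℝ) (k : ℕ) (G : Fin n → Fin p)
    (C : Fin m → Finset (Fin n)) (j : Fin m) (kj : ℕ) (t : ℕ) (base : ℝ) (cj : Fin p → ℕ)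
    (s : State₂ n p) (h : Valid k G s) :
    Valid k G (greedy₂ g What k G C (fun l => (members G l).card) j kj t base cj s).val := by
  induction t generalizing base cj s with
  | zero => exact h
  | succ t ih =>
    simp only [greedy₂, bind_val]
    cases hb : (best g What 1 (fun _ => base)
      (canAdd G (fun l => (members G l).card) k kj s cj) (pairs C j)).val with
    | none => exact h
    | some dy =>
      obtain ⟨d, y⟩ := dy
      obtain ⟨-, hd, -⟩ := best_some hb
      rw [canAdd_val] at hd
      exact ih _ _ _ (h.push hd.1 hd.2.2)

/-- The cost is charged to the items added, plus one for a final search without result, and not to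
the step limit `t`: the target of a category may exceed `k`, whereas the growth of `total` cannot.
-/
lemma costLE_greedy₂ (g : Fin m → ℝ → ℝ) (What : Fin n → Fin m → ℝ) (k : ℕ) (G : Fin n → Fin p)
    (C : Fin m → Finset (Fin n)) (size : Fin p → ℕ) (j : Fin m) (kj : ℕ) (t : ℕ) (base : ℝ)
    (cj : Fin p → ℕ) (s : State₂ n p) :
    s.total ≤ (greedy₂ g What k G C size j kj t base cj s).val.total ∧
    CostLE (greedy₂ g What k G C size j kj t base cj s)
      (((greedy₂ g What k G C size j kj t base cj s).val.total - s.total + 1) *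
        (15 * (C j).card + 4)) := by
  induction t generalizing base cj s with
  | zero => exact ⟨le_rfl, (CostLE.pure _).mono (Nat.zero_le _)⟩
  | succ t ih =>
    have hbest : CostLE (best g What 1 (fun _ => base) (canAdd G size k kj s cj) (pairs C j))
      (15 * (C j).card) := by
      rw [← length_pairs]
      exact costLE_best _ _ _ _ _ (fun i => costLE_canAdd ..) _
    cases hb : (best g What 1 (fun _ => base) (canAdd G size k kj s cj) (pairs C j)).val with
    | none =>
      have hv : (greedy₂ g What k G C size j kj (t + 1) base cj s).val = s := by
        simp only [greedy₂, bind_val, hb, pure_val]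
      rw [hv]
      refine ⟨le_rfl, CostLE.bind_of_le (b := 0) hbest ?_ (by rw [Nat.sub_self]; omega)⟩
      rw [hb]
      exact CostLE.pure _
    | some dy =>
      obtain ⟨d, y⟩ := dy
      have hv : (greedy₂ g What k G C size j kj (t + 1) base cj s).val =
          (greedy₂ g What k G C size j kj t (base + What d.2 j)
            (Function.update cj (G d.2) (cj (G d.2) + 1)) (push₂ G s d.2 : Counted m _).val).val := by
        simp only [greedy₂, bind_val, hb, op_val]
      obtain ⟨h1, h2⟩ := ih (base + What d.2 j)
            (Function.update cj (G d.2) (cj (G d.2) + 1)) (push₂ G s d.2 : Counted m _).val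
      rw [hv]
      have h3 : (push₂ G s d.2 : Counted m _).val.total = s.total + 1 := rfl
      rw [h3] at h1 h2
      refine ⟨by omega, ?_⟩
      set T := (greedy₂ g What k G C size j kj t (base + What d.2 j)
            (Function.update cj (G d.2) (cj (G d.2) + 1))
            (push₂ G s d.2 : Counted m _).val).val.total
      have h4 : T - s.total + 1 = (T - (s.total + 1) + 1) + 1 := by omega
      refine CostLE.bind_of_le (b := 2 + ((T - (s.total + 1) + 1) * (15 * (C j).card + 4) + 1 + 1))
        hbest ?_ (le_of_eq (by rw [h4]; ring))
      rw [hb]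
      exact CostLE.bind (costLE_push₂ ..) (CostLE.op_bind (CostLE.op_bind h2))

lemma valid_part₂ (g : Fin m → ℝ → ℝ) (What : Fin n → Fin m → ℝ) (k : ℕ) (G : Fin n → Fin p)
    (C : Fin m → Finset (Fin n)) (size₀ r : ℕ) (s₁ : State₁ n m) (js : List (Fin m))
    (s : State₂ n p) (h : Valid k G s) :
    Valid k G (part₂ g What k G C (fun l => (members G l).card) size₀ r s₁ js s).val := by
  induction js generalizing s with
  | nil => exact h
  | cons j js ih => exact ih _ (valid_greedy₂ _ _ _ _ _ _ _ _ _ _ _ h)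

lemma costLE_part₂ (g : Fin m → ℝ → ℝ) (What : Fin n → Fin m → ℝ) (k : ℕ) (G : Fin n → Fin p)
    (C : Fin m → Finset (Fin n)) (size₀ r : ℕ) (s₁ : State₁ n m) (hn : 0 < n) (js : List (Fin m))
    (s : State₂ n p) (h : Valid k G s) :
    CostLE (part₂ g What k G C (fun l => (members G l).card) size₀ r s₁ js s)
      ((k + 1) * (15 * (js.map fun j => (C j).card).sum + 4 * js.length) + 3 * js.length) := by
  induction js generalizing s with
  | nil => exact (CostLE.pure _).mono (Nat.zero_le _)
  | cons j js ih =>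
    refine CostLE.mono (CostLE.op_bind (CostLE.op_bind (CostLE.op_bind (CostLE.bind
      (costLE_greedy₂ ..).2 (ih _ (valid_greedy₂ _ _ _ _ _ _ _ _ _ _ _ h)))))) ?_
    have h1 := (valid_greedy₂ g What k G C j (n * max r (s₁.cnt j) / size₀)
      (n * max r (s₁.cnt j) / size₀) 0 0 s h).total_le hn
    have h2 := Nat.mul_le_mul_right (15 * (C j).card + 4)
      (show ((greedy₂ g What k G C (fun l => (members G l).card) j
        (n * max r (s₁.cnt j) / size₀) (n * max r (s₁.cnt j) / size₀) 0 0 s).val.total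
          - s.total + 1) ≤ k + 1 by omega)
    refine (Nat.add_le_add_right (Nat.add_le_add_right (Nat.add_le_add_right
      (Nat.add_le_add_right h2 _) _) _) _).trans (le_of_eq ?_)
    simp only [List.map_cons, List.sum_cons, List.length_cons]
    ring

lemma costLE_fillDown (k : ℕ) (G : Fin n → Fin p) (size : Fin p → ℕ) (is : List (Fin n))
    (s : State₂ n p) : CostLE (fillDown k G size is s : Counted m _) (7 * is.length) := by
  induction is generalizing s with
  | nil => exact CostLE.pure _
  | cons i is ih =>
    refine CostLE.mono (CostLE.op_bind (CostLE.bind (b := 2 + 7 * is.length) (costLE_fits ..) ?_))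
      (by rw [List.length_cons]; omega)
    split
    · exact CostLE.bind (costLE_push₂ ..) (ih _)
    · exact (CostLE.bind (CostLE.pure _) (ih _)).mono (by omega)

lemma costLE_fillUp (k : ℕ) (G : Fin n → Fin p) (size : Fin p → ℕ) (is : List (Fin n))
    (s : State₂ n p) : CostLE (fillUp k G size is s : Counted m _) (7 * is.length) := by
  induction is generalizing s with
  | nil => exact CostLE.pure _
  | cons i is ih =>
    refine CostLE.mono (CostLE.op_bind (CostLE.op_bind (CostLE.op_bind (CostLE.op_bind
      (CostLE.op_bind (b := 2 + 7 * is.length) ?_))))) (by rw [List.length_cons]; omega)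
    split
    · exact CostLE.bind (costLE_push₂ ..) (ih _)
    · exact (CostLE.bind (CostLE.pure _) (ih _)).mono (by omega)

lemma fillDown_cons_val (k : ℕ) (G : Fin n → Fin p) (size : Fin p → ℕ) (i : Fin n)
    (is : List (Fin n)) (s : State₂ n p) :
    (fillDown k G size (i :: is) s : Counted m _).val =
      if i ∉ s.S ∧ n * (s.cnt (G i) + 1) ≤ k * size (G i) then
        (fillDown k G size is (push₂ G s i : Counted m _).val : Counted m _).val
      else (fillDown k G size is s : Counted m _).val := by
  rw [fillDown, bind_val, bind_val]
  split <;> rename_i h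
  · change (decide (i ∉ s.S) &&
    decide (n * (s.cnt (G i) + 1) ≤ k * size (G i))) = true at h
    rw [if_pos (by simpa using h)]; rfl
  · change ¬(decide (i ∉ s.S) &&
    decide (n * (s.cnt (G i) + 1) ≤ k * size (G i))) = true at h
    rw [if_neg (by simpa using h)]; rfl

lemma fillUp_cons_val (k : ℕ) (G : Fin n → Fin p) (size : Fin p → ℕ) (i : Fin n)
    (is : List (Fin n)) (s : State₂ n p) :
    (fillUp k G size (i :: is) s : Counted m _).val =
      if i ∉ s.S ∧ s.total < k ∧ n * s.cnt (G i) < k * size (G i) then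
        (fillUp k G size is (push₂ G s i : Counted m _).val : Counted m _).val
      else (fillUp k G size is s : Counted m _).val := by
  rw [fillUp, bind_val, bind_val, bind_val, bind_val, bind_val]
  split <;> rename_i h
  · change (decide (i ∉ s.S) && decide (s.total < k) &&
    decide (n * s.cnt (G i) < k * size (G i))) = true at h
    rw [if_pos (by simpa [and_assoc] using h)]; rfl
  · change ¬(decide (i ∉ s.S) && decide (s.total < k) &&
    decide (n * s.cnt (G i) < k * size (G i))) = true at h
    rw [if_neg (by simpa [and_assoc] using h)]; rfl

/-- Filling up to the shares rounded down: the state stays valid, and an item is left over only if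
the share of its group does not allow one more item. -/
lemma fillDown_spec (k : ℕ) (G : Fin n → Fin p) (is : List (Fin n)) (s : State₂ n p)
    (h : Valid k G s) :
    Valid k G (fillDown k G (fun l => (members G l).card) is s : Counted m _).val ∧
    s.S ⊆ (fillDown k G (fun l => (members G l).card) is s : Counted m _).val.S ∧
    ∀ i ∈ is, i ∉ (fillDown k G (fun l => (members G l).card) is s : Counted m _).val.S →
      k * (members G (G i)).card <
        n * (((fillDown k G (fun l => (members G l).card) is s : Counted m _).val.S ∩
          members G (G i)).card + 1) := by
  induction is generalizing s with
  | nil => exact ⟨h, Subset.rfl, by simp⟩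
  | cons i is ih =>
    rw [fillDown_cons_val]
    by_cases hc : i ∉ s.S ∧ n * (s.cnt (G i) + 1) ≤ k * (members G (G i)).card
    · rw [if_pos hc]
      obtain ⟨h1, h2, h3⟩ := ih _ (h.push hc.1 hc.2 : Valid k G (push₂ G s i : Counted m _).val)
      refine ⟨h1, (subset_insert _ _).trans h2, fun i' hi' hn' => ?_⟩
      rcases List.mem_cons.1 hi' with rfl | hi'
      · exact absurd (h2 (mem_insert_self _ _)) hn'
      · exact h3 i' hi' hn'
    · rw [if_neg hc]
      obtain ⟨h1, h2, h3⟩ := ih s h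
      refine ⟨h1, h2, fun i' hi' hn' => ?_⟩
      rcases List.mem_cons.1 hi' with rfl | hi'
      · rw [not_and, not_le, h.cnt] at hc
        refine (hc fun hs => hn' (h2 hs)).trans_le (Nat.mul_le_mul_left _ (Nat.add_le_add_right
          (card_le_card (inter_subset_inter_right h2)) 1))
      · exact h3 i' hi' hn'

/-- `Valid` may fail here, as a group may exceed its exact share by rounding, so the counters and
the rounded bound are carried separately. The last clause is what will force `k` items: the output
stays too small only if every group with an item left over has reached its exact share. -/
lemma fillUp_spec (k : ℕ) (G : Fin n → Fin p) (is : List (Fin n)) (s : State₂ n p)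
    (ht : s.total = s.S.card) (hc : ∀ l, s.cnt l = (s.S ∩ members G l).card) (hk : s.S.card ≤ k)
    (hup : ∀ l, (s.S ∩ members G l).card ≤ ⌈((k : ℝ) * (members G l).card) / n⌉₊) :
    s.S ⊆ (fillUp k G (fun l => (members G l).card) is s : Counted m _).val.S ∧
    (fillUp k G (fun l => (members G l).card) is s : Counted m _).val.S.card ≤ k ∧
    (∀ l, ((fillUp k G (fun l => (members G l).card) is s : Counted m _).val.S ∩
      members G l).card ≤ ⌈((k : ℝ) * (members G l).card) / n⌉₊) ∧
    ∀ i ∈ is, i ∉ (fillUp k G (fun l => (members G l).card) is s : Counted m _).val.S →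
      (fillUp k G (fun l => (members G l).card) is s : Counted m _).val.S.card < k →
      k * (members G (G i)).card ≤
        n * ((fillUp k G (fun l => (members G l).card) is s : Counted m _).val.S ∩
          members G (G i)).card := by
  induction is generalizing s with
  | nil => exact ⟨Subset.rfl, hk, hup, by simp⟩
  | cons i is ih =>
    rw [fillUp_cons_val]
    by_cases hi : i ∉ s.S ∧ s.total < k ∧ n * s.cnt (G i) < k * (members G (G i)).card
    · rw [if_pos hi]
      obtain ⟨h1, h2, h3, h4⟩ := ih (push₂ G s i : Counted m _).val
        (by rw [push₂_val]; simp only [ht, card_insert_of_notMem hi.1])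
        (update_cnt_eq hc hi.1)
        (by rw [push₂_val, card_insert_of_notMem hi.1, ← ht]; exact hi.2.1)
        (by
          intro l
          rw [push₂_val, card_insert_inter_members G hi.1]
          by_cases hl : G i = l
          · subst hl
            rw [if_pos rfl, Nat.add_one_le_iff, Nat.lt_ceil, ← hc]
            have hn : (0 : ℝ) < n := by exact_mod_cast i.pos
            rw [lt_div_iff₀ hn, mul_comm]
            exact_mod_cast hi.2.2
          · rw [if_neg hl]; exact hup l)
      refine ⟨(subset_insert _ _).trans h1, h2, h3, fun i' hi' hn' => ?_⟩
      rcases List.mem_cons.1 hi' with rfl | hi'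
      · exact absurd (h1 (mem_insert_self _ _)) hn'
      · exact h4 i' hi' hn'
    · rw [if_neg hi]
      obtain ⟨h1, h2, h3, h4⟩ := ih s ht hc hk hup
      refine ⟨h1, h2, h3, fun i' hi' hn' => ?_⟩
      rcases List.mem_cons.1 hi' with rfl | hi'
      · intro hlt
        rw [not_and, not_and, not_lt, hc] at hi
        refine (hi (fun hs => hn' (h1 hs)) ?_).trans (Nat.mul_le_mul_left _
          (card_le_card (inter_subset_inter_right h1)))
        rw [ht]
        exact (card_le_card h1).trans_lt hlt
      · exact h4 i' hi' hn'

/-- The outcome of the second part. -/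
noncomputable def chosen [NeZero p] (g : Fin m → ℝ → ℝ) (What : Fin n → Fin m → ℝ) (k : ℕ)
    (G : Fin n → Fin p) (C : Fin m → Finset (Fin n)) : State₂ n p :=
  (part₂ g What k G C (fun l => (members G l).card) (members G 0).card (Nat.sqrt k)
    (part₁ g What k G C (members G 0).card (Nat.sqrt k)).val (active C) ⟨∅, 0, 0⟩).val

lemma fairGreedy_val [NeZero p] (g : Fin m → ℝ → ℝ) (What : Fin n → Fin m → ℝ) (k : ℕ)
    (G : Fin n → Fin p) (C : Fin m → Finset (Fin n)) :
    (fairGreedy g What k G C).val =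
      (fillUp k G (fun l => (members G l).card) (List.finRange n)
        (fillDown k G (fun l => (members G l).card) (List.finRange n)
          (chosen g What k G C) : Counted m _).val : Counted m _).val.S := by
  simp only [fairGreedy, bind_val, op_val, pure_val, sizes_finRange_val, chosen]

lemma valid_chosen [NeZero p] (g : Fin m → ℝ → ℝ) (What : Fin n → Fin m → ℝ) (k : ℕ)
    (G : Fin n → Fin p) (C : Fin m → Finset (Fin n)) : Valid k G (chosen g What k G C) :=
  valid_part₂ _ _ _ _ _ _ _ _ _ _ (valid_empty k G)

lemma le_ceil_of_share {k c s : ℕ} (hn : 0 < n) (h : n * c ≤ k * s) :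
    c ≤ ⌈((k : ℝ) * s) / n⌉₊ := by
  have hn' : (0 : ℝ) < n := by exact_mod_cast hn
  have : (c : ℝ) ≤ (k : ℝ) * s / n := by
    rw [le_div_iff₀ hn', mul_comm]
    exact_mod_cast h
  exact_mod_cast this.trans (Nat.le_ceil _)

lemma fairGreedy_spec [NeZero p] (g : Fin m → ℝ → ℝ) (What : Fin n → Fin m → ℝ) (k : ℕ)
    (G : Fin n → Fin p) (C : Fin m → Finset (Fin n)) (hk : 1 ≤ k) (hkn : k ≤ n) :
    (chosen g What k G C).S ⊆ (fairGreedy g What k G C).val ∧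
    (fairGreedy g What k G C).val.card = k ∧ IsProportional G k (fairGreedy g What k G C).val := by
  have hn : 0 < n := by omega
  have hV := valid_chosen g What k G C
  rw [fairGreedy_val]
  obtain ⟨a1, a2, a3⟩ := fillDown_spec (m := m) k G (List.finRange n) _ hV
  set s := (fillDown k G (fun l => (members G l).card) (List.finRange n)
          (chosen g What k G C) : Counted m _).val
  obtain ⟨b1, b2, b3, b4⟩ := fillUp_spec (m := m) k G (List.finRange n) s a1.total a1.cnt
    (a1.total ▸ a1.total_le hn)
    (fun l => le_ceil_of_share hn (by rw [← a1.cnt]; exact a1.share l))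
  set s' := (fillUp k G (fun l => (members G l).card) (List.finRange n) s : Counted m _).val
  refine ⟨a2.trans b1, ?_, fun l => ⟨?_, b3 l⟩⟩
  · refine le_antisymm b2 (not_lt.1 fun hlt => ?_)
    -- With fewer than `k` items, every group would have at least its exact share: by `fillUp_spec`
    -- if an item is left over, and because `k ≤ n` if the group is used up. Summing over the groups
    -- gives a contradiction.
    have h1 : ∀ l, k * (members G l).card ≤ n * (s'.S ∩ members G l).card := by
      intro l
      by_cases hall : members G l ⊆ s'.S
      · rw [inter_eq_right.2 hall]
        exact Nat.mul_le_mul_right _ hkn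
      · obtain ⟨i, hi, his⟩ := not_subset.1 hall
        obtain rfl := mem_members.1 hi
        exact b4 i (List.mem_finRange i) his hlt
    have h2 := sum_le_sum fun l (_ : l ∈ univ) => h1 l
    rw [← mul_sum, ← mul_sum, sum_card_members, sum_card_inter_members, mul_comm] at h2
    exact absurd (Nat.le_of_mul_le_mul_left h2 hn) (not_le.2 hlt)
  -- The rounded-down share is already reached after `fillDown`: either the group is used up, or one
  -- more item would exceed the share.
  · have h1 : k * (members G l).card / n ≤ (s.S ∩ members G l).card := by
      by_cases hall : members G l ⊆ s.S
      · rw [inter_eq_right.2 hall]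
        exact Nat.div_le_of_le_mul (Nat.mul_le_mul_right _ hkn)
      · obtain ⟨i, hi, his⟩ := not_subset.1 hall
        obtain rfl := mem_members.1 hi
        exact Nat.lt_succ_iff.1 ((Nat.div_lt_iff_lt_mul hn).2
          (by rw [mul_comm _ n]; exact a3 i (List.mem_finRange i) his))
    exact h1.trans (card_le_card (inter_subset_inter_right b1))

lemma costLE_fairGreedy [NeZero p] (g : Fin m → ℝ → ℝ) (What : Fin n → Fin m → ℝ) (k : ℕ)
    (G : Fin n → Fin p) (C : Fin m → Finset (Fin n))
    (hC : ∀ j j', j ≠ j' → Disjoint (C j) (C j')) (hk : 1 ≤ k) (hkn : k ≤ n) :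
    CostLE (fairGreedy g What k G C) (120 * (n * k)) := by
  have hn : 0 < n := by omega
  have hcost : CostLE (fairGreedy g What k G C) (n + ((36 * (n * k) + 3 * k + 5 +
      ((k + 1) * (15 * n + 4 * n) + 3 * n + (7 * n + (7 * n + 0)))) + 1)) := by
    refine CostLE.bind ?_ (CostLE.op_bind (CostLE.bind ?_ (CostLE.bind ?_ (CostLE.bind ?_
      (CostLE.bind ?_ (CostLE.pure _))))))
    · simpa using costLE_sizes (m := m) G (List.finRange n)
    · rw [sizes_finRange_val]
      exact costLE_part₁ _ _ _ _ _ _ _ hC (by simpa using card_le_univ (members G 0))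
        (Nat.sqrt_le_self k)
    · rw [sizes_finRange_val]
      refine (costLE_part₂ _ _ _ _ _ _ _ _ hn _ _ (valid_empty k G)).mono ?_
      have h1 := sum_active_card_le C hC
      have h2 := length_active_le C hC
      exact add_le_add (Nat.mul_le_mul_left _ (by omega)) (by omega)
    · simpa using costLE_fillDown (m := m) k G _ (List.finRange n) _
    · simpa using costLE_fillUp (m := m) k G _ (List.finRange n) _
  -- The sum is `55 * n * k + 37 * n + 3 * k + 6`, and `n`, `k` and `1` are at most `n * k`.
  refine hcost.mono ?_
  have h1 : n ≤ n * k := Nat.le_mul_of_pos_right n hk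
  have h2 : k ≤ n * k := Nat.le_mul_of_pos_left k hn
  nlinarith

end Proportional

/-! ### Greedy selection in the first group is exactly optimal -/

section PartOne

variable {n m p : ℕ} {W : Fin n → Fin m → ℝ}

lemma mem_category {i : Fin n} {j : Fin m} : i ∈ category W j ↔ 0 < W i j := by
  simp [category]

lemma eq_zero_of_mem_category (hW : ∀ i j, 0 ≤ W i j)
    (hC : ∀ j j', j ≠ j' → Disjoint (category W j) (category W j')) {i : Fin n} {j j' : Fin m}
    (hi : i ∈ category W j) (hj : j' ≠ j) : W i j' = 0 := by
  by_contra h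
  exact disjoint_left.1 (hC j' j hj) (mem_category.2 (lt_of_le_of_ne (hW i j') (Ne.symm h))) hi

/-- The running values stored in a state of the first part are correct. -/
structure Tracks (W : Fin n → Fin m → ℝ) (scale : ℝ) (s : State₁ n m) : Prop where
  base : ∀ j, s.base j = scale * ∑ i ∈ s.S, W i j
  cnt : ∀ j, s.cnt j = (s.S ∩ category W j).card

lemma push₁_val (What : Fin n → Fin m → ℝ) (scale : ℝ) (s : State₁ n m) (c : Fin m × Fin n) :
    (push₁ What scale s c).val = ⟨insert c.2 s.S,
      Function.update s.base c.1 (s.base c.1 + scale * What c.2 c.1),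
      Function.update s.cnt c.1 (s.cnt c.1 + 1)⟩ := rfl

lemma Tracks.push {What : Fin n → Fin m → ℝ} {scale : ℝ} {s : State₁ n m} (h : Tracks W scale s)
    (hW : ∀ i j, 0 ≤ W i j)
    (hC : ∀ j j', j ≠ j' → Disjoint (category W j) (category W j'))
    {j : Fin m} {i : Fin n} (hi : i ∈ category W j) (hs : i ∉ s.S) (ho : What i j = W i j) :
    Tracks W scale (push₁ What scale s (j, i)).val := by
  rw [push₁_val]
  refine ⟨fun j' => ?_, fun j' => ?_⟩
  · simp only [sum_insert hs]
    by_cases hj : j' = j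
    · subst hj
      rw [Function.update_self, h.base, ho]; ring
    · rw [Function.update_of_ne hj, h.base, eq_zero_of_mem_category hW hC hi hj, zero_add]
  · simp only
    by_cases hj : j' = j
    · subst hj
      rw [Function.update_self, h.cnt, insert_inter_of_mem hi,
        card_insert_of_notMem (by simp [hs])]
    · rw [Function.update_of_ne hj, h.cnt, insert_inter_of_notMem]
      exact fun h' => disjoint_left.1 (hC j' j hj) h' hi

/-- `rank` is arbitrary since these facts do not depend on how candidates are ranked; they serve
both the initial choice by individual gains and the main greedy run. -/
lemma greedy₁_spec [NeZero p] (g : Fin m → ℝ → ℝ) (What : Fin n → Fin m → ℝ) (G : Fin n → Fin p)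
    (scale : ℝ) (rank : State₁ n m → Fin m → ℝ) (cands : List (Fin m × Fin n))
    (hW : ∀ i j, 0 ≤ W i j) (hC : ∀ j j', j ≠ j' → Disjoint (category W j) (category W j'))
    (ho : ∀ i j, G i = 0 → What i j = W i j)
    (hcands : ∀ c ∈ cands, c.2 ∈ category W c.1) (t : ℕ) (s : State₁ n m) (h : Tracks W scale s) :
    Tracks W scale (greedy₁ g What G scale rank cands t s).val ∧
    s.S ⊆ (greedy₁ g What G scale rank cands t s).val.S ∧
    (∀ i ∈ (greedy₁ g What G scale rank cands t s).val.S, i ∉ s.S →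
      G i = 0 ∧ ∃ c ∈ cands, c.2 = i) ∧
    (greedy₁ g What G scale rank cands t s).val.S.card ≤ s.S.card + t ∧
    ((greedy₁ g What G scale rank cands t s).val.S.card = s.S.card + t ∨
      ∀ c ∈ cands, G c.2 = 0 → c.2 ∈ (greedy₁ g What G scale rank cands t s).val.S) := by
  induction t generalizing s with
  | zero => exact ⟨h, Subset.rfl, fun i hi hi' => absurd hi hi', le_rfl, Or.inl rfl⟩
  | succ t ih =>
    cases hb : (best g What scale (rank s) (fun i => op (decide (G i = 0 ∧ i ∉ s.S))) cands).val with
    | none =>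
      have hv : (greedy₁ g What G scale rank cands (t + 1) s).val = s := by
        simp only [greedy₁, bind_val, hb, pure_val]
      rw [hv]
      refine ⟨h, Subset.rfl, fun i hi hi' => absurd hi hi', by omega, Or.inr fun c hc h0 => ?_⟩
      have := best_none hb c hc
      simpa [h0] using this
    | some dy =>
      obtain ⟨⟨j, i⟩, y⟩ := dy
      obtain ⟨hd, hok, -⟩ := best_some hb
      have hv : (greedy₁ g What G scale rank cands (t + 1) s).val =
          (greedy₁ g What G scale rank cands t (push₁ What scale s (j, i)).val).val := by
        simp only [greedy₁, bind_val, hb]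
      rw [hv]
      have hok' : G i = 0 ∧ i ∉ s.S := by simpa using hok
      obtain ⟨h1, h2, h3, h4, h5⟩ := ih (push₁ What scale s (j, i)).val
        (h.push hW hC (hcands _ hd) hok'.2 (ho _ _ hok'.1))
      have hS : (push₁ What scale s (j, i)).val.S = insert i s.S := rfl
      rw [hS, card_insert_of_notMem hok'.2] at h4 h5
      rw [hS] at h2 h3
      refine ⟨h1, (subset_insert _ _).trans h2, fun i' hi' hs' => ?_, by omega,
        h5.imp (fun h => by omega) id⟩
      by_cases hii : i' = i
      · subst hii
        exact ⟨hok'.1, _, hd, rfl⟩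
      · exact h3 i' hi' (by simp [hii, hs'])

/-- Disjointness keeps the runs apart: a run adds items of its own category only, so the number
reached in a category is not changed by later runs. -/
lemma initial₁_spec [NeZero p] (g : Fin m → ℝ → ℝ) (What : Fin n → Fin m → ℝ) (G : Fin n → Fin p)
    (scale : ℝ) (r : ℕ)
    (hW : ∀ i j, 0 ≤ W i j) (hC : ∀ j j', j ≠ j' → Disjoint (category W j) (category W j'))
    (ho : ∀ i j, G i = 0 → What i j = W i j) (js : List (Fin m)) (hjs : js.Nodup)
    (s : State₁ n m) (h : Tracks W scale s) (hs : ∀ j ∈ js, s.S ∩ category W j = ∅) :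
    Tracks W scale (initial₁ g What G (category W) scale r js s).val ∧
    (∀ j, j ∉ js → (initial₁ g What G (category W) scale r js s).val.S ∩ category W j =
      s.S ∩ category W j) ∧
    (∀ j ∈ js, ((initial₁ g What G (category W) scale r js s).val.S ∩ category W j).card =
      min r (category W j ∩ members G 0).card) ∧
    (∀ i ∈ (initial₁ g What G (category W) scale r js s).val.S, i ∉ s.S →
      G i = 0 ∧ ∃ j, i ∈ category W j) := by
  induction js generalizing s with
  | nil => exact ⟨h, fun _ _ => rfl, by simp, fun i hi hi' => absurd hi hi'⟩
  | cons j js ih =>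
    obtain ⟨a1, a2, a3, a4, a5⟩ := greedy₁_spec g What G scale (fun _ _ => 0)
      (pairs (category W) j) hW hC ho
      (fun c hc => by obtain ⟨rfl, h'⟩ := mem_pairs.1 hc; exact h') r s h
    simp only [initial₁, bind_val]
    set s' := (greedy₁ g What G scale (fun _ _ => 0) (pairs (category W) j) r s).val
    have hnew : ∀ i ∈ s'.S, i ∉ s.S → G i = 0 ∧ i ∈ category W j := by
      intro i hi hi'
      obtain ⟨h0, c, hc, rfl⟩ := a3 i hi hi'
      exact ⟨h0, (mem_pairs.1 hc).2⟩
    have hother : ∀ j', j' ≠ j → s'.S ∩ category W j' = s.S ∩ category W j' := by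
      intro j' hj'
      refine Subset.antisymm (fun i hi => ?_) (inter_subset_inter_right a2)
      rw [mem_inter] at hi ⊢
      refine ⟨by_contra fun his => ?_, hi.2⟩
      exact disjoint_left.1 (hC j' j hj') hi.2 (hnew i hi.1 his).2
    have hjj : s'.S ∩ category W j = s'.S \ s.S := by
      ext i
      rw [mem_inter, mem_sdiff]
      refine and_congr_right fun hi => ⟨fun hij his => ?_, fun his => (hnew i hi his).2⟩
      have := mem_inter.2 ⟨his, hij⟩
      rw [hs j (by simp)] at this
      simp at this
    have hcard : (s'.S ∩ category W j).card = min r (category W j ∩ members G 0).card := by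
      have h1 : (s'.S ∩ category W j).card + s.S.card = s'.S.card := by
        rw [hjj, card_sdiff_add_card_eq_card a2]
      have h2 : s'.S ∩ category W j ⊆ category W j ∩ members G 0 := by
        intro i hi
        have := hi
        rw [hjj, mem_sdiff] at this
        exact mem_inter.2 ⟨(mem_inter.1 hi).2, mem_members.2 (hnew i this.1 this.2).1⟩
      have h3 := card_le_card h2
      rcases a5 with a5 | a5
      · rw [min_eq_left (by omega)]; omega
      · have h4 : category W j ∩ members G 0 ⊆ s'.S ∩ category W j := by
          intro i hi
          rw [mem_inter] at hi ⊢
          exact ⟨a5 (j, i) (mem_pairs.2 ⟨rfl, hi.1⟩) (mem_members.1 hi.2), hi.1⟩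
        have h5 := card_le_card h4
        rw [min_eq_right (by omega)]; omega
    have hj : j ∉ js := (List.nodup_cons.1 hjs).1
    obtain ⟨b1, b2, b3, b4⟩ := ih (List.nodup_cons.1 hjs).2 s' a1 (fun j' hj' => by
      rw [hother j' (fun h => hj (h ▸ hj'))]
      exact hs j' (List.mem_cons_of_mem _ hj'))
    refine ⟨b1, fun j' hj' => ?_, fun j' hj' => ?_, fun i hi his => ?_⟩
    · rw [List.mem_cons, not_or] at hj'
      rw [b2 j' hj'.2, hother j' hj'.1]
    · rcases List.mem_cons.1 hj' with rfl | hj'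
      · rw [b2 _ hj, hcard]
      · exact b3 j' hj'
    · by_cases his' : i ∈ s'.S
      · exact ⟨(hnew i his' his).1, j, (hnew i his' his).2⟩
      · exact b4 i hi his'

/-- Both `a + x` and `b` lie between `a` and `b + x`, as convex combinations with interchanged
weights. Adding the two concavity inequalities gives the claim. -/
lemma gain_antitone {g : ℝ → ℝ} (hg : ConcaveOn ℝ (Set.Ici 0) g) {a b x : ℝ} (ha : 0 ≤ a)
    (hab : a ≤ b) (hx : 0 ≤ x) : g (b + x) - g b ≤ g (a + x) - g a := by
  rcases (add_nonneg (sub_nonneg.2 hab) hx).eq_or_lt with h0 | h0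
  · obtain rfl : x = 0 := by linarith
    simp
  have hd := h0.ne'
  have h1 := hg.2 (Set.mem_Ici.2 ha) (Set.mem_Ici.2 (show 0 ≤ b + x by linarith))
    (show 0 ≤ (b - a) / (b - a + x) from div_nonneg (by linarith) h0.le)
    (show 0 ≤ x / (b - a + x) from div_nonneg hx h0.le) (by field_simp)
  have h2 := hg.2 (Set.mem_Ici.2 ha) (Set.mem_Ici.2 (show 0 ≤ b + x by linarith))
    (show 0 ≤ x / (b - a + x) from div_nonneg hx h0.le)
    (show 0 ≤ (b - a) / (b - a + x) from div_nonneg (by linarith) h0.le) (by field_simp; ring)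
  simp only [smul_eq_mul] at h1 h2
  have e1 : (b - a) / (b - a + x) * a + x / (b - a + x) * (b + x) = a + x := by
    field_simp; ring
  have e2 : x / (b - a + x) * a + (b - a) / (b - a + x) * (b + x) = b := by
    field_simp; ring
  rw [e1] at h1
  rw [e2] at h2
  have e3 : (b - a) / (b - a + x) + x / (b - a + x) = 1 := by field_simp
  nlinarith [congrArg (· * g a) e3, congrArg (· * g (b + x)) e3]

/-- By disjointness, an item changes the summand of its own category only. This separability is what
makes the exchange argument exact. -/
lemma utility_scaled_insert (g : Fin m → ℝ → ℝ) (scale : ℝ) (hW : ∀ i j, 0 ≤ W i j)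
    (hC : ∀ j j', j ≠ j' → Disjoint (category W j) (category W j')) {S : Finset (Fin n)}
    {i : Fin n} {j : Fin m} (hi : i ∈ category W j) (hS : i ∉ S) :
    ∑ j', g j' (scale * ∑ x ∈ insert i S, W x j') = ∑ j', g j' (scale * ∑ x ∈ S, W x j') +
      (g j (scale * ∑ x ∈ S, W x j + scale * W i j) - g j (scale * ∑ x ∈ S, W x j)) := by
  rw [← add_sum_erase _ _ (mem_univ j),
    ← add_sum_erase _ (fun j' => g j' (scale * ∑ x ∈ S, W x j')) (mem_univ j)]
  have h1 : ∀ j' ∈ univ.erase j, g j' (scale * ∑ x ∈ insert i S, W x j') =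
      g j' (scale * ∑ x ∈ S, W x j') := by
    intro j' hj'
    rw [sum_insert hS, eq_zero_of_mem_category hW hC hi (ne_of_mem_erase hj'), zero_add]
  rw [sum_congr rfl h1, sum_insert hS, mul_add, add_comm (scale * W i j)]
  ring

/-- Exchanging an item of `T \ S` for a best unused item does not lower the scaled objective. -/
lemma exchange (g : Fin m → ℝ → ℝ) (hg : ∀ j, IsGain (g j)) {scale : ℝ} (hscale : 0 ≤ scale)
    (hW : ∀ i j, 0 ≤ W i j) (hC : ∀ j j', j ≠ j' → Disjoint (category W j) (category W j'))
    {S T : Finset (Fin n)} (hST : S ⊆ T) {i : Fin n} {j : Fin m} (hi : i ∈ category W j)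
    (hiT : i ∉ T) (hT : ∀ x ∈ T, x ∉ S → ∃ j', x ∈ category W j')
    (hbest : ∀ x ∈ T, x ∉ S → ∀ j', x ∈ category W j' →
      g j' (scale * ∑ y ∈ S, W y j' + scale * W x j') - g j' (scale * ∑ y ∈ S, W y j') ≤
        g j (scale * ∑ y ∈ S, W y j + scale * W i j) - g j (scale * ∑ y ∈ S, W y j))
    (htie : ∀ x ∈ T, x ∉ S → x ∈ category W j → W x j ≤ W i j) (hne : (T \ S).Nonempty) :
    ∃ x ∈ T, x ∉ S ∧ ∑ j', g j' (scale * ∑ y ∈ T, W y j') ≤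
      ∑ j', g j' (scale * ∑ y ∈ insert i (T.erase x), W y j') := by
  have hsum : ∀ (A : Finset (Fin n)) j', 0 ≤ scale * ∑ y ∈ A, W y j' := fun A j' =>
    mul_nonneg hscale (sum_nonneg fun y _ => hW y j')
  -- An item of the same category outside `S` can be replaced by `i` directly, since it has no
  -- larger utility (`htie`).
  by_cases hx : ∃ x ∈ T, x ∉ S ∧ x ∈ category W j
  · obtain ⟨x, hxT, hxS, hxj⟩ := hx
    refine ⟨x, hxT, hxS, sum_le_sum fun j' _ => ?_⟩
    refine (hg j').mono (hsum _ _) (hsum _ _) (mul_le_mul_of_nonneg_left ?_ hscale)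
    rw [sum_insert (fun h => hiT (mem_of_mem_erase h)), ← add_sum_erase _ _ hxT]
    refine add_le_add_left ?_ _
    by_cases hj : j' = j
    · subst hj; exact htie x hxT hxS hxj
    · rw [eq_zero_of_mem_category hW hC hxj hj]; exact hW _ _
  -- Now `T` has no item of category `j` outside `S`, so `i` gains over `T.erase x` exactly what it
  -- gains over `S`. By concavity, `x` gains over `T.erase x` no more than over `S`, hence no more
  -- than `i`.
  · push Not at hx
    obtain ⟨x, hx'⟩ := hne
    obtain ⟨hxT, hxS⟩ := mem_sdiff.1 hx'
    obtain ⟨j', hxj'⟩ := hT x hxT hxS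
    have hj : j' ≠ j := fun h => hx x hxT hxS (h ▸ hxj')
    refine ⟨x, hxT, hxS, ?_⟩
    have hiE : i ∉ T.erase x := fun h => hiT (mem_of_mem_erase h)
    rw [utility_scaled_insert g scale hW hC hi hiE]
    conv_lhs => rw [← insert_erase hxT]
    rw [utility_scaled_insert g scale hW hC hxj' (notMem_erase x T)]
    refine add_le_add_right ?_ _
    have hSE : S ⊆ T.erase x := fun y hy => mem_erase.2 ⟨fun h => hxS (h ▸ hy), hST hy⟩
    have e1 : ∑ y ∈ T.erase x, W y j = ∑ y ∈ S, W y j := by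
      refine (sum_subset hSE fun y hy hyS => ?_).symm
      by_contra h
      exact hx y (mem_of_mem_erase hy) hyS (mem_category.2 (lt_of_le_of_ne (hW y j) (Ne.symm h)))
    rw [e1]
    refine le_trans (gain_antitone (hg j').concave (hsum S j') ?_
      (mul_nonneg hscale (hW x j'))) (hbest x hxT hxS j' hxj')
    exact mul_le_mul_of_nonneg_left (sum_le_sum_of_subset_of_nonneg hSE fun y _ _ => hW y j')
      hscale

/-- The induction keeps a competitor `T` that contains the current state. After each choice it is
altered, by `exchange` or by plain insertion, so that it contains the new item without losing value;
unless nothing was left to match, its excess over the state shrinks by one, as does the remaining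
number of steps. -/
lemma greedy₁_optimal [NeZero p] (g : Fin m → ℝ → ℝ) (hg : ∀ j, IsGain (g j))
    (What : Fin n → Fin m → ℝ) (G : Fin n → Fin p) {scale : ℝ} (hscale : 0 < scale)
    (cands : List (Fin m × Fin n))
    (hW : ∀ i j, 0 ≤ W i j) (hC : ∀ j j', j ≠ j' → Disjoint (category W j) (category W j'))
    (ho : ∀ i j, G i = 0 → What i j = W i j)
    (hcands : ∀ c, c ∈ cands ↔ c.2 ∈ category W c.1) (t : ℕ) (s : State₁ n m)
    (h : Tracks W scale s) (T : Finset (Fin n)) (hsT : s.S ⊆ T)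
    (hT : ∀ x ∈ T, x ∉ s.S → G x = 0 ∧ ∃ j, x ∈ category W j) (ht : (T \ s.S).card ≤ t) :
    ∑ j, g j (scale * ∑ i ∈ T, W i j) ≤ ∑ j, g j (scale *
      ∑ i ∈ (greedy₁ g What G scale State₁.base cands t s).val.S, W i j) := by
  induction t generalizing s T with
  | zero =>
    have h0 : T ⊆ s.S := sdiff_eq_empty_iff_subset.1 (card_eq_zero.1 (by omega))
    rw [Subset.antisymm h0 hsT]
    exact le_rfl
  | succ t ih =>
    cases hb : (best g What scale (State₁.base s) (fun i => op (decide (G i = 0 ∧ i ∉ s.S)))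
      cands).val with
    | none =>
      have hv : (greedy₁ g What G scale State₁.base cands (t + 1) s).val = s := by
        simp only [greedy₁, bind_val, hb, pure_val]
      rw [hv]
      have h0 : T ⊆ s.S := by
        intro x hx
        by_contra hxs
        obtain ⟨h0, j, hj⟩ := hT x hx hxs
        have := best_none hb (j, x) ((hcands _).2 hj)
        simp [h0, hxs] at this
      rw [Subset.antisymm h0 hsT]
    | some dy =>
      obtain ⟨⟨j, i⟩, y⟩ := dy
      obtain ⟨hd, hok, hmax⟩ := best_some hb
      have hv : (greedy₁ g What G scale State₁.base cands (t + 1) s).val =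
          (greedy₁ g What G scale State₁.base cands t (push₁ What scale s (j, i)).val).val := by
        simp only [greedy₁, bind_val, hb]
      rw [hv]
      obtain ⟨hi0, his⟩ : G i = 0 ∧ i ∉ s.S := by simpa using hok
      have hij : i ∈ category W j := (hcands _).1 hd
      have hS : (push₁ What scale s (j, i)).val.S = insert i s.S := rfl
      have hpush := h.push hW hC hij his (ho i j hi0)
      have hsum : ∀ (A : Finset (Fin n)) j', 0 ≤ scale * ∑ y ∈ A, W y j' := fun A j' =>
        mul_nonneg hscale.le (sum_nonneg fun y _ => hW y j')
      have hmax' : ∀ x, x ∉ s.S → G x = 0 → ∀ j', x ∈ category W j' →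
          gain g What scale s.base (j', x) < gain g What scale s.base (j, i) ∨
          (gain g What scale s.base (j', x) = gain g What scale s.base (j, i) ∧
            W x j' ≤ W i j) := by
        intro x hxs hx0 j' hxj'
        have := hmax (j', x) ((hcands _).2 hxj') (by simp [hx0, hxs])
        rwa [ho x j' hx0, ho i j hi0] at this
      by_cases hiT : i ∈ T
      · refine ih _ hpush T (by rw [hS]; exact insert_subset hiT hsT) (fun x hx hxs => ?_) ?_
        · rw [hS] at hxs
          exact hT x hx fun h => hxs (mem_insert_of_mem h)
        · rw [hS, sdiff_insert, card_erase_of_mem (mem_sdiff.2 ⟨hiT, his⟩)]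
          omega
      by_cases hne : (T \ s.S).Nonempty
      · obtain ⟨x, hxT, hxs, hle⟩ := exchange g hg hscale.le hW hC hsT hij hiT
          (fun x hx hxs => (hT x hx hxs).2)
          (fun x hx hxs j' hxj' => by
            have := hmax' x hxs (hT x hx hxs).1 j' hxj'
            simp only [gain, h.base, ho x j' (hT x hx hxs).1, ho i j hi0] at this
            rcases this with h1 | h1
            · exact h1.le
            · exact h1.1.le)
          (fun x hx hxs hxj => by
            rcases hmax' x hxs (hT x hx hxs).1 j hxj with h1 | h1
            · simp only [gain, h.base, ho x j (hT x hx hxs).1, ho i j hi0] at h1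
              -- In the same category a larger utility yields at least the same gain, which excludes
              -- a strictly smaller gain.
              by_contra hlt
              push Not at hlt
              refine absurd h1 (not_lt.2 (sub_le_sub_right ((hg j).mono ?_ ?_ ?_) _))
              · exact Set.mem_Ici.2 (add_nonneg (hsum _ _) (mul_nonneg hscale.le (hW _ _)))
              · exact Set.mem_Ici.2 (add_nonneg (hsum _ _) (mul_nonneg hscale.le (hW _ _)))
              · exact add_le_add_right (mul_le_mul_of_nonneg_left hlt.le hscale.le) _
            · exact h1.2) hne
        refine hle.trans (ih _ hpush (insert i (T.erase x)) ?_ (fun y hy hys => ?_) ?_)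
        · rw [hS]
          exact insert_subset_insert _ fun y hy => mem_erase.2 ⟨fun h => hxs (h ▸ hy), hsT hy⟩
        · rw [hS, mem_insert, not_or] at hys
          rcases mem_insert.1 hy with rfl | hy
          · exact absurd rfl hys.1
          · exact hT y (mem_of_mem_erase hy) hys.2
        · rw [hS]
          have hsub : insert i (T.erase x) \ insert i s.S ⊆ (T \ s.S).erase x := by
            intro y hy
            simp only [mem_sdiff, mem_insert, mem_erase, not_or] at hy ⊢
            tauto
          have := card_le_card hsub
          rw [card_erase_of_mem (mem_sdiff.2 ⟨hxT, hxs⟩)] at this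
          omega
      · have h0 : T = s.S :=
          Subset.antisymm (sdiff_eq_empty_iff_subset.1 (not_nonempty_iff_eq_empty.1 hne)) hsT
        subst h0
        have hle : ∑ j', g j' (scale * ∑ i ∈ s.S, W i j') ≤
            ∑ j', g j' (scale * ∑ i ∈ insert i s.S, W i j') :=
          sum_le_sum fun j' _ => (hg j').mono (hsum _ _) (hsum _ _) (mul_le_mul_of_nonneg_left
            (sum_le_sum_of_subset_of_nonneg (subset_insert _ _) fun y _ _ => hW y j') hscale.le)
        refine hle.trans (ih _ hpush (insert i s.S) Subset.rfl (fun x hx hxs => absurd hx hxs) ?_)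
        rw [hS]; simp

end PartOne

/-! ### Selection inside the categories takes the best items of every group -/

section PartTwo

variable {n m p : ℕ}

/-- Within every group, the items of `C` chosen in `S` have the largest values of `w`. -/
def IsUpper (G : Fin n → Fin p) (w : Fin n → ℝ) (C S : Finset (Fin n)) : Prop :=
  ∀ i ∈ S ∩ C, ∀ i' ∈ C, i' ∉ S → G i' = G i → w i' ≤ w i

/-- Within a category all gains are measured from the same base, so, with the tie-break, every step
takes an eligible item of largest observed utility. Eligibility of an unused item depends on its
group only; hence each group is used from the top. The two alternatives at the end are the two
shares that can block a group. -/
lemma greedy₂_spec (g : Fin m → ℝ → ℝ) (What : Fin n → Fin m → ℝ) (k : ℕ) (G : Fin n → Fin p)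
    (C : Fin m → Finset (Fin n)) (j : Fin m) (hg : MonotoneOn (g j) (Set.Ici 0))
    (hnonneg : ∀ i, 0 ≤ What i j) (hn : 0 < n) (kj : ℕ) (t : ℕ) (base : ℝ) (cj : Fin p → ℕ)
    (s : State₂ n p) (h : Valid k G s) (hbase : 0 ≤ base)
    (hcj : ∀ l, cj l = ((s.S ∩ C j) ∩ members G l).card) (ht : t + (s.S ∩ C j).card = kj)
    (hshare : ∀ l, n * ((s.S ∩ C j) ∩ members G l).card ≤ kj * (members G l).card)
    (hup : IsUpper G (fun i => What i j) (C j) s.S) :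
    s.S ⊆ (greedy₂ g What k G C (fun l => (members G l).card) j kj t base cj s).val.S ∧
    (∀ i ∈ (greedy₂ g What k G C (fun l => (members G l).card) j kj t base cj s).val.S,
      i ∉ s.S → i ∈ C j) ∧
    IsUpper G (fun i => What i j) (C j)
      (greedy₂ g What k G C (fun l => (members G l).card) j kj t base cj s).val.S ∧
    (∀ l, n * (((greedy₂ g What k G C (fun l => (members G l).card) j kj t base cj s).val.S ∩ C j) ∩
      members G l).card ≤ kj * (members G l).card) ∧
    ∀ i ∈ C j, i ∉ (greedy₂ g What k G C (fun l => (members G l).card) j kj t base cj s).val.S →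
      kj * (members G (G i)).card <
        n * ((((greedy₂ g What k G C (fun l => (members G l).card) j kj t base cj s).val.S ∩ C j) ∩
          members G (G i)).card + 1) ∨
      k * (members G (G i)).card <
        n * (((greedy₂ g What k G C (fun l => (members G l).card) j kj t base cj s).val.S ∩
          members G (G i)).card + 1) := by
  induction t generalizing base cj s with
  | zero =>
    refine ⟨Subset.rfl, fun i hi hi' => absurd hi hi', hup, hshare, fun i hi his => Or.inl ?_⟩
    change _ < n * (((s.S ∩ C j) ∩ members G (G i)).card + 1)
    -- All `kj` steps succeeded. The category shares of the groups then hold with equality in the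
    -- sum, hence in every group, and no group has room for another item.
    have hsum : ∑ l, n * ((s.S ∩ C j) ∩ members G l).card = ∑ l, kj * (members G l).card := by
      rw [← mul_sum, ← mul_sum, sum_card_inter_members, sum_card_members, ← ht, zero_add, mul_comm]
    have := (sum_eq_sum_iff_of_le (fun l _ => hshare l)).1 hsum (G i) (mem_univ _)
    rw [← this, mul_add, mul_one]
    omega
  | succ t ih =>
    cases hb : (best g What 1 (fun _ => base)
      (canAdd G (fun l => (members G l).card) k kj s cj) (pairs C j)).val with
    | none =>
      have hv : (greedy₂ g What k G C (fun l => (members G l).card) j kj (t + 1) base cj s).val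
          = s := by
        simp only [greedy₂, bind_val, hb, pure_val]
      rw [hv]
      refine ⟨Subset.rfl, fun i hi hi' => absurd hi hi', hup, hshare, fun i hi his => ?_⟩
      have h1 := best_none hb (j, i) (mem_pairs.2 ⟨rfl, hi⟩)
      by_contra hcon
      push Not at hcon
      rw [← hcj, ← h.cnt] at hcon
      rw [canAdd_val.2 ⟨his, hcon.1, hcon.2⟩] at h1
      exact absurd h1 (by simp)
    | some dy =>
      obtain ⟨⟨j', i⟩, y⟩ := dy
      obtain ⟨hd, hok, hmax⟩ := best_some hb
      obtain ⟨rfl, hi⟩ : j' = j ∧ i ∈ C j := mem_pairs.1 hd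
      have hv : (greedy₂ g What k G C (fun l => (members G l).card) j' kj (t + 1) base cj s).val =
          (greedy₂ g What k G C (fun l => (members G l).card) j' kj t (base + What i j')
            (Function.update cj (G i) (cj (G i) + 1)) (push₂ G s i : Counted m _).val).val := by
        simp only [greedy₂, bind_val, hb, op_val]
      rw [hv]
      obtain ⟨his, hok1, hok2⟩ := canAdd_val.1 hok
      have hS : (push₂ G s i : Counted m _).val.S = insert i s.S := rfl
      have hins : insert i s.S ∩ C j' = insert i (s.S ∩ C j') := insert_inter_of_mem hi
      have hisC : i ∉ s.S ∩ C j' := fun h => his (mem_inter.1 h).1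
      obtain ⟨a1, a2, a3⟩ := ih (base + What i j') (Function.update cj (G i) (cj (G i) + 1))
        (push₂ G s i : Counted m _).val (h.push his hok2) (add_nonneg hbase (hnonneg i))
        (fun l => by rw [hS, hins]; exact update_cnt_eq hcj hisC l)
        (by rw [hS, hins, card_insert_of_notMem hisC]; omega)
        (fun l => by
          rw [hS, hins, card_insert_inter_members G hisC]
          by_cases hl : G i = l
          · subst hl
            rw [if_pos rfl, ← hcj]; exact hok1
          · rw [if_neg hl]; exact hshare l)
        (by
          rw [hS]
          intro x hx x' hx' hxs' hG
          rw [mem_insert, not_or] at hxs'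
          rw [hins] at hx
          rcases mem_insert.1 hx with rfl | hx
          · have hcan : (canAdd G (fun l => (members G l).card) k kj s cj x' :
                Counted m Bool).val = true :=
              canAdd_val.2 ⟨hxs'.2, by rw [hG]; exact hok1, by rw [hG]; exact hok2⟩
            rcases hmax (j', x') (mem_pairs.2 ⟨rfl, hx'⟩) hcan with h1 | h1
            · by_contra hlt
              push Not at hlt
              refine absurd h1 (not_lt.2 (sub_le_sub_right (hg ?_ ?_ ?_) _))
              · exact Set.mem_Ici.2 (by have := hnonneg x; simp only [one_mul]; linarith)
              · exact Set.mem_Ici.2 (by have := hnonneg x'; simp only [one_mul]; linarith)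
              · simp only [one_mul]
                exact add_le_add_right hlt.le _
            · exact h1.2
          · exact hup x hx x' hx' hxs'.2 hG)
      rw [hS] at a1 a2
      refine ⟨(subset_insert _ _).trans a1, fun x hx hxs => ?_, a3⟩
      by_cases hxi : x = i
      · exact hxi ▸ hi
      · exact a2 x hx (by simp [hxi, hxs])

/-- In the second part the share of the whole output never binds, provided that the numbers of
items intended for the categories sum up to at most `k`. -/
lemma part₂_spec (g : Fin m → ℝ → ℝ) (What : Fin n → Fin m → ℝ) (k : ℕ) (G : Fin n → Fin p)
    (C : Fin m → Finset (Fin n)) (size₀ r : ℕ) (s₁ : State₁ n m)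
    (hC : ∀ j j', j ≠ j' → Disjoint (C j) (C j'))
    (hg : ∀ j, MonotoneOn (g j) (Set.Ici 0))
    (hnonneg : ∀ i j, 0 ≤ What i j) (hn : 0 < n) (js : List (Fin m)) (hjs : js.Nodup)
    (s : State₂ n p) (h : Valid k G s) (hs : ∀ j ∈ js, s.S ∩ C j = ∅)
    (hbudget : ∀ l, n * (s.S ∩ members G l).card +
      (js.map fun j => n * max r (s₁.cnt j) / size₀).sum * (members G l).card ≤
        k * (members G l).card) :
    (∀ j, j ∉ js → (part₂ g What k G C (fun l => (members G l).card) size₀ r s₁ js s).val.S ∩ C j =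
      s.S ∩ C j) ∧
    ∀ j ∈ js, IsUpper G (fun i => What i j) (C j)
        (part₂ g What k G C (fun l => (members G l).card) size₀ r s₁ js s).val.S ∧
      ∀ i ∈ C j, i ∉ (part₂ g What k G C (fun l => (members G l).card) size₀ r s₁ js s).val.S →
        (n * max r (s₁.cnt j) / size₀) * (members G (G i)).card <
        n * ((((part₂ g What k G C (fun l => (members G l).card) size₀ r s₁ js s).val.S ∩ C j) ∩
          members G (G i)).card + 1) := by
  induction js generalizing s with
  | nil => exact ⟨fun _ _ => rfl, by simp⟩
  | cons j js ih =>
    have hj : j ∉ js := (List.nodup_cons.1 hjs).1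
    set kj := n * max r (s₁.cnt j) / size₀ with hkj
    have hsj : s.S ∩ C j = ∅ := hs j (by simp)
    obtain ⟨a1, a2, a3, a4, a5⟩ := greedy₂_spec g What k G C j (hg j) (fun i => hnonneg i j) hn kj
      kj 0 0 s h le_rfl (by simp [hsj]) (by simp [hsj]) (by simp [hsj])
      (by intro x hx; simp [hsj] at hx)
    have hval := valid_greedy₂ g What k G C j kj kj 0 0 s h
    simp only [part₂, bind_val, op_val]
    rw [← hkj]
    set s' := (greedy₂ g What k G C (fun l => (members G l).card) j kj kj 0 0 s).val
    have hother : ∀ j', j' ≠ j → s'.S ∩ C j' = s.S ∩ C j' := by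
      intro j' hj'
      refine Subset.antisymm (fun i hi => ?_) (inter_subset_inter_right a1)
      rw [mem_inter] at hi ⊢
      exact ⟨by_contra fun his => disjoint_left.1 (hC j' j hj') hi.2 (a2 i hi.1 his), hi.2⟩
    have hsplit : ∀ l, (s'.S ∩ members G l).card =
        (s.S ∩ members G l).card + ((s'.S ∩ C j) ∩ members G l).card := by
      intro l
      rw [← card_union_of_disjoint]
      · congr 1
        ext i
        simp only [mem_inter, mem_union]
        constructor
        · rintro ⟨h1, h2⟩
          by_cases his : i ∈ s.S
          · exact Or.inl ⟨his, h2⟩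
          · exact Or.inr ⟨⟨h1, a2 i h1 his⟩, h2⟩
        · rintro (⟨h1, h2⟩ | ⟨⟨h1, -⟩, h2⟩)
          · exact ⟨a1 h1, h2⟩
          · exact ⟨h1, h2⟩
      · refine disjoint_left.2 fun i hi hi' => ?_
        have : i ∈ s.S ∩ C j := mem_inter.2
          ⟨(mem_inter.1 hi).1, (mem_inter.1 (mem_inter.1 hi').1).2⟩
        rw [hsj] at this
        simp at this
    obtain ⟨b1, b2⟩ := ih (List.nodup_cons.1 hjs).2 s' hval
      (fun j' hj' => by
        rw [hother j' (fun h => hj (h ▸ hj'))]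
        exact hs j' (List.mem_cons_of_mem _ hj'))
      (fun l => by
        have h1 := hbudget l
        rw [List.map_cons, List.sum_cons] at h1
        rw [hsplit l, mul_add]
        have h2 := a4 l
        change _ + (kj + _) * _ ≤ _ at h1
        change _ ≤ kj * _ at h2
        rw [add_mul] at h1
        omega)
    refine ⟨fun j' hj' => ?_, fun j' hj' => ?_⟩
    · rw [List.mem_cons, not_or] at hj'
      rw [b1 j' hj'.2, hother j' hj'.1]
    · rcases List.mem_cons.1 hj' with rfl | hj'
      · have hmem : ∀ i ∈ C j', i ∈ (part₂ g What k G C (fun l => (members G l).card) size₀ r s₁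
            js s').val.S ↔ i ∈ s'.S := by
          intro i hi
          have := Finset.ext_iff.1 (b1 j' hj) i
          simpa [hi] using this
        refine ⟨fun x hx x' hx' hxs' hG => ?_, fun i hi his => ?_⟩
        · rw [b1 j' hj] at hx
          exact a3 x hx x' hx' (fun h => hxs' ((hmem x' hx').2 h)) hG
        · rw [b1 j' hj]
          rcases a5 i hi (fun h => his ((hmem i hi).2 h)) with h1 | h1
          · exact h1
          -- If the category share had room but the output share had not, the group's items chosen
          -- earlier together with its share of `kj` would exceed its share of `k`, against
          -- `hbudget`.
          · by_contra hcon
            rw [not_lt] at hcon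
            have h2 := hbudget (G i)
            rw [List.map_cons, List.sum_cons, add_mul] at h2
            rw [hsplit, mul_add, mul_add] at h1
            rw [mul_add] at hcon
            change n * _ + _ ≤ kj * _ at hcon
            change n * _ + (kj * _ + _) ≤ _ at h2
            omega
      · exact b2 j' hj'

end PartTwo

/-! ### Best items of a category and summation by parts -/

section TopSet

variable {ι : Type*} [DecidableEq ι]

open Classical in
/-- The `y` items of `C` with the largest values of `w` (all items, if there are fewer), with ties
broken in a way that makes these sets increase with `y`. -/
noncomputable def topSet (C : Finset ι) (w : ι → ℝ) : ℕ → Finset ι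
  | 0 => ∅
  | y + 1 => if h : (C \ topSet C w y).Nonempty then
      insert (exists_max_image _ w h).choose (topSet C w y) else topSet C w y

variable (C : Finset ι) (w : ι → ℝ)

lemma topSet_zero : topSet C w 0 = ∅ := rfl

lemma topSet_succ (y : ℕ) : (topSet C w (y + 1) = topSet C w y ∧ C ⊆ topSet C w y) ∨
    ∃ x ∈ C, x ∉ topSet C w y ∧ topSet C w (y + 1) = insert x (topSet C w y) ∧
      ∀ i ∈ C, i ∉ topSet C w y → w i ≤ w x := by
  by_cases h : (C \ topSet C w y).Nonempty
  · right
    obtain ⟨h1, h2⟩ := (exists_max_image _ w h).choose_spec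
    refine ⟨_, (mem_sdiff.1 h1).1, (mem_sdiff.1 h1).2, ?_, fun i hi hi' =>
      h2 i (mem_sdiff.2 ⟨hi, hi'⟩)⟩
    rw [topSet, dif_pos h]
  · left
    exact ⟨by rw [topSet, dif_neg h], sdiff_eq_empty_iff_subset.1 (not_nonempty_iff_eq_empty.1 h)⟩

lemma topSet_subset (y : ℕ) : topSet C w y ⊆ C := by
  induction y with
  | zero => exact empty_subset _
  | succ y ih =>
    rcases topSet_succ C w y with ⟨h, -⟩ | ⟨x, hx, -, h, -⟩ <;> rw [h]
    · exact ih
    · exact insert_subset hx ih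

lemma card_topSet (y : ℕ) : (topSet C w y).card = min y C.card := by
  induction y with
  | zero => simp [topSet_zero]
  | succ y ih =>
    rcases topSet_succ C w y with ⟨h, h'⟩ | ⟨x, hx, hx', h, -⟩ <;> rw [h]
    · have := card_le_card h'
      omega
    · rw [card_insert_of_notMem hx', ih]
      have : (topSet C w y).card < C.card := card_lt_card
        (ssubset_iff_of_subset (topSet_subset C w y) |>.2 ⟨x, hx, hx'⟩)
      omega

lemma topSet_mono : Monotone (topSet C w) := by
  refine monotone_nat_of_le_succ fun y => ?_
  rcases topSet_succ C w y with ⟨h, -⟩ | ⟨x, -, -, h, -⟩ <;> rw [h]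
  exact subset_insert _ _

lemma topSet_upper (y : ℕ) : ∀ i ∈ topSet C w y, ∀ i' ∈ C, i' ∉ topSet C w y → w i' ≤ w i := by
  induction y with
  | zero => intro i hi; simp [topSet_zero] at hi
  | succ y ih =>
    rcases topSet_succ C w y with ⟨h, -⟩ | ⟨x, -, -, h, hmax⟩ <;> rw [h]
    · exact ih
    · intro i hi i' hi' hn
      rw [mem_insert, not_or] at hn
      rcases mem_insert.1 hi with rfl | hi
      · exact hmax i' hi' hn.2
      · exact ih i hi i' hi' hn.2

lemma topSet_eq_of_card_le {y : ℕ} (h : C.card ≤ y) : topSet C w y = C :=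
  eq_of_subset_of_card_le (topSet_subset C w y) (by rw [card_topSet, min_eq_right h])

/-- Summation by parts: if the coefficients `a` have small sums over all sets `topSet C w y`, then
they have small sums weighted by `w - v`. -/
lemma sum_mul_sub_le (a : ι → ℝ) {M B : ℝ} (hB : 0 ≤ B) (hM : ∀ i ∈ C, w i ≤ M) (Y : ℕ)
    (ha : ∀ y ≤ Y, ∑ i ∈ topSet C w y, a i ≤ B) (v : ℝ) (hv : v ≤ M)
    (hvw : ∀ i ∈ topSet C w Y, v ≤ w i) :
    ∑ i ∈ topSet C w Y, a i * (w i - v) ≤ B * (M - v) := by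
  induction Y generalizing v with
  | zero => simpa [topSet_zero] using mul_nonneg hB (sub_nonneg.2 hv)
  | succ Y ih =>
    have haY := ha (Y + 1) le_rfl
    rcases topSet_succ C w Y with ⟨h, -⟩ | ⟨x, hx, hx', h, hmax⟩
    · rw [h] at hvw ⊢
      exact ih (fun y hy => ha y (by omega)) v hv hvw
    · rw [h] at hvw haY ⊢
      have h1 := ih (fun y hy => ha y (by omega)) (w x) (hM x hx)
        (fun i hi => topSet_upper C w Y i hi x hx hx')
      -- Lowering the reference value from `w x` to `v` adds `w x - v` times a partial sum of `a`,
      -- which is at most `B`. With the inductive bound `B * (M - w x)` this telescopes to `B * (M -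
      -- v)`.
      have h2 : ∑ i ∈ insert x (topSet C w Y), a i * (w i - v) =
          ∑ i ∈ topSet C w Y, a i * (w i - w x) +
            (w x - v) * ∑ i ∈ insert x (topSet C w Y), a i := by
        rw [mul_sum, sum_insert hx', sum_insert hx', add_left_comm, ← sum_add_distrib]
        congr 1
        · ring
        · exact sum_congr rfl fun i _ => by ring
      rw [h2]
      have h3 := mul_le_mul_of_nonneg_left haY (sub_nonneg.2 (hvw x (mem_insert_self _ _)))
      nlinarith

/-- A value that separates `topSet C w y` from the rest of `C`. -/
lemma exists_threshold {M : ℝ} (hM0 : 0 ≤ M) (h0 : ∀ i ∈ C, 0 ≤ w i) (hM : ∀ i ∈ C, w i ≤ M)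
    (y : ℕ) : ∃ v, 0 ≤ v ∧ v ≤ M ∧ (∀ i ∈ topSet C w y, v ≤ w i) ∧
      (∀ i ∈ C, i ∉ topSet C w y → w i ≤ v) ∧ (v = 0 ∨ (topSet C w y).card = y) := by
  rcases le_or_gt C.card y with h | h
  · refine ⟨0, le_rfl, hM0, fun i hi => h0 i (topSet_subset _ _ _ hi), fun i hi hi' => ?_,
      Or.inl rfl⟩
    rw [topSet_eq_of_card_le C w h] at hi'
    exact absurd hi hi'
  · have hc : (topSet C w y).card = y := by rw [card_topSet, min_eq_left h.le]
    rcases (topSet C w y).eq_empty_or_nonempty with he | hne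
    · exact ⟨M, hM0, le_rfl, by simp [he], fun i hi _ => hM i hi, Or.inr hc⟩
    · obtain ⟨x, hx, hmin⟩ := exists_min_image _ w hne
      exact ⟨w x, h0 x (topSet_subset _ _ _ hx), hM x (topSet_subset _ _ _ hx), hmin,
        topSet_upper C w y x hx, Or.inr hc⟩

/-- A threshold `v` bounds the `y` best items from below and all further ones from above, so the
average cannot rise when items are added. If `C` has fewer than `y` items, `v = 0` and nothing is
added. -/
lemma mul_sum_topSet_le (h0 : ∀ i ∈ C, 0 ≤ w i) {x y : ℕ} (hyx : y ≤ x) :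
    (y : ℝ) * ∑ i ∈ topSet C w x, w i ≤ x * ∑ i ∈ topSet C w y, w i := by
  obtain ⟨v, hv0, -, hv1, hv2, hv3⟩ := exists_threshold C w
    (M := ∑ i ∈ C, w i) (sum_nonneg h0) h0 (fun i hi => single_le_sum h0 hi) y
  have h1 : (y : ℝ) * v ≤ ∑ i ∈ topSet C w y, w i := by
    rcases hv3 with rfl | hc
    · rw [mul_zero]
      exact sum_nonneg fun i hi => h0 i (topSet_subset _ _ _ hi)
    · have := card_nsmul_le_sum _ w v hv1
      rwa [hc, nsmul_eq_mul] at this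
  have h2 : ∑ i ∈ topSet C w x \ topSet C w y, w i ≤ (x - y : ℝ) * v := by
    have := sum_le_card_nsmul (topSet C w x \ topSet C w y) w v fun i hi =>
      hv2 i (topSet_subset _ _ _ (mem_sdiff.1 hi).1) (mem_sdiff.1 hi).2
    rw [nsmul_eq_mul] at this
    rcases hv3 with rfl | hc
    · simpa using this
    · refine this.trans (mul_le_mul_of_nonneg_right ?_ hv0)
      rw [card_sdiff_of_subset (topSet_mono C w hyx), hc, card_topSet, ← Nat.cast_sub hyx]
      exact_mod_cast Nat.sub_le_sub_right (min_le_left _ _) _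
  rw [← sum_sdiff (topSet_mono C w hyx)]
  have hxy : (0 : ℝ) ≤ x - y := sub_nonneg.2 (by exact_mod_cast hyx)
  have h3 := mul_le_mul_of_nonneg_left h2 (Nat.cast_nonneg (α := ℝ) y)
  have h4 := mul_le_mul_of_nonneg_left h1 hxy
  nlinarith

end TopSet

/-- After removing the common items, `A` has at least as many left as `E`, and each of them
outweighs each of those of `E`. -/
lemma sum_le_sum_of_upper {ι : Type*} [DecidableEq ι] {w : ι → ℝ} {A E X : Finset ι}
    (hE : E ⊆ X) (h0 : ∀ i ∈ X, 0 ≤ w i) (hA0 : ∀ i ∈ A, 0 ≤ w i)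
    (hup : ∀ i ∈ A, ∀ i' ∈ X, i' ∉ A → w i' ≤ w i) (hcard : E.card ≤ A.card ∨ X ⊆ A) :
    ∑ i ∈ E, w i ≤ ∑ i ∈ A, w i := by
  rcases hcard with hcard | hX
  · rw [← sum_sdiff (inter_subset_left (s₁ := E) (s₂ := A)), sdiff_inter_self_left,
      ← sum_sdiff (inter_subset_right (s₁ := E) (s₂ := A)), sdiff_inter_self_right]
    refine add_le_add_left ?_ _
    have hc : (E \ A).card ≤ (A \ E).card := card_sdiff_le_card_sdiff_iff.2 hcard
    rcases (E \ A).eq_empty_or_nonempty with he | hne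
    · rw [he, sum_empty]
      exact sum_nonneg fun i hi => hA0 i (mem_sdiff.1 hi).1
    obtain ⟨x, hx, hmax⟩ := exists_max_image _ w hne
    obtain ⟨hxE, hxA⟩ := mem_sdiff.1 hx
    calc ∑ i ∈ E \ A, w i ≤ (E \ A).card • w x := sum_le_card_nsmul _ _ _ hmax
      _ ≤ (A \ E).card • w x := nsmul_le_nsmul_left (h0 x (hE hxE)) hc
      _ ≤ ∑ i ∈ A \ E, w i := card_nsmul_le_sum _ _ _ fun i hi =>
          hup i (mem_sdiff.1 hi).1 x (hE hxE) hxA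
  · exact sum_le_sum_of_subset_of_nonneg (hE.trans hX) fun i hi _ => hA0 i hi

/-- Concavity between `0` and `x`, with `g 0 ≥ 0`. This turns approximations of utility sums into
approximations of `g`. -/
lemma IsGain.mul_le {g : ℝ → ℝ} (hg : IsGain g) {c x z : ℝ} (hc0 : 0 ≤ c) (hc1 : c ≤ 1)
    (hx : 0 ≤ x) (hz : c * x ≤ z) : c * g x ≤ g z := by
  have h1 := hg.concave.2 (Set.mem_Ici.2 hx) (Set.mem_Ici.2 le_rfl) hc0 (sub_nonneg.2 hc1)
    (by ring)
  simp only [smul_eq_mul, mul_zero, add_zero] at h1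
  have h2 := mul_nonneg (sub_nonneg.2 hc1) (hg.nonneg 0 le_rfl)
  have h3 := hg.mono (Set.mem_Ici.2 (mul_nonneg hc0 hx))
    (Set.mem_Ici.2 ((mul_nonneg hc0 hx).trans hz)) hz
  linarith

/-! ### Negative correlation and Chernoff bounds for random divisions -/

section Concentration

variable {n p : ℕ}

/-- The divisions into groups of the prescribed sizes as a finite set. -/
def divisionSet (n : ℕ) {p : ℕ} (size : Fin p → ℕ) : Finset (Fin n → Fin p) :=
  univ.filter fun G => ∀ l, (members G l).card = size l

lemma coe_divisionSet (size : Fin p → ℕ) :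
    (divisionSet n size : Set (Fin n → Fin p)) = divisions n size := by
  ext G; simp [divisionSet, divisions]

lemma mem_divisionSet {size : Fin p → ℕ} {G : Fin n → Fin p} :
    G ∈ divisionSet n size ↔ ∀ l, (members G l).card = size l := by
  simp [divisionSet]

lemma divisionSet_nonempty {size : Fin p → ℕ} (h : ∑ l, size l = n) :
    (divisionSet n size).Nonempty := by
  have hc : Fintype.card (Fin n) = Fintype.card (Σ l, Fin (size l)) := by simp [h]
  let e := Fintype.equivOfCardEq hc
  refine ⟨fun i => (e i).1, mem_divisionSet.2 fun l => ?_⟩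
  have hinj : Function.Injective fun x : Fin (size l) => e.symm ⟨l, x⟩ := fun x y hxy => by
    simpa using hxy
  have himage : members (fun i => (e i).1) l = univ.image fun x => e.symm ⟨l, x⟩ := by
    ext i
    simp only [mem_members, mem_image, mem_univ, true_and]
    constructor
    · intro hi
      obtain ⟨x, hx⟩ : ∃ x, e i = ⟨l, x⟩ := by
        subst hi; exact ⟨(e i).2, rfl⟩
      exact ⟨x, by rw [← hx, Equiv.symm_apply_apply]⟩
    · rintro ⟨x, rfl⟩
      rw [Equiv.apply_symm_apply]
  rw [himage, card_image_of_injective _ hinj, card_univ, Fintype.card_fin]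

/-- The items that are in a group from `B`. -/
def inGroups (G : Fin n → Fin p) (B : Finset (Fin p)) : Finset (Fin n) :=
  univ.filter fun i => G i ∈ B

lemma mem_inGroups {G : Fin n → Fin p} {B : Finset (Fin p)} {i : Fin n} :
    i ∈ inGroups G B ↔ G i ∈ B := by
  simp [inGroups]

lemma card_inGroups {size : Fin p → ℕ} {G : Fin n → Fin p} (hG : G ∈ divisionSet n size)
    (B : Finset (Fin p)) : (inGroups G B).card = ∑ l ∈ B, size l := by
  rw [card_eq_sum_card_fiberwise (f := G) (t := B) (fun i hi => mem_inGroups.1 hi)]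
  refine sum_congr rfl fun l hl => ?_
  rw [← mem_divisionSet.1 hG l]
  congr 1
  ext i
  simp only [mem_filter, mem_inGroups, mem_members]
  exact ⟨fun h => h.2, fun h => ⟨h ▸ hl, h⟩⟩

/-- The divisions for which all items of `A` are in groups from `B`. -/
def capturing (n : ℕ) {p : ℕ} (size : Fin p → ℕ) (B : Finset (Fin p)) (A : Finset (Fin n)) :
    Finset (Fin n → Fin p) :=
  (divisionSet n size).filter fun G => A ⊆ inGroups G B

lemma comp_mem_divisionSet {size : Fin p → ℕ} {G : Fin n → Fin p} (hG : G ∈ divisionSet n size)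
    (π : Equiv.Perm (Fin n)) : G ∘ π ∈ divisionSet n size := by
  refine mem_divisionSet.2 fun l => ?_
  rw [← mem_divisionSet.1 hG l]
  refine card_bij (fun i _ => π i) (fun i hi => mem_members.2 (by have h := mem_members.1 hi; exact h))
    (fun _ _ _ _ h => π.injective h) fun i hi => ⟨π.symm i, mem_members.2 ?_, by simp⟩
  simpa using mem_members.1 hi

/-- Items are exchangeable: swapping `i` and `i'` maps divisions of one kind injectively to
divisions of the other. -/
lemma card_capturing_insert_le (size : Fin p → ℕ) (B : Finset (Fin p)) {A : Finset (Fin n)}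
    {i i' : Fin n} (hi : i ∉ A) (hi' : i' ∉ A) :
    (capturing n size B (insert i A)).card ≤ (capturing n size B (insert i' A)).card := by
  refine card_le_card_of_injOn (fun G => G ∘ Equiv.swap i i') (fun G hG => ?_)
    fun G _ G' _ h => (Equiv.swap i i').surjective.injective_comp_right h
  obtain ⟨h1, h2⟩ := mem_filter.1 hG
  refine mem_filter.2 ⟨comp_mem_divisionSet h1 _, fun x hx => mem_inGroups.2 ?_⟩
  rcases mem_insert.1 hx with rfl | hx
  · simpa using mem_inGroups.1 (h2 (mem_insert_self i A))
  · have hxi : x ≠ i := fun h => hi (h ▸ hx)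
    have hxi' : x ≠ i' := fun h => hi' (h ▸ hx)
    simpa [Equiv.swap_apply_of_ne_of_ne hxi hxi'] using
      mem_inGroups.1 (h2 (mem_insert_of_mem hx))

/-- Double counting of pairs of a division capturing `A` and a further captured item; each such
division has the same number of these items. -/
lemma sum_card_capturing (size : Fin p → ℕ) (B : Finset (Fin p)) (A : Finset (Fin n)) :
    ∑ i ∈ univ \ A, (capturing n size B (insert i A)).card =
      (capturing n size B A).card * (∑ l ∈ B, size l - A.card) := by
  have h1 : ∀ i, (capturing n size B (insert i A)).card =
      ∑ G ∈ capturing n size B A, if i ∈ inGroups G B then 1 else 0 := by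
    intro i
    rw [← card_filter]
    congr 1
    ext G
    simp only [capturing, mem_filter, insert_subset_iff]
    tauto
  rw [sum_congr rfl fun i _ => h1 i, sum_comm, ← smul_eq_mul, ← sum_const]
  refine sum_congr rfl fun G hG => ?_
  obtain ⟨hG1, hG2⟩ := mem_filter.1 hG
  rw [← card_filter, ← card_inGroups hG1 B, ← card_sdiff_of_subset hG2]
  congr 1
  ext i
  simp [and_comm]

/-- By symmetry and averaging, an item is captured, given that `A` is, with probability `(N - |A|) /
(n - |A|)`, where `N` is the total size of the groups in `B`. This is at most `N / n`. -/
lemma mul_card_capturing_insert_le (size : Fin p → ℕ) (B : Finset (Fin p)) {A : Finset (Fin n)}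
    {i : Fin n} (hi : i ∉ A) (hB : ∑ l ∈ B, size l ≤ n) :
    n * (capturing n size B (insert i A)).card ≤
      (∑ l ∈ B, size l) * (capturing n size B A).card := by
  have hA : A.card < n := by
    have := card_lt_card (ssubset_univ_iff.2 fun h : A = univ => hi (h ▸ mem_univ i))
    simpa using this
  have h1 : (n - A.card) * (capturing n size B (insert i A)).card ≤
      (capturing n size B A).card * (∑ l ∈ B, size l - A.card) := by
    rw [← sum_card_capturing]
    have h := card_nsmul_le_sum (univ \ A) (fun i => (capturing n size B (insert i A)).card)
      ((capturing n size B (insert i A)).card)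
      fun i' hi' => card_capturing_insert_le size B hi (mem_sdiff.1 hi').2
    rwa [card_sdiff_of_subset (subset_univ A), card_univ, Fintype.card_fin, smul_eq_mul] at h
  have h2 : n * (∑ l ∈ B, size l - A.card) ≤ (n - A.card) * ∑ l ∈ B, size l := by
    rw [Nat.mul_sub, Nat.sub_mul]
    exact Nat.sub_le_sub_left (by rw [mul_comm]; exact Nat.mul_le_mul_right _ hB) _
  refine Nat.le_of_mul_le_mul_left ?_ (Nat.sub_pos_of_lt hA)
  calc (n - A.card) * (n * (capturing n size B (insert i A)).card)
      = n * ((n - A.card) * (capturing n size B (insert i A)).card) := by ring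
    _ ≤ n * ((capturing n size B A).card * (∑ l ∈ B, size l - A.card)) :=
        Nat.mul_le_mul_left _ h1
    _ = (capturing n size B A).card * (n * (∑ l ∈ B, size l - A.card)) := by ring
    _ ≤ (capturing n size B A).card * ((n - A.card) * ∑ l ∈ B, size l) :=
        Nat.mul_le_mul_left _ h2
    _ = _ := by ring

/-- Under a uniform division, the events that single items are in groups from `B` are negatively
correlated. -/
lemma card_capturing_le (size : Fin p → ℕ) (B : Finset (Fin p)) (hB : ∑ l ∈ B, size l ≤ n)
    (A : Finset (Fin n)) : ((capturing n size B A).card : ℝ) ≤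
      ((∑ l ∈ B, size l : ℕ) / n : ℝ) ^ A.card * (divisionSet n size).card := by
  induction A using Finset.induction_on with
  | empty =>
    rw [card_empty, pow_zero, one_mul]
    exact_mod_cast card_le_card (filter_subset _ _)
  | insert i A hi ih =>
    have hn : (0 : ℝ) < n := by exact_mod_cast i.pos
    have h1 : (n : ℝ) * (capturing n size B (insert i A)).card ≤
        (∑ l ∈ B, size l : ℕ) * (capturing n size B A).card := by
      exact_mod_cast mul_card_capturing_insert_le size B hi hB
    rw [card_insert_of_notMem hi, pow_succ]
    set q := ((∑ l ∈ B, size l : ℕ) / n : ℝ) with hq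
    have hq0 : 0 ≤ q := by positivity
    calc ((capturing n size B (insert i A)).card : ℝ)
        ≤ q * (capturing n size B A).card := by
          rw [hq, div_mul_eq_mul_div, le_div_iff₀ hn, mul_comm]; exact h1
      _ ≤ q * (q ^ A.card * (divisionSet n size).card) := mul_le_mul_of_nonneg_left ih hq0
      _ = _ := by ring

/-- Expanding the power over subsets `A` of the captured items reduces the sum to the numbers of
divisions capturing `A`. Negative correlation bounds these as if the items were independent, which
leaves a binomial moment generating function. -/
lemma sum_one_add_pow_le (size : Fin p → ℕ) (B : Finset (Fin p)) (hB : ∑ l ∈ B, size l ≤ n)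
    (T : Finset (Fin n)) {t : ℝ} (ht : 0 ≤ t) :
    ∑ G ∈ divisionSet n size, (1 + t) ^ (T ∩ inGroups G B).card ≤
      (1 + t * ((∑ l ∈ B, size l : ℕ) / n : ℝ)) ^ T.card * (divisionSet n size).card := by
  have h1 : ∀ G ∈ divisionSet n size, (1 + t) ^ (T ∩ inGroups G B).card =
      ∑ A ∈ T.powerset, if A ⊆ inGroups G B then t ^ A.card else 0 := by
    intro G _
    rw [← sum_filter, add_comm, ← Finset.sum_pow_mul_eq_add_pow]
    refine sum_congr ?_ fun A _ => by simp
    ext A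
    rw [mem_filter, mem_powerset, mem_powerset, subset_inter_iff]
  rw [sum_congr rfl h1, sum_comm, add_comm 1 (t * _), ← Finset.sum_pow_mul_eq_add_pow, sum_mul]
  refine sum_le_sum fun A _ => ?_
  rw [← sum_filter, sum_const, nsmul_eq_mul, one_pow, mul_one, mul_pow]
  calc ((capturing n size B A).card : ℝ) * t ^ A.card
      ≤ (((∑ l ∈ B, size l : ℕ) / n : ℝ) ^ A.card * (divisionSet n size).card) * t ^ A.card :=
        mul_le_mul_of_nonneg_right (card_capturing_le size B hB A) (pow_nonneg ht _)
    _ = _ := by ring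

/-- Markov's inequality for `(1 + t) ^ X`. A set `B` of groups is allowed because the lower tail for
one group is the upper tail for the union of the others. -/
lemma card_tail_le (size : Fin p → ℕ) (B : Finset (Fin p)) (hB : ∑ l ∈ B, size l ≤ n)
    (T : Finset (Fin n)) {t : ℝ} (ht : 0 ≤ t) (a : ℝ) :
    (((divisionSet n size).filter fun G => a ≤ (T ∩ inGroups G B).card).card : ℝ) ≤
      (1 + t * ((∑ l ∈ B, size l : ℕ) / n : ℝ)) ^ T.card * Real.exp (-(a * Real.log (1 + t))) *
        (divisionSet n size).card := by
  set D := (divisionSet n size).filter fun G => a ≤ (T ∩ inGroups G B).card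
  have hpos : (0 : ℝ) < 1 + t := by linarith
  have h1 : ∀ G ∈ D, Real.exp (a * Real.log (1 + t)) ≤ (1 + t) ^ (T ∩ inGroups G B).card := by
    intro G hG
    rw [← Real.exp_log (pow_pos hpos _), Real.log_pow]
    exact Real.exp_le_exp.2 (mul_le_mul_of_nonneg_right (mem_filter.1 hG).2
      (Real.log_nonneg (by linarith)))
  have h2 : (D.card : ℝ) * Real.exp (a * Real.log (1 + t)) ≤
      (1 + t * ((∑ l ∈ B, size l : ℕ) / n : ℝ)) ^ T.card * (divisionSet n size).card := by
    rw [← nsmul_eq_mul]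
    exact (card_nsmul_le_sum _ _ _ h1).trans ((sum_le_sum_of_subset_of_nonneg (filter_subset _ _)
      fun _ _ _ => by positivity).trans (sum_one_add_pow_le size B hB T ht))
  rw [Real.exp_neg, mul_right_comm, ← div_eq_mul_inv, le_div_iff₀ (Real.exp_pos _)]
  exact h2

lemma inGroups_singleton (G : Fin n → Fin p) (l : Fin p) : inGroups G {l} = members G l := by
  ext i; simp [mem_inGroups, mem_members]

/-- Chernoff bound, upper tail. -/
lemma card_upper_tail_le (size : Fin p → ℕ) (hs : ∑ l, size l = n) (l : Fin p)
    (T : Finset (Fin n)) {δ b : ℝ} (hδ : 0 ≤ δ) (hδ1 : δ ≤ 1) (hb : 0 ≤ b) :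
    (((divisionSet n size).filter fun G => (1 + δ) * (size l / n * T.card) + b ≤
      ((T ∩ members G l).card : ℝ)).card : ℝ) ≤
      Real.exp (-(b * δ / 2)) * (divisionSet n size).card := by
  have hl : ∑ l' ∈ {l}, size l' ≤ n := by
    rw [← hs]; exact sum_le_univ_sum_of_nonneg fun _ => Nat.zero_le _
  have h := card_tail_le size {l} hl T hδ ((1 + δ) * (size l / n * T.card) + b)
  simp only [inGroups_singleton, sum_singleton] at h
  refine h.trans (mul_le_mul_of_nonneg_right ?_ (Nat.cast_nonneg _))
  set q : ℝ := size l / n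
  have hq : 0 ≤ q := by positivity
  have h1 : (1 + δ * q) ^ T.card ≤ Real.exp (T.card * (δ * q)) := by
    rw [Real.exp_nat_mul]
    exact pow_le_pow_left₀ (by positivity) (by linarith [Real.add_one_le_exp (δ * q)]) _
  refine (mul_le_mul_of_nonneg_right h1 (Real.exp_pos _).le).trans ?_
  rw [← Real.exp_add, Real.exp_le_exp]
  have hpos : (0 : ℝ) < 1 + δ := by linarith
  have h2 := Real.one_sub_inv_le_log_of_pos hpos
  have h3 : (1 + δ) * (1 - (1 + δ)⁻¹) = δ := by field_simp; ring
  -- With `t = δ`, the factor `1 + δ` in front of the mean compensates the moment generating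
  -- function, so that only `b * log (1 + δ) ≥ b * δ / 2` remains, a bound that does not depend on
  -- `T`.
  have h4 : δ ≤ (1 + δ) * Real.log (1 + δ) := by
    calc δ = _ := h3.symm
      _ ≤ _ := mul_le_mul_of_nonneg_left h2 hpos.le
  have h5 : δ / 2 ≤ Real.log (1 + δ) := by
    nlinarith [Real.log_nonneg (show (1 : ℝ) ≤ 1 + δ by linarith)]
  have h6 := mul_le_mul_of_nonneg_left h4 (mul_nonneg hq (Nat.cast_nonneg (α := ℝ) T.card))
  have h7 := mul_le_mul_of_nonneg_left h5 hb
  nlinarith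

/-- Chernoff bound, lower tail. -/
lemma card_lower_tail_le (size : Fin p → ℕ) (hs : ∑ l, size l = n) (hn : 0 < n) (l : Fin p)
    (T : Finset (Fin n)) {δ b : ℝ} (hδ : 0 ≤ δ) (hδ1 : δ < 1) (hb : 0 ≤ b) :
    (((divisionSet n size).filter fun G => ((T ∩ members G l).card : ℝ) ≤
      (1 - δ) * (size l / n * T.card) - b).card : ℝ) ≤
      Real.exp (-(b * δ / 2)) * (divisionSet n size).card := by
  have hn' : (0 : ℝ) < n := by exact_mod_cast hn
  set q : ℝ := size l / n with hq
  have hq0 : 0 ≤ q := by positivity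
  set c := (1 - δ) * (q * T.card) - b with hc
  rcases lt_or_ge c 0 with hc0 | hc0
  · rw [filter_false_of_mem fun G _ => not_le.2 (hc0.trans_le (Nat.cast_nonneg _))]
    simp only [card_empty, Nat.cast_zero]
    positivity
  have hsum : ∑ l' ∈ univ.erase l, size l' + size l = n := by
    rw [sum_erase_add _ _ (mem_univ l), hs]
  have hq1 : ((∑ l' ∈ univ.erase l, size l' : ℕ) / n : ℝ) = 1 - q := by
    rw [hq, eq_sub_iff_add_eq, ← add_div, div_eq_one_iff_eq hn'.ne']
    exact_mod_cast hsum
  have h1δ : 0 < 1 - δ := by linarith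
  -- The tail bound is applied to all groups but `l`. This `t` makes `1 + t = (1 - δ)⁻¹`, and the
  -- two powers then combine to `(1 - δ * q) ^ T.card`.
  have ht : 0 ≤ δ / (1 - δ) := by positivity
  have h1t : 1 + δ / (1 - δ) = (1 - δ)⁻¹ := by field_simp; ring
  have h := card_tail_le size (univ.erase l) (by omega) T ht (T.card - c)
  have hcomp : ∀ G : Fin n → Fin p, ((T ∩ inGroups G (univ.erase l)).card : ℝ) =
      T.card - (T ∩ members G l).card := by
    intro G
    have : T ∩ inGroups G (univ.erase l) = T \ members G l := by
      ext i; simp [mem_inGroups, mem_members]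
    rw [this, eq_sub_iff_add_eq]
    exact_mod_cast card_sdiff_add_card_inter T (members G l)
  simp only [hcomp, sub_le_sub_iff_left] at h
  refine h.trans (mul_le_mul_of_nonneg_right ?_ (Nat.cast_nonneg _))
  rw [hq1, h1t, Real.log_inv]
  have hqle : q ≤ 1 := by
    rw [hq, div_le_one hn']; exact_mod_cast (by omega : size l ≤ n)
  have e1 : Real.exp (-((T.card - c) * -Real.log (1 - δ))) =
      (1 - δ) ^ T.card * Real.exp (c * -Real.log (1 - δ)) := by
    rw [← Real.exp_log (pow_pos h1δ T.card), Real.log_pow, ← Real.exp_add]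
    congr 1; ring
  have e2 : (1 + δ / (1 - δ) * (1 - q)) ^ T.card * (1 - δ) ^ T.card = (1 - δ * q) ^ T.card := by
    rw [← mul_pow]
    congr 1
    field_simp; ring
  rw [e1, ← mul_assoc, e2]
  have h2 : (1 - δ * q) ^ T.card ≤ Real.exp (T.card * (-(δ * q))) := by
    rw [Real.exp_nat_mul]
    exact pow_le_pow_left₀ (by nlinarith) (by linarith [Real.add_one_le_exp (-(δ * q))]) _
  refine (mul_le_mul_of_nonneg_right h2 (Real.exp_pos _).le).trans ?_
  rw [← Real.exp_add, Real.exp_le_exp]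
  have h3 := Real.one_sub_inv_le_log_of_pos h1δ
  have h4 : c * -Real.log (1 - δ) ≤ c * (δ / (1 - δ)) := by
    refine mul_le_mul_of_nonneg_left ?_ hc0
    have : (1 - δ)⁻¹ - 1 = δ / (1 - δ) := by field_simp; ring
    linarith
  have h5 : c * (δ / (1 - δ)) = q * T.card * δ - b * δ / (1 - δ) := by
    rw [hc]; field_simp
  have h6 : b * δ / 2 ≤ b * δ / (1 - δ) :=
    div_le_div_of_nonneg_left (by positivity) h1δ (by linarith)
  nlinarith

end Concentration

/-! ### The concentration event and the outcome of the first part -/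

section Summary

variable {n m p : ℕ}

/-- The `y` items of category `j` with the largest utilities. -/
noncomputable def heaviest (W : Fin n → Fin m → ℝ) (j : Fin m) (y : ℕ) : Finset (Fin n) :=
  topSet (category W j) (fun i => W i j) y

/-- The utility of the `y` best items of category `j`. -/
noncomputable def bestSum (W : Fin n → Fin m → ℝ) (j : Fin m) (y : ℕ) : ℝ :=
  ∑ i ∈ heaviest W j y, W i j

/-- Every group receives about its share of the `y` best items of every category, `y ≤ k`. -/
def Concentrated (W : Fin n → Fin m → ℝ) (k : ℕ) (δ b : ℝ) (G : Fin n → Fin p) : Prop :=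
  ∀ j l y, y ≤ k →
    ((heaviest W j y ∩ members G l).card : ℝ) ≤
      (1 + δ) * ((members G l).card / n * (heaviest W j y).card) + b ∧
    (1 - δ) * ((members G l).card / n * (heaviest W j y).card) - b ≤
      ((heaviest W j y ∩ members G l).card : ℝ)

-- Union bound over category, group, `1 ≤ y ≤ k` and the two tails; `y = 0` concerns the empty set
-- and never fails.
open Classical in
lemma card_not_concentrated_le (W : Fin n → Fin m → ℝ) (k : ℕ) {δ b : ℝ} (hδ : 0 ≤ δ)
    (hδ1 : δ < 1) (hb : 0 ≤ b) (size : Fin p → ℕ) (hs : ∑ l, size l = n) (hn : 0 < n) :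
    (((divisionSet n size).filter fun G => ¬ Concentrated W k δ b G).card : ℝ) ≤
      2 * (m * p * k) * Real.exp (-(b * δ / 2)) * (divisionSet n size).card := by
  set U : Fin m → Fin p → ℕ → Finset (Fin n → Fin p) := fun j l y =>
    (divisionSet n size).filter fun G => (1 + δ) * (size l / n * (heaviest W j y).card) + b ≤
      ((heaviest W j y ∩ members G l).card : ℝ)
  set L : Fin m → Fin p → ℕ → Finset (Fin n → Fin p) := fun j l y =>
    (divisionSet n size).filter fun G => ((heaviest W j y ∩ members G l).card : ℝ) ≤
      (1 - δ) * (size l / n * (heaviest W j y).card) - b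
  set E : ℝ := Real.exp (-(b * δ / 2)) * (divisionSet n size).card
  have hsub : (divisionSet n size).filter (fun G => ¬ Concentrated W k δ b G) ⊆
      (univ ×ˢ univ ×ˢ Icc 1 k).biUnion fun c : Fin m × Fin p × ℕ =>
        U c.1 c.2.1 c.2.2 ∪ L c.1 c.2.1 c.2.2 := by
    intro G hG
    obtain ⟨hD, hbad⟩ := mem_filter.1 hG
    unfold Concentrated at hbad
    push Not at hbad
    obtain ⟨j, l, y, hy, h⟩ := hbad
    rw [mem_divisionSet.1 hD l] at h
    refine mem_biUnion.2 ⟨(j, l, y), ?_, ?_⟩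
    · rw [mem_product, mem_product, mem_Icc]
      refine ⟨mem_univ _, mem_univ _, Nat.one_le_iff_ne_zero.2 ?_, hy⟩
      intro hy0
      change y = 0 at hy0
      subst hy0
      simp only [heaviest, topSet_zero, empty_inter, card_empty, Nat.cast_zero, mul_zero,
        zero_add, zero_sub] at h
      linarith [h hb]
    · by_cases hu : (1 + δ) * (size l / n * (heaviest W j y).card) + b ≤
        ((heaviest W j y ∩ members G l).card : ℝ)
      · exact mem_union_left _ (mem_filter.2 ⟨hD, hu⟩)
      · exact mem_union_right _ (mem_filter.2 ⟨hD, (h (not_le.1 hu).le).le⟩)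
  have hcard : ∀ c ∈ (univ ×ˢ univ ×ˢ Icc 1 k : Finset (Fin m × Fin p × ℕ)),
      ((U c.1 c.2.1 c.2.2 ∪ L c.1 c.2.1 c.2.2).card : ℝ) ≤ 2 * E := by
    intro c _
    have h1 : ((U c.1 c.2.1 c.2.2).card : ℝ) ≤ E := card_upper_tail_le size hs _ _ hδ hδ1.le hb
    have h2 : ((L c.1 c.2.1 c.2.2).card : ℝ) ≤ E :=
      card_lower_tail_le size hs hn _ _ hδ hδ1 hb
    have h3 : ((U c.1 c.2.1 c.2.2 ∪ L c.1 c.2.1 c.2.2).card : ℝ) ≤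
        (U c.1 c.2.1 c.2.2).card + (L c.1 c.2.1 c.2.2).card := by
      exact_mod_cast card_union_le _ _
    linarith
  have h1 : (((divisionSet n size).filter fun G => ¬ Concentrated W k δ b G).card : ℝ) ≤
      ∑ c ∈ (univ ×ˢ univ ×ˢ Icc 1 k : Finset (Fin m × Fin p × ℕ)),
        ((U c.1 c.2.1 c.2.2 ∪ L c.1 c.2.1 c.2.2).card : ℝ) := by
    exact_mod_cast (card_le_card hsub).trans card_biUnion_le
  refine h1.trans ((sum_le_card_nsmul _ _ _ hcard).trans (le_of_eq ?_))
  rw [card_product, card_product, card_univ, card_univ, Fintype.card_fin, Fintype.card_fin,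
    Nat.card_Icc, nsmul_eq_mul, Nat.add_sub_cancel]
  push_cast
  ring

lemma le_uniformOn_of_concentrated (W : Fin n → Fin m → ℝ) (k : ℕ) {δ b ε : ℝ} (hδ : 0 ≤ δ)
    (hδ1 : δ < 1) (hb : 0 ≤ b) (size : Fin p → ℕ) (hs : ∑ l, size l = n) (hn : 0 < n)
    (hε : 2 * (m * p * k) * Real.exp (-(b * δ / 2)) ≤ ε) (Q : (Fin n → Fin p) → Prop)
    (hQ : ∀ G ∈ divisionSet n size, Concentrated W k δ b G → Q G) :
    1 - ε ≤ (ProbabilityTheory.uniformOn (divisions n size)).real {G | Q G} := by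
  classical
  have hD : (0 : ℝ) < (divisionSet n size).card := by
    exact_mod_cast card_pos.2 (divisionSet_nonempty hs)
  have hset : {G : Fin n → Fin p | Q G} = ((univ.filter Q : Finset (Fin n → Fin p)) : Set _) := by
    ext G; simp
  rw [MeasureTheory.measureReal_def, hset, ← coe_divisionSet,
    ProbabilityTheory.uniformOn_apply_finset, ENNReal.toReal_div, ENNReal.toReal_natCast,
    ENNReal.toReal_natCast, le_div_iff₀ hD]
  have h1 := card_not_concentrated_le W k hδ hδ1 hb size hs hn
  have h2 : ((divisionSet n size).card : ℝ) ≤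
      ((divisionSet n size ∩ univ.filter Q).card : ℝ) +
      ((divisionSet n size).filter fun G => ¬ Concentrated W k δ b G).card := by
    norm_cast
    refine (card_le_card fun G hG => ?_).trans (card_union_le _ _)
    by_cases h : Concentrated W k δ b G
    · exact mem_union_left _ (mem_inter.2 ⟨hG, mem_filter.2 ⟨mem_univ _, hQ G hG h⟩⟩)
    · exact mem_union_right _ (mem_filter.2 ⟨hG, h⟩)
  have h3 := mul_le_mul_of_nonneg_right hε hD.le
  linarith

/-- The initial set `I` is only asserted to exist: later it matters that it has the prescribed
number of items in every category, and that the greedy set and its competitors contain it, so that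
only items outside `I` use up the remaining budget. -/
lemma part₁_spec [NeZero p] (g : Fin m → ℝ → ℝ) (hg : ∀ j, IsGain (g j))
    (What W : Fin n → Fin m → ℝ) (k : ℕ) (G : Fin n → Fin p) (size₀ r : ℕ)
    (hn : 0 < n) (hsize : 0 < size₀)
    (hW : ∀ i j, 0 ≤ W i j) (hC : ∀ j j', j ≠ j' → Disjoint (category W j) (category W j'))
    (ho : ∀ i j, G i = 0 → What i j = W i j) :
    ∃ I : Finset (Fin n),
      (∀ j, (I ∩ category W j).card = min r (category W j ∩ members G 0).card) ∧
      I ⊆ (part₁ g What k G (category W) size₀ r).val.S ∧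
      (∀ i ∈ (part₁ g What k G (category W) size₀ r).val.S, G i = 0 ∧ ∃ j, i ∈ category W j) ∧
      (∀ j, (part₁ g What k G (category W) size₀ r).val.cnt j =
        ((part₁ g What k G (category W) size₀ r).val.S ∩ category W j).card) ∧
      (part₁ g What k G (category W) size₀ r).val.S.card ≤
        I.card + (k * size₀ / n - (active (category W)).length * r) ∧
      ∀ T, I ⊆ T → (∀ i ∈ T, G i = 0 ∧ ∃ j, i ∈ category W j) →
        (T \ I).card ≤ k * size₀ / n - (active (category W)).length * r →
        ∑ j, g j (n / size₀ * ∑ i ∈ T, W i j) ≤ ∑ j, g j (n / size₀ *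
          ∑ i ∈ (part₁ g What k G (category W) size₀ r).val.S, W i j) := by
  set scale : ℝ := n / size₀ with hscale
  have hscale0 : 0 < scale := by positivity
  obtain ⟨a1, -, a3, a4⟩ := initial₁_spec g What G scale r hW hC ho (active (category W))
    (nodup_active _) ⟨∅, 0, 0⟩ ⟨fun j => by simp, fun j => by simp⟩ (fun j _ => by simp)
  have hval : (part₁ g What k G (category W) size₀ r).val =
      (greedy₁ g What G scale State₁.base ((active (category W)).flatMap (pairs (category W)))
        (k * size₀ / n - (active (category W)).length * r)
        (initial₁ g What G (category W) scale r (active (category W)) ⟨∅, 0, 0⟩).val).val := rfl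
  set s := (initial₁ g What G (category W) scale r (active (category W)) ⟨∅, 0, 0⟩).val
  have hcands : ∀ c, c ∈ (active (category W)).flatMap (pairs (category W)) ↔
      c.2 ∈ category W c.1 := by
    intro c
    rw [List.mem_flatMap]
    constructor
    · rintro ⟨j, -, hc⟩
      obtain ⟨rfl, h⟩ := mem_pairs.1 hc
      exact h
    · exact fun h => ⟨c.1, mem_active.2 ⟨c.2, h⟩, mem_pairs.2 ⟨rfl, h⟩⟩
  obtain ⟨b1, b2, b3, b4, -⟩ := greedy₁_spec g What G scale State₁.base
    ((active (category W)).flatMap (pairs (category W))) hW hC ho (fun c hc => (hcands c).1 hc)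
    (k * size₀ / n - (active (category W)).length * r) s a1
  rw [hval]
  refine ⟨s.S, fun j => ?_, b2, fun i hi => ?_, b1.cnt, b4, fun T hT1 hT2 hT3 => ?_⟩
  · by_cases hj : j ∈ active (category W)
    · exact a3 j hj
    · have : category W j = ∅ := not_nonempty_iff_eq_empty.1 fun h => hj (mem_active.2 h)
      simp [this]
  · by_cases his : i ∈ s.S
    · exact a4 i his (by simp)
    · obtain ⟨h0, c, hc, rfl⟩ := b3 i hi his
      exact ⟨h0, c.1, (hcands c).1 hc⟩
  · exact greedy₁_optimal g hg What G hscale0 _ hW hC ho hcands _ s a1 T hT1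
      (fun x hx _ => hT2 x hx) hT3

lemma sum_card_inter_category_le (W : Fin n → Fin m → ℝ)
    (hC : ∀ j j', j ≠ j' → Disjoint (category W j) (category W j')) (S : Finset (Fin n)) :
    ∑ j, (S ∩ category W j).card ≤ S.card := by
  rw [← card_biUnion fun j _ j' _ h => (hC j j' h).mono inter_subset_right inter_subset_right]
  exact card_le_card (biUnion_subset.2 fun j _ => inter_subset_left)

/-- The numbers of items intended for the categories sum up to at most `k`. -/
lemma sum_targets_le [NeZero p] (g : Fin m → ℝ → ℝ) (hg : ∀ j, IsGain (g j))
    (What W : Fin n → Fin m → ℝ) (k : ℕ) (G : Fin n → Fin p) (size₀ r : ℕ)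
    (hn : 0 < n) (hsize : 0 < size₀)
    (hW : ∀ i j, 0 ≤ W i j) (hC : ∀ j j', j ≠ j' → Disjoint (category W j) (category W j'))
    (ho : ∀ i j, G i = 0 → What i j = W i j)
    (hr : (active (category W)).length * r ≤ k * size₀ / n) :
    ((active (category W)).map fun j =>
      n * max r ((part₁ g What k G (category W) size₀ r).val.cnt j) / size₀).sum ≤ k := by
  obtain ⟨I, hI1, hI2, hI3, hI4, hI5, -⟩ := part₁_spec g hg What W k G size₀ r hn hsize hW hC ho
  set s := (part₁ g What k G (category W) size₀ r).val
  -- Slots beyond `r` are items received beyond `I`. A category with fewer than `r` items in the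
  -- first group has all of them in `I` and is charged `r`; any other has exactly `r` items in `I`.
  have hmax : ∀ j, max r (s.cnt j) + (I ∩ category W j).card ≤ r + (s.S ∩ category W j).card := by
    intro j
    have h1 : (s.S ∩ category W j).card ≤ (category W j ∩ members G 0).card := by
      refine card_le_card fun i hi => ?_
      rw [mem_inter] at hi ⊢
      exact ⟨hi.2, mem_members.2 (hI3 i hi.1).1⟩
    have h2 : (I ∩ category W j).card ≤ (s.S ∩ category W j).card :=
      card_le_card (inter_subset_inter_right hI2)
    rw [hI4 j]
    have := hI1 j
    omega
  have hsplit : ∀ A : Finset (Fin n), (∀ i ∈ A, ∃ j, i ∈ category W j) →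
      A.card = ∑ j ∈ univ.filter (fun j => (category W j).Nonempty), (A ∩ category W j).card := by
    intro A hA
    rw [← card_biUnion fun j _ j' _ h => (hC j j' h).mono inter_subset_right inter_subset_right]
    congr 1
    ext i
    simp only [mem_biUnion, mem_filter, mem_univ, true_and, mem_inter]
    constructor
    · intro hi
      obtain ⟨j, hj⟩ := hA i hi
      exact ⟨j, ⟨i, hj⟩, hi, hj⟩
    · rintro ⟨j, -, hi, -⟩
      exact hi
  have hsum : ∑ j ∈ univ.filter (fun j => (category W j).Nonempty), max r (s.cnt j) ≤
      k * size₀ / n := by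
    have h1 := sum_le_sum fun j (_ : j ∈ univ.filter fun j => (category W j).Nonempty) => hmax j
    rw [sum_add_distrib, sum_add_distrib, ← hsplit I fun i hi => (hI3 i (hI2 hi)).2,
      ← hsplit s.S fun i hi => (hI3 i hi).2, ← sum_active, ← sum_active, List.map_const',
      List.sum_replicate, smul_eq_mul, sum_active] at h1
    omega
  rw [sum_active]
  refine Nat.le_of_mul_le_mul_left ?_ hsize
  rw [mul_sum]
  calc ∑ j ∈ univ.filter (fun j => (category W j).Nonempty), size₀ * (n * max r (s.cnt j) / size₀)
      ≤ ∑ j ∈ univ.filter (fun j => (category W j).Nonempty), n * max r (s.cnt j) :=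
        sum_le_sum fun j _ => Nat.mul_div_le _ _
    _ = n * ∑ j ∈ univ.filter (fun j => (category W j).Nonempty), max r (s.cnt j) := by
        rw [mul_sum]
    _ ≤ n * (k * size₀ / n) := Nat.mul_le_mul_left _ hsum
    _ ≤ k * size₀ := Nat.mul_div_le _ _
    _ = size₀ * k := mul_comm _ _

end Summary

/-! ### Consequences of concentration for a single category -/

section Deterministic

variable {n m p : ℕ}

/-- Group sizes, utilities and error parameters for which the selection is nearly optimal. -/
structure Regular (W : Fin n → Fin m → ℝ) (G : Fin n → Fin p) (k r : ℕ) (δ τ γ b : ℝ) : Prop where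
  n_pos : 0 < n
  value : ∀ i j, W i j = 0 ∨ (τ < W i j ∧ W i j < 1 / τ)
  disj : ∀ j j', j ≠ j' → Disjoint (category W j) (category W j')
  δ_pos : 0 < δ
  δ_le : δ ≤ 1 / 8
  τ_pos : 0 < τ
  γ_pos : 0 < γ
  b_nonneg : 0 ≤ b
  size_ge : ∀ l, γ * n ≤ (members G l).card
  conc : Concentrated W k δ b G
  sq_le : r * r ≤ k
  b_le : b + 1 ≤ δ * τ ^ 2 * r
  b_le' : 4 * (b + 2) ≤ δ * γ * r
  m_le : 3 * m ≤ δ * γ * r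

variable {W : Fin n → Fin m → ℝ} {G : Fin n → Fin p} {k r : ℕ} {δ τ γ b : ℝ}

namespace Regular

lemma nonneg (h : Regular W G k r δ τ γ b) (i : Fin n) (j : Fin m) : 0 ≤ W i j := by
  rcases h.value i j with h0 | h0
  · rw [h0]
  · exact (h.τ_pos.trans h0.1).le

lemma le_inv (h : Regular W G k r δ τ γ b) (i : Fin n) (j : Fin m) : W i j ≤ 1 / τ := by
  rcases h.value i j with h0 | h0
  · rw [h0]; exact (one_div_pos.2 h.τ_pos).le
  · exact h0.2.le

lemma ge_of_mem (h : Regular W G k r δ τ γ b) {i : Fin n} {j : Fin m} (hi : i ∈ category W j) :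
    τ ≤ W i j := by
  rcases h.value i j with h0 | h0
  · rw [mem_category, h0] at hi
    exact absurd hi (lt_irrefl _)
  · exact h0.1.le

lemma n_pos' (h : Regular W G k r δ τ γ b) : (0 : ℝ) < n := by exact_mod_cast h.n_pos

lemma γ_le (h : Regular W G k r δ τ γ b) (l : Fin p) : γ ≤ (members G l).card / (n : ℝ) := by
  rw [le_div_iff₀ h.n_pos']; exact h.size_ge l

lemma card_members_le (G : Fin n → Fin p) (l : Fin p) : (members G l).card ≤ n := by
  simpa using card_le_univ (members G l)

lemma share_le_one (h : Regular W G k r δ τ γ b) (l : Fin p) :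
    (members G l).card / (n : ℝ) ≤ 1 := by
  rw [div_le_one h.n_pos']; exact_mod_cast card_members_le G l

lemma r_pos (h : Regular W G k r δ τ γ b) : (0 : ℝ) < r := by
  by_contra hr
  push Not at hr
  have h1 := h.b_le'
  have h2 : δ * γ * r ≤ 0 := mul_nonpos_of_nonneg_of_nonpos (mul_pos h.δ_pos h.γ_pos).le hr
  linarith [h.b_nonneg]

lemma bestSum_nonneg (h : Regular W G k r δ τ γ b) (j : Fin m) (y : ℕ) : 0 ≤ bestSum W j y :=
  sum_nonneg fun i _ => h.nonneg i j

lemma bestSum_mono (h : Regular W G k r δ τ γ b) (j : Fin m) {x y : ℕ} (hxy : x ≤ y) :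
    bestSum W j x ≤ bestSum W j y :=
  sum_le_sum_of_subset_of_nonneg (topSet_mono _ _ hxy) fun i _ _ => h.nonneg i j

lemma mul_bestSum_le (h : Regular W G k r δ τ γ b) (j : Fin m) {x y : ℕ} (hyx : y ≤ x) :
    (y : ℝ) * bestSum W j x ≤ x * bestSum W j y :=
  mul_sum_topSet_le _ _ (fun i _ => h.nonneg i j) hyx

/-- Since averages of best items decrease, a fraction `c` of the items retains at least the fraction
`c` of the value. -/
lemma bestSum_scale (h : Regular W G k r δ τ γ b) (j : Fin m) {x y : ℕ} {c : ℝ} (hyx : y ≤ x)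
    (hc1 : c ≤ 1) (hc : c * x ≤ y) : c * bestSum W j x ≤ bestSum W j y := by
  rcases Nat.eq_zero_or_pos x with rfl | hx
  · obtain rfl : y = 0 := by omega
    exact mul_le_of_le_one_left (h.bestSum_nonneg j 0) hc1
  · have hx' : (0 : ℝ) < x := by exact_mod_cast hx
    have h1 := h.mul_bestSum_le j hyx
    have h2 := mul_le_mul_of_nonneg_right hc (h.bestSum_nonneg j x)
    refine le_of_mul_le_mul_left ?_ hx'
    nlinarith

lemma b_div_γ (h : Regular W G k r δ τ γ b) : 4 * ((b + 2) / γ) ≤ δ * r := by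
  rw [← mul_div_assoc, div_le_iff₀ h.γ_pos]
  linarith [h.b_le']

lemma card_heaviest_le (W : Fin n → Fin m → ℝ) (j : Fin m) (y : ℕ) :
    (heaviest W j y).card ≤ y := by
  rw [heaviest, card_topSet]; exact min_le_left _ _

/-- If in every group the best items of category `j` are taken until `κ` times the share of the
group is reached, then nearly the value of the best `κ` items is obtained. -/
lemma bestSum_le_of_upper (h : Regular W G k r δ τ γ b) (j : Fin m) {S : Finset (Fin n)} {κ : ℕ}
    (hκ : κ ≤ k) (hr : r ≤ κ) (hup : IsUpper G (fun i => W i j) (category W j) S)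
    (hterm : ∀ i ∈ category W j, i ∉ S → κ * (members G (G i)).card <
      n * ((S ∩ category W j ∩ members G (G i)).card + 1)) :
    (1 - 2 * δ) * bestSum W j κ ≤ ∑ i ∈ S ∩ category W j, W i j := by
  have hδ := h.δ_pos
  have hδ1 := h.δ_le
  have hr' : (r : ℝ) ≤ κ := by exact_mod_cast hr
  have hdiv := h.b_div_γ
  have hb1 : (b + 1) / γ + 1 ≤ δ * r := by
    have h1 : (b + 1) / γ + 1 / γ = (b + 2) / γ := by ring
    have h2 : (0 : ℝ) ≤ (b + 2) / γ := div_nonneg (by linarith [h.b_nonneg]) h.γ_pos.le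
    have h3 : 1 ≤ 1 / γ := by
      rcases n with _ | n
      · exact absurd h.n_pos (lt_irrefl _)
      · rw [le_div_iff₀ h.γ_pos, one_mul]
        exact (h.γ_le (G 0)).trans (h.share_le_one (G 0))
    linarith
  have hδκ : δ * r ≤ δ * κ := mul_le_mul_of_nonneg_left hr' hδ.le
  -- Chosen so that the `⌊z⌋` best items, even at their largest deviation, put at most `q * κ - 1`
  -- items into a group of share `q ≥ γ`, fewer than `S` takes there unless it has exhausted the
  -- group's items. Still, `⌊z⌋ ≥ (1 - 2 * δ) * κ`.
  set z : ℝ := (1 - δ) * κ - (b + 1) / γ with hz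
  have hz0 : (1 - 2 * δ) * κ + 1 ≤ z := by rw [hz]; nlinarith
  have hκ0 : (0 : ℝ) ≤ κ := Nat.cast_nonneg κ
  have hznn : 0 ≤ z := by nlinarith
  have hyz : (⌊z⌋₊ : ℝ) ≤ z := Nat.floor_le hznn
  have hzy : z < ⌊z⌋₊ + 1 := Nat.lt_floor_add_one z
  have hb0 : 0 ≤ (b + 1) / γ := div_nonneg (by linarith [h.b_nonneg]) h.γ_pos.le
  have hyκ : ⌊z⌋₊ ≤ κ := by
    have : (⌊z⌋₊ : ℝ) ≤ κ := by rw [hz] at hyz; nlinarith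
    exact_mod_cast this
  refine (h.bestSum_scale j hyκ (by linarith) (by linarith)).trans ?_
  set y := ⌊z⌋₊
  have hfib : ∀ A : Finset (Fin n), ∑ i ∈ A, W i j = ∑ l, ∑ i ∈ A ∩ members G l, W i j := by
    intro A
    rw [← sum_fiberwise A G]
    refine sum_congr rfl fun l _ => sum_congr ?_ fun _ _ => rfl
    ext i; simp [mem_members]
  rw [bestSum, hfib (heaviest W j y), hfib (S ∩ category W j)]
  refine sum_le_sum fun l _ => ?_
  refine sum_le_sum_of_upper (X := category W j ∩ members G l)
    (inter_subset_inter_right (topSet_subset _ _ _)) (fun i _ => h.nonneg i j)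
    (fun i _ => h.nonneg i j) ?_ ?_
  · intro i hi i' hi' hn'
    simp only [mem_inter, mem_members] at hi hi' hn'
    exact hup i (mem_inter.2 hi.1) i' hi'.1 (fun hs => hn' ⟨⟨hs, hi'.1⟩, hi'.2⟩)
      (hi'.2.trans hi.2.symm)
  · by_cases hall : category W j ∩ members G l ⊆ S ∩ category W j ∩ members G l
    · exact Or.inr hall
    left
    obtain ⟨i, hi, hiS⟩ := not_subset.1 hall
    obtain ⟨hiC, hil⟩ := mem_inter.1 hi
    obtain rfl := mem_members.1 hil
    have h1 := hterm i hiC fun hs => hiS (mem_inter.2 ⟨mem_inter.2 ⟨hs, hiC⟩, hil⟩)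
    have h2 := (h.conc j (G i) y (hyκ.trans hκ)).1
    set q : ℝ := (members G (G i)).card / n with hq
    have hqγ : γ ≤ q := h.γ_le _
    have hq0 : 0 ≤ q := h.γ_pos.le.trans hqγ
    have h3 : κ * q < (S ∩ category W j ∩ members G (G i)).card + 1 := by
      rw [hq, ← mul_div_assoc, div_lt_iff₀ h.n_pos', mul_comm _ (n : ℝ)]
      exact_mod_cast h1
    have h4 : ((heaviest W j y).card : ℝ) ≤ y := by exact_mod_cast card_heaviest_le W j y
    have h5 : b + 1 ≤ q * ((b + 1) / γ) := by
      rw [← mul_div_assoc, le_div_iff₀ h.γ_pos, mul_comm]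
      exact mul_le_mul_of_nonneg_right hqγ (by linarith [h.b_nonneg])
    have h6 : (1 + δ) * (q * (heaviest W j y).card) ≤ q * (κ - (b + 1) / γ) := by
      have : (1 + δ) * (y : ℝ) ≤ κ - (b + 1) / γ := by
        have h61 := mul_le_mul_of_nonneg_left hyz (show 0 ≤ 1 + δ by linarith)
        rw [hz] at h61
        nlinarith [mul_nonneg hδ.le hb0, mul_nonneg (mul_nonneg hδ.le hδ.le) hκ0]
      calc (1 + δ) * (q * (heaviest W j y).card) = q * ((1 + δ) * (heaviest W j y).card) := by ring
        _ ≤ q * ((1 + δ) * y) := by gcongr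
        _ ≤ _ := mul_le_mul_of_nonneg_left this hq0
    have h7 : ((heaviest W j y ∩ members G (G i)).card : ℝ) <
        (S ∩ category W j ∩ members G (G i)).card := by
      nlinarith
    exact_mod_cast h7.le

/-- A category with few items in the first group is nearly exhausted. -/
lemma bestSum_le_of_card_le (h : Regular W G k r δ τ γ b) (j : Fin m) (l : Fin p) {x κ : ℕ}
    (hx : x ≤ k) (hκ : r ≤ κ) (hrκ : (r : ℝ) ≤ (members G l).card / n * (κ + 1))
    (hc : (category W j ∩ members G l).card ≤ r) :
    (1 - 2 * δ) * bestSum W j x ≤ bestSum W j κ := by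
  have hδ := h.δ_pos
  rcases le_or_gt (heaviest W j x).card κ with hle | hlt
  · have hsub : bestSum W j x ≤ bestSum W j κ := by
      rcases le_or_gt x κ with hxκ | hxκ
      · exact h.bestSum_mono j hxκ
      · rw [heaviest, card_topSet] at hle
        have hcard : (category W j).card ≤ κ := by omega
        unfold bestSum heaviest
        rw [topSet_eq_of_card_le _ _ hcard, topSet_eq_of_card_le _ _ (hcard.trans hxκ.le)]
    refine le_trans ?_ hsub
    exact mul_le_of_le_one_left (h.bestSum_nonneg j x) (by linarith)
  · have hxeq : bestSum W j x = bestSum W j (heaviest W j x).card := by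
      unfold bestSum
      refine sum_congr ?_ fun _ _ => rfl
      unfold heaviest
      rw [card_topSet]
      rcases le_total x (category W j).card with hxc | hxc
      · rw [min_eq_left hxc]
      · rw [min_eq_right hxc, topSet_eq_of_card_le _ _ hxc, topSet_eq_of_card_le _ _ le_rfl]
    have h1 := (h.conc j l x hx).2
    set x' := (heaviest W j x).card
    rw [hxeq]
    refine h.bestSum_scale j hlt.le (by linarith) ?_
    set q : ℝ := (members G l).card / n with hq
    have hqγ : γ ≤ q := h.γ_le _
    have hq0 : 0 < q := h.γ_pos.trans_le hqγ
    have h2 : ((heaviest W j x ∩ members G l).card : ℝ) ≤ r := by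
      exact_mod_cast (card_le_card (inter_subset_inter_right (topSet_subset _ _ _))).trans hc
    -- Concentration gives `(1 - δ) * q * x' - b ≤ r ≤ q * (κ + 1)`. After division by `q`, the
    -- excess `1 + b / q` is at most `(b + 2) / γ`, which `b_div_γ` absorbs into `δ * x'`.
    have h3 : q * ((1 - δ) * x') ≤ q * (κ + 1 + b / q) := by
      rw [mul_add, mul_div_cancel₀ _ hq0.ne']
      linarith
    have h4 := le_of_mul_le_mul_left h3 hq0
    have h5 : b / q ≤ b / γ := div_le_div_of_nonneg_left h.b_nonneg h.γ_pos hqγ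
    have h6 : b / γ + 1 ≤ (b + 2) / γ := by
      rw [div_add' _ _ _ h.γ_pos.ne', div_le_div_iff_of_pos_right h.γ_pos]
      linarith [hqγ.trans (h.share_le_one l)]
    have h7 : (0 : ℝ) ≤ (b + 2) / γ := div_nonneg (by linarith [h.b_nonneg]) h.γ_pos.le
    have h8 : δ * (r : ℝ) ≤ δ * x' :=
      mul_le_mul_of_nonneg_left (by exact_mod_cast hκ.trans hlt.le) hδ.le
    linarith [h.b_div_γ]

/-- The rescaled value of a set of items from one group does not much exceed the value of the best
items of the category. -/
lemma sum_le_bestSum (h : Regular W G k r δ τ γ b) (j : Fin m) (l : Fin p) {A : Finset (Fin n)}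
    {κ : ℕ} (hA : A ⊆ category W j ∩ members G l) (hrA : r ≤ A.card) (hκ : κ ≤ k)
    (hAκ : (A.card : ℝ) ≤ (members G l).card / n * (κ + 1)) :
    (1 - δ) * ∑ i ∈ A, W i j ≤ (1 + δ) * ((members G l).card / n * bestSum W j κ) := by
  have hδ := h.δ_pos
  have hτ' : (0 : ℝ) ≤ 1 / τ := (one_div_pos.2 h.τ_pos).le
  set q : ℝ := (members G l).card / n with hq
  have hq0 : 0 ≤ q := h.γ_pos.le.trans (h.γ_le _)
  have hq1 : q ≤ 1 := h.share_le_one l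
  -- Utilities are split at the threshold of the `κ` best items: the excess over `v` is handled by
  -- summation by parts, and the rest amounts to counting items.
  obtain ⟨v, hv0, hvM, hv1, hv2, hv3⟩ := exists_threshold (category W j) (fun i => W i j) hτ'
    (fun i _ => h.nonneg i j) (fun i _ => h.le_inv i j) κ
  change ∀ i ∈ heaviest W j κ, _ at hv1
  change ∀ i ∈ category W j, i ∉ heaviest W j κ → _ at hv2
  change _ ∨ (heaviest W j κ).card = κ at hv3
  -- Concentration for all `y ≤ κ` says precisely that the indicator of the group minus `(1 + δ) *
  -- q` has sums at most `b` over all top sets.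
  have habel := sum_mul_sub_le (category W j) (fun i => W i j)
    (fun i => (if i ∈ members G l then (1 : ℝ) else 0) - (1 + δ) * q) h.b_nonneg
    (fun i _ => h.le_inv i j) κ (fun y hy => by
      have := (h.conc j l y (hy.trans hκ)).1
      change ∑ i ∈ heaviest W j y, _ ≤ b
      rw [sum_sub_distrib, sum_boole, sum_const, nsmul_eq_mul, filter_mem_eq_inter]
      linarith) v hvM hv1
  change ∑ i ∈ heaviest W j κ, _ ≤ _ at habel
  simp only [sub_mul, sum_sub_distrib, ite_mul, one_mul, zero_mul, ← mul_sum] at habel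
  rw [← sum_filter, filter_mem_eq_inter] at habel
  have hsum : ∑ i ∈ heaviest W j κ, W i j - ∑ i ∈ heaviest W j κ, v =
      bestSum W j κ - (heaviest W j κ).card * v := by
    rw [sum_const, nsmul_eq_mul, bestSum]
  have hAv : ∑ i ∈ A, W i j ≤ ∑ i ∈ heaviest W j κ ∩ members G l, (W i j - v) + A.card * v := by
    have h1 : ∑ i ∈ A, (W i j - v) ≤ ∑ i ∈ A ∩ heaviest W j κ, (W i j - v) := by
      rw [← filter_mem_eq_inter, sum_filter]
      refine sum_le_sum fun i hi => ?_
      split_ifs with hi'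
      · exact le_rfl
      · exact sub_nonpos.2 (hv2 i (mem_inter.1 (hA hi)).1 hi')
    have h2 : ∑ i ∈ A ∩ heaviest W j κ, (W i j - v) ≤
        ∑ i ∈ heaviest W j κ ∩ members G l, (W i j - v) := by
      refine sum_le_sum_of_subset_of_nonneg (fun i hi => ?_) fun i hi _ =>
        sub_nonneg.2 (hv1 i (mem_inter.1 hi).1)
      rw [mem_inter] at hi ⊢
      exact ⟨hi.2, (mem_inter.1 (hA hi.1)).2⟩
    have h3 : ∑ i ∈ A, (W i j - v) = ∑ i ∈ A, W i j - A.card * v := by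
      rw [sum_sub_distrib, sum_const, nsmul_eq_mul]
    linarith
  have hWA : τ * r ≤ ∑ i ∈ A, W i j := by
    have h1 := card_nsmul_le_sum A (fun i => W i j) τ fun i hi =>
      h.ge_of_mem (mem_inter.1 (hA hi)).1
    rw [nsmul_eq_mul, mul_comm] at h1
    exact (mul_le_mul_of_nonneg_left (by exact_mod_cast hrA) h.τ_pos.le).trans h1
  -- Here the `r` guaranteed items are needed: with each worth at least `τ`, the error `b / τ` from
  -- the summation by parts and the rounding error of at most `1 / τ` are a fraction `δ` of the
  -- value.
  have hbτ : (b + 1) * (1 / τ) ≤ δ * ∑ i ∈ A, W i j := by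
    have h1 : (b + 1) * (1 / τ) ≤ δ * (τ * r) := by
      rw [mul_one_div, div_le_iff₀ h.τ_pos]
      calc b + 1 ≤ _ := h.b_le
        _ = _ := by ring
    exact h1.trans (mul_le_mul_of_nonneg_left hWA hδ.le)
  have hcardv : (A.card : ℝ) * v ≤ (1 + δ) * q * ((heaviest W j κ).card * v) + v := by
    rcases hv3 with rfl | hc
    · simp
    · rw [hc]
      have h1 := mul_le_mul_of_nonneg_right hAκ hv0
      have h2 : 0 ≤ δ * q * (κ * v) := by positivity
      have h3 := mul_le_mul_of_nonneg_right hq1 hv0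
      nlinarith
  rw [hsum] at habel
  have hbv : 0 ≤ b * v := mul_nonneg h.b_nonneg hv0
  nlinarith

/-- The items of one group among the best ones of a category are worth about their share. -/
lemma bestSum_le_sum (h : Regular W G k r δ τ γ b) (j : Fin m) (l : Fin p) {A : Finset (Fin n)}
    {y : ℕ} (hy : y ≤ k) (hA : A ⊆ category W j) (hrA : r ≤ A.card)
    (hyA : heaviest W j y ∩ members G l ⊆ A) :
    (1 - δ) * ((members G l).card / n * bestSum W j y) ≤ (1 + δ) * ∑ i ∈ A, W i j := by
  have hδ := h.δ_pos
  have hτ' : (0 : ℝ) ≤ 1 / τ := (one_div_pos.2 h.τ_pos).le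
  set q : ℝ := (members G l).card / n with hq
  -- The same summation with opposite signs, from the lower deviations, and with threshold `0`.
  have habel := sum_mul_sub_le (category W j) (fun i => W i j)
    (fun i => (1 - δ) * q - (if i ∈ members G l then (1 : ℝ) else 0)) h.b_nonneg
    (fun i _ => h.le_inv i j) y (fun y' hy' => by
      have := (h.conc j l y' (hy'.trans hy)).2
      change ∑ i ∈ heaviest W j y', _ ≤ b
      rw [sum_sub_distrib, sum_boole, sum_const, nsmul_eq_mul, filter_mem_eq_inter]
      linarith) 0 hτ' fun i _ => h.nonneg i j
  change ∑ i ∈ heaviest W j y, _ ≤ _ at habel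
  simp only [sub_zero, sub_mul, sum_sub_distrib, ite_mul, one_mul, zero_mul, ← mul_sum] at habel
  rw [← sum_filter, filter_mem_eq_inter] at habel
  have h1 : ∑ i ∈ heaviest W j y ∩ members G l, W i j ≤ ∑ i ∈ A, W i j :=
    sum_le_sum_of_subset_of_nonneg hyA fun i _ _ => h.nonneg i j
  have hWA : τ * r ≤ ∑ i ∈ A, W i j := by
    have h1 := card_nsmul_le_sum A (fun i => W i j) τ fun i hi => h.ge_of_mem (hA hi)
    rw [nsmul_eq_mul, mul_comm] at h1
    exact (mul_le_mul_of_nonneg_left (by exact_mod_cast hrA) h.τ_pos.le).trans h1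
  have hbτ : b * (1 / τ) ≤ δ * ∑ i ∈ A, W i j := by
    have h1 : b * (1 / τ) ≤ δ * (τ * r) := by
      rw [mul_one_div, div_le_iff₀ h.τ_pos]
      calc b ≤ b + 1 := by linarith
        _ ≤ _ := h.b_le
        _ = _ := by ring
    exact h1.trans (mul_le_mul_of_nonneg_left hWA hδ.le)
  unfold bestSum
  linarith

end Regular

end Deterministic

/-! ### Near-optimality for concentrated divisions -/

section NearOptimal

variable {n m p : ℕ} {W : Fin n → Fin m → ℝ} {G : Fin n → Fin p} {k r : ℕ} {δ τ γ b : ℝ}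

lemma observed_nonneg {φ : Fin p → ℝ → ℝ} (hφ : ∀ l, IsBias (φ l)) (hW : ∀ i j, 0 ≤ W i j)
    (i : Fin n) (j : Fin m) : 0 ≤ observed φ G W i j :=
  (hφ _).nonneg _ (hW i j)

/-- Items of one group are seen through the same strictly increasing function, so an order found
among observed utilities transfers back to the latent ones. -/
lemma observed_le_iff {φ : Fin p → ℝ → ℝ} (hφ : ∀ l, IsBias (φ l)) (hW : ∀ i j, 0 ≤ W i j)
    {i i' : Fin n} {j : Fin m} (hG : G i' = G i) :
    observed φ G W i' j ≤ observed φ G W i j ↔ W i' j ≤ W i j := by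
  unfold observed
  rw [hG]
  exact (hφ _).strictMono.le_iff_le (hW i' j) (hW i j)

lemma observed_zero [NeZero p] {φ : Fin p → ℝ → ℝ} (hφ₀ : ∀ x, 0 ≤ x → φ 0 x = x)
    (hW : ∀ i j, 0 ≤ W i j) (i : Fin n) (j : Fin m) (hG : G i = 0) :
    observed φ G W i j = W i j := by
  unfold observed
  rw [hG]
  exact hφ₀ _ (hW i j)

lemma length_active_le_attributes (C : Fin m → Finset (Fin n)) : (active C).length ≤ m := by
  exact (List.length_filter_le _ _).trans (by simp)

namespace Regular

lemma mul_le_share (h : Regular W G k r δ τ γ b) : (m : ℝ) * r ≤ γ * r * r := by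
  have h1 : δ * (γ * r) ≤ 1 * (γ * r) := mul_le_mul_of_nonneg_right (by linarith [h.δ_le])
    (mul_pos h.γ_pos h.r_pos).le
  refine mul_le_mul_of_nonneg_right ?_ h.r_pos.le
  have := h.m_le
  have hm : (0 : ℝ) ≤ m := Nat.cast_nonneg m
  linarith

/-- The reserved slots number at most `m * r ≤ γ * r * r ≤ γ * k`. Hence the truncated subtraction
in the budget of the first part is a true one. -/
lemma active_mul_le (h : Regular W G k r δ τ γ b) (l : Fin p) :
    (active (category W)).length * r ≤ k * (members G l).card / n := by
  rw [Nat.le_div_iff_mul_le h.n_pos]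
  refine (Nat.mul_le_mul_right _ (Nat.mul_le_mul_right _ (length_active_le_attributes _))).trans ?_
  have h1 : (r : ℝ) * r ≤ k := by exact_mod_cast h.sq_le
  have h2 : (m : ℝ) * r * n ≤ k * (members G l).card := by
    calc (m : ℝ) * r * n ≤ γ * r * r * n :=
          mul_le_mul_of_nonneg_right h.mul_le_share h.n_pos'.le
      _ = (r * r) * (γ * n) := by ring
      _ ≤ k * (members G l).card := mul_le_mul h1 (h.size_ge l)
          (mul_pos h.γ_pos h.n_pos').le (Nat.cast_nonneg _)
  exact_mod_cast h2

lemma members_pos (h : Regular W G k r δ τ γ b) (l : Fin p) : 0 < (members G l).card := by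
  have := (mul_pos h.γ_pos h.n_pos').trans_le (h.size_ge l)
  exact_mod_cast this

/-- The second part nearly obtains the value of the best `κ` items of category `j`, where `κ` is the
number of items intended for this category. -/
lemma chosen_ge [NeZero p] {g : Fin m → ℝ → ℝ} (h : Regular W G k r δ τ γ b)
    (hg : ∀ j, IsGain (g j)) {φ : Fin p → ℝ → ℝ} (hφ : ∀ l, IsBias (φ l))
    (hφ₀ : ∀ x, 0 ≤ x → φ 0 x = x) (hr : r = Nat.sqrt k) {j : Fin m}
    (hj : (category W j).Nonempty) {κ : ℕ} (hκ : κ = n * max r ((part₁ g (observed φ G W) k G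
      (category W) (members G 0).card r).val.cnt j) / (members G 0).card) :
    r ≤ κ ∧ κ ≤ k ∧ (1 - 2 * δ) * bestSum W j κ ≤
      ∑ i ∈ (chosen g (observed φ G W) k G (category W)).S ∩ category W j, W i j := by
  have hsum := sum_targets_le g hg (observed φ G W) W k G (members G 0).card r h.n_pos
    (h.members_pos 0) h.nonneg h.disj (observed_zero hφ₀ h.nonneg) (h.active_mul_le 0)
  obtain ⟨-, hp⟩ := part₂_spec g (observed φ G W) k G (category W) (members G 0).card r
    (part₁ g (observed φ G W) k G (category W) (members G 0).card r).val h.disj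
    (fun j => (hg j).mono) (observed_nonneg hφ h.nonneg) h.n_pos (active (category W))
    (nodup_active _) ⟨∅, 0, 0⟩ (valid_empty k G) (fun j _ => by simp)
    (fun l => by
      simp only [empty_inter, card_empty, mul_zero, zero_add]
      exact Nat.mul_le_mul_right _ hsum)
  obtain ⟨hup, hterm⟩ := hp j (mem_active.2 hj)
  have hrκ : r ≤ κ := by
    rw [hκ, Nat.le_div_iff_mul_le (h.members_pos 0), mul_comm]
    exact Nat.mul_le_mul (card_members_le G 0) (le_max_left _ _)
  have hκk : κ ≤ k := by
    refine le_trans ?_ hsum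
    rw [sum_active, hκ]
    exact single_le_sum (f := fun j => n * max r ((part₁ g (observed φ G W) k G
      (category W) (members G 0).card r).val.cnt j) / (members G 0).card)
      (fun _ _ => Nat.zero_le _) (mem_filter.2 ⟨mem_univ j, hj⟩)
  refine ⟨hrκ, hκk, ?_⟩
  subst hr
  refine h.bestSum_le_of_upper j hκk hrκ ?_ ?_
  · intro i hi i' hi' hn' hG
    exact (observed_le_iff hφ h.nonneg hG).1 (hup i hi i' hi' hn' hG)
  · rw [hκ]
    exact hterm

/-- The best items of all categories, restricted to one group, fit into the budget that the first
part has for this group. -/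
lemma sum_card_competitor_le (h : Regular W G k r δ τ γ b) (l : Fin p) {x : Fin m → ℕ}
    (hx : ∑ j, x j ≤ k) :
    ∑ j, (heaviest W j ⌈(1 - 2 * δ) * x j⌉₊ ∩ members G l).card ≤
      k * (members G l).card / n - (active (category W)).length * r := by
  have hδ := h.δ_pos
  have hδ1 := h.δ_le
  have hr0 := h.r_pos
  refine Nat.le_sub_of_add_le ((Nat.le_div_iff_mul_le h.n_pos).2 ?_)
  set q : ℝ := (members G l).card / n with hq
  have hqγ : γ ≤ q := h.γ_le l
  have hq0 : 0 < q := h.γ_pos.trans_le hqγ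
  have hq1 : q ≤ 1 := h.share_le_one l
  have hm : (0 : ℝ) ≤ m := Nat.cast_nonneg m
  have hxk : ∀ j, x j ≤ k := fun j => (single_le_sum (fun _ _ => Nat.zero_le _)
    (mem_univ j)).trans hx
  have hceil : ∀ j, (⌈(1 - 2 * δ) * x j⌉₊ : ℝ) ≤ (1 - 2 * δ) * x j + 1 := fun j =>
    (Nat.ceil_lt_add_one (mul_nonneg (by linarith) (Nat.cast_nonneg _))).le
  have h1 : ∀ j, ((heaviest W j ⌈(1 - 2 * δ) * x j⌉₊ ∩ members G l).card : ℝ) ≤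
      (1 + δ) * (q * ((1 - 2 * δ) * x j + 1)) + b := by
    intro j
    have hle : ⌈(1 - 2 * δ) * x j⌉₊ ≤ k := by
      refine le_trans (Nat.ceil_le.2 ?_) (hxk j)
      exact mul_le_of_le_one_left (Nat.cast_nonneg _) (by linarith)
    refine (h.conc j l _ hle).1.trans ?_
    have h2 : ((heaviest W j ⌈(1 - 2 * δ) * x j⌉₊).card : ℝ) ≤ (1 - 2 * δ) * x j + 1 :=
      le_trans (by exact_mod_cast card_heaviest_le W j _) (hceil j)
    rw [← hq]
    gcongr
  have h2 : (∑ j, (heaviest W j ⌈(1 - 2 * δ) * x j⌉₊ ∩ members G l).card : ℝ) ≤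
      (1 + δ) * (q * ((1 - 2 * δ) * k + m)) + m * b := by
    refine (sum_le_sum fun j _ => h1 j).trans ?_
    have hx' : (∑ j, (x j : ℝ)) ≤ k := by exact_mod_cast hx
    rw [sum_add_distrib, ← mul_sum, ← mul_sum, sum_add_distrib, ← mul_sum]
    simp only [sum_const, card_univ, Fintype.card_fin, nsmul_eq_mul, mul_one]
    gcongr
    linarith
  have hk : (r : ℝ) * r ≤ k := by exact_mod_cast h.sq_le
  have hbr : b + 2 ≤ r := by
    have h3 : δ * γ ≤ 1 * 1 := mul_le_mul (by linarith) (hqγ.trans hq1) h.γ_pos.le zero_le_one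
    have h4 := mul_le_mul_of_nonneg_right h3 hr0.le
    have := h.b_le'
    linarith [h.b_nonneg]
  have h3 : 3 * m * r ≤ δ * q * k := by
    calc 3 * m * r ≤ δ * γ * r * r := mul_le_mul_of_nonneg_right h.m_le hr0.le
      _ = δ * γ * (r * r) := by ring
      _ ≤ δ * q * k := mul_le_mul (mul_le_mul_of_nonneg_left hqγ hδ.le) hk (by positivity)
          (by positivity)
  have h4 : (1 + δ) * (q * ((1 - 2 * δ) * k + m)) + m * b + m * r ≤ q * k := by
    have h5 : (1 + δ) * (q * m) ≤ 2 * m := by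
      have : q * m ≤ 1 * m := mul_le_mul_of_nonneg_right hq1 hm
      have := mul_le_mul_of_nonneg_left this (show 0 ≤ 1 + δ by linarith)
      have := mul_le_mul_of_nonneg_right hδ1 hm
      linarith
    have h6 : m * (b + 2) ≤ m * r := mul_le_mul_of_nonneg_left hbr hm
    have h7 : 0 ≤ δ * δ * (q * k) := by positivity
    nlinarith
  have h5 : ((∑ j, (heaviest W j ⌈(1 - 2 * δ) * x j⌉₊ ∩ members G l).card : ℕ) +
      ((active (category W)).length * r : ℕ) : ℝ) ≤ q * k := by
    refine le_trans ?_ h4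
    push_cast
    gcongr
    exact_mod_cast length_active_le_attributes (category W)
  rw [hq, div_mul_eq_mul_div, le_div_iff₀ h.n_pos', mul_comm ((members G l).card : ℝ)] at h5
  exact_mod_cast h5

/-- With `c = 1 - 2 * δ`, each category loses `c ^ 2` between the optimum and the competitor `T` in
the first group, and `c ^ 2` between the greedy set there and the output. Greedy optimality links
the two, but only for the sum over all categories. -/
lemma opt_le [NeZero p] {g : Fin m → ℝ → ℝ} (h : Regular W G k r δ τ γ b)
    (hg : ∀ j, IsGain (g j)) {φ : Fin p → ℝ → ℝ} (hφ : ∀ l, IsBias (φ l))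
    (hφ₀ : ∀ x, 0 ≤ x → φ 0 x = x) (hr : r = Nat.sqrt k) (hk : 1 ≤ k) (hkn : k ≤ n) :
    (1 - 8 * δ) * opt g W k ≤
      utility g W (fairGreedy g (observed φ G W) k G (category W)).val := by
  have hδ := h.δ_pos
  have hδ1 := h.δ_le
  have hn := h.n_pos'
  set c : ℝ := 1 - 2 * δ with hc
  have hc0 : 0 ≤ c := by rw [hc]; linarith
  have hc1 : c ≤ 1 := by rw [hc]; linarith
  have hc2 : 0 ≤ c ^ 2 := sq_nonneg c
  have hc21 : c ^ 2 ≤ 1 := pow_le_one₀ hc0 hc1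
  obtain ⟨Sopt, hSopt, hopt⟩ := exists_mem_eq_sup'
    (s := univ.filter fun S : Finset (Fin n) => S.card ≤ k) ⟨∅, by simp⟩ (utility g W)
  have hSk : Sopt.card ≤ k := (mem_filter.1 hSopt).2
  set x : Fin m → ℕ := fun j => (Sopt ∩ category W j).card with hx
  have hxk : ∑ j, x j ≤ k := (sum_card_inter_category_le W h.disj Sopt).trans hSk
  have hxk' : ∀ j, x j ≤ k := fun j => (single_le_sum (fun _ _ => Nat.zero_le _)
    (mem_univ j)).trans hxk
  set P : Fin m → ℝ := fun j => bestSum W j (x j) with hP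
  have hP0 : ∀ j, 0 ≤ P j := fun j => h.bestSum_nonneg j _
  have hsumC : ∀ (A : Finset (Fin n)) j, ∑ i ∈ A, W i j = ∑ i ∈ A ∩ category W j, W i j := by
    intro A j
    refine (sum_subset inter_subset_left fun i hi hi' => ?_).symm
    by_contra hne
    exact hi' (mem_inter.2 ⟨hi, mem_category.2 (lt_of_le_of_ne (h.nonneg i j) (Ne.symm hne))⟩)
  have hoptP : opt g W k ≤ ∑ j, g j (P j) := by
    unfold opt
    rw [hopt]
    refine sum_le_sum fun j _ => (hg j).mono (sum_nonneg fun i _ => h.nonneg i j) (hP0 j) ?_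
    rw [hsumC]
    refine sum_le_sum_of_upper (X := category W j) inter_subset_right
      (fun i _ => h.nonneg i j) (fun i _ => h.nonneg i j) (topSet_upper _ _ _) (Or.inl ?_)
    rw [heaviest, card_topSet]
    exact le_min le_rfl (card_le_card inter_subset_right)
  obtain ⟨I, hI1, hI2, hI3, hI4, -, hI6⟩ := part₁_spec g hg (observed φ G W) W k G
    (members G 0).card r h.n_pos (h.members_pos 0) h.nonneg h.disj (observed_zero hφ₀ h.nonneg)
  have hchosen := fun j => h.chosen_ge hg hφ hφ₀ hr (j := j)
  set s := (part₁ g (observed φ G W) k G (category W) (members G 0).card r).val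
  set S := (fairGreedy g (observed φ G W) k G (category W)).val
  have hsub : (chosen g (observed φ G W) k G (category W)).S ⊆ S :=
    (fairGreedy_spec g (observed φ G W) k G (category W) hk hkn).1
  set q : ℝ := (members G 0).card / n with hq
  have hq0 : 0 < q := h.γ_pos.trans_le (h.γ_le 0)
  have hscale : (n : ℝ) / (members G 0).card = q⁻¹ := by rw [hq, inv_div]
  rw [hscale] at hI6
  -- Shrinking by `c` makes room in the first group's budget for deviations and for the reserved
  -- slots.
  set y : Fin m → ℕ := fun j => ⌈c * x j⌉₊ with hy
  have hyx : ∀ j, y j ≤ x j := fun j => Nat.ceil_le.2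
    (mul_le_of_le_one_left (Nat.cast_nonneg _) hc1)
  -- The greedy set beats only competitors that contain `I`; including it is free, as the remaining
  -- budget counts `T \ I`.
  set T := I ∪ univ.biUnion fun j => heaviest W j (y j) ∩ members G 0 with hT
  have hTmem : ∀ i ∈ T, G i = 0 ∧ ∃ j, i ∈ category W j := by
    intro i hi
    rcases mem_union.1 hi with hi | hi
    · exact hI3 i (hI2 hi)
    · obtain ⟨j, -, hij⟩ := mem_biUnion.1 hi
      exact ⟨mem_members.1 (mem_inter.1 hij).2, j, topSet_subset _ _ _ (mem_inter.1 hij).1⟩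
  have hgreedy := hI6 T subset_union_left hTmem (by
    refine le_trans ?_ (h.sum_card_competitor_le 0 hxk)
    refine le_trans (card_le_card ?_) card_biUnion_le
    intro i hi
    rw [mem_sdiff, hT, mem_union] at hi
    exact hi.1.resolve_left hi.2)
  have hS : ∀ j, (category W j).Nonempty →
      c * bestSum W j (n * max r (s.cnt j) / (members G 0).card) ≤ ∑ i ∈ S, W i j := by
    intro j hj
    refine (hchosen j hj rfl).2.2.trans ?_
    rw [hsumC S]
    exact sum_le_sum_of_subset_of_nonneg (inter_subset_inter_right hsub)
      fun i _ _ => h.nonneg i j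
  have hcatG : ∀ A : Finset (Fin n), (∀ i ∈ A, G i = 0 ∧ ∃ j, i ∈ category W j) → ∀ j,
      A ∩ category W j ⊆ category W j ∩ members G 0 := by
    intro A hA j i hi
    rw [mem_inter] at hi ⊢
    exact ⟨hi.2, mem_members.2 (hA i hi.1).1⟩
  have hκ : ∀ j (a : ℕ), a ≤ max r (s.cnt j) →
      (a : ℝ) ≤ q * ((n * max r (s.cnt j) / (members G 0).card : ℕ) + 1) := by
    intro j a ha
    have h1 := Nat.lt_div_mul_add (a := n * max r (s.cnt j)) (h.members_pos 0)
    rw [hq, div_mul_eq_mul_div, le_div_iff₀ hn]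
    have h2 : a * n ≤ (members G 0).card *
        (n * max r (s.cnt j) / (members G 0).card + 1) := by
      have := Nat.mul_le_mul_left n ha
      rw [mul_comm a n, mul_add, mul_one, mul_comm (members G 0).card]
      omega
    exact_mod_cast h2
  -- categories with few items in the first group
  have hsmall : ∀ j, (category W j ∩ members G 0).card ≤ r →
      c ^ 2 * g j (P j) ≤ g j (∑ i ∈ S, W i j) := by
    intro j hj
    refine (hg j).mul_le hc2 hc21 (hP0 j) ?_
    by_cases hne : (category W j).Nonempty
    · obtain ⟨h1, h2, -⟩ := hchosen j hne rfl
      refine le_trans ?_ (hS j hne)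
      rw [sq, mul_assoc]
      exact mul_le_mul_of_nonneg_left (h.bestSum_le_of_card_le j 0 (hxk' j) h1
        (hκ j r (le_max_left _ _)) hj) hc0
    · have h0 : P j = 0 := by
        have : heaviest W j (x j) = ∅ := subset_empty.1
          (not_nonempty_iff_eq_empty.1 hne ▸ topSet_subset _ _ _)
        simp only [hP, bestSum, this, sum_empty]
      rw [h0, mul_zero]
      exact sum_nonneg fun i _ => h.nonneg i j
  -- Here `I` already contains all items of the category in the first group, so `T` and the greedy
  -- set agree on it and its terms cancel in their comparison.
  have hsame : ∀ j, (category W j ∩ members G 0).card ≤ r →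
      ∑ i ∈ T, W i j = ∑ i ∈ s.S, W i j := by
    intro j hj
    have hI : I ∩ category W j = category W j ∩ members G 0 :=
      eq_of_subset_of_card_le (hcatG I (fun i hi => hI3 i (hI2 hi)) j)
        (by rw [hI1, min_eq_right hj])
    have h1 : T ∩ category W j = category W j ∩ members G 0 :=
      Subset.antisymm (hcatG T hTmem j) (hI ▸ inter_subset_inter_right subset_union_left)
    have h2 : s.S ∩ category W j = category W j ∩ members G 0 :=
      Subset.antisymm (hcatG s.S hI3 j) (hI ▸ inter_subset_inter_right hI2)
    rw [hsumC, h1, hsumC s.S, h2]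
  -- categories with many items in the first group
  have hratio : ∀ u v : ℝ, 0 ≤ u → (1 - δ) * u ≤ (1 + δ) * v → c * u ≤ v := by
    intro u v hu huv
    have h1 : (1 + δ) * (c * u) ≤ (1 - δ) * u := by
      rw [hc]; nlinarith [mul_nonneg (mul_nonneg hδ.le hδ.le) hu]
    exact le_of_mul_le_mul_left (h1.trans huv) (by linarith)
  have hW0 : ∀ (A : Finset (Fin n)) j, 0 ≤ ∑ i ∈ A, W i j :=
    fun A j => sum_nonneg fun i _ => h.nonneg i j
  have hbigS : ∀ j, r < (category W j ∩ members G 0).card →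
      c ^ 2 * g j (q⁻¹ * ∑ i ∈ s.S, W i j) ≤ g j (∑ i ∈ S, W i j) := by
    intro j hj
    refine (hg j).mul_le hc2 hc21 (mul_nonneg (inv_nonneg.2 hq0.le) (hW0 _ _)) ?_
    have hne : (category W j).Nonempty := by
      obtain ⟨i, hi⟩ := card_pos.1 (Nat.zero_lt_of_lt hj)
      exact ⟨i, (mem_inter.1 hi).1⟩
    obtain ⟨h1, h2, -⟩ := hchosen j hne rfl
    have hrI : r ≤ (s.S ∩ category W j).card := by
      have h3 := card_le_card (inter_subset_inter_right (u := category W j) hI2)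
      rw [hI1, min_eq_left hj.le] at h3
      exact h3
    have h3 := h.sum_le_bestSum j 0 (hcatG s.S hI3 j) hrI h2
      (hκ j _ (by rw [hI4]; exact le_max_right _ _))
    rw [← hsumC] at h3
    have h4 := hratio _ _ (hW0 s.S j) h3
    refine le_trans ?_ (hS j hne)
    rw [sq, mul_assoc]
    refine mul_le_mul_of_nonneg_left ?_ hc0
    rw [mul_left_comm, inv_mul_le_iff₀ hq0]
    exact h4
  have hbigT : ∀ j, r < (category W j ∩ members G 0).card →
      c ^ 2 * g j (P j) ≤ g j (q⁻¹ * ∑ i ∈ T, W i j) := by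
    intro j hj
    refine (hg j).mul_le hc2 hc21 (hP0 j) ?_
    have hrT : r ≤ (T ∩ category W j).card := by
      have h3 := card_le_card (inter_subset_inter_right (u := category W j)
        (show I ⊆ T from subset_union_left))
      rw [hI1, min_eq_left hj.le] at h3
      exact h3
    have h3 := h.bestSum_le_sum j 0 ((hyx j).trans (hxk' j))
      (inter_subset_right (s₁ := T) (s₂ := category W j)) hrT (fun i hi => by
        refine mem_inter.2 ⟨mem_union_right _ (mem_biUnion.2 ⟨j, mem_univ j, hi⟩), ?_⟩
        exact topSet_subset _ _ _ (mem_inter.1 hi).1)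
    rw [← hsumC] at h3
    have h4 := hratio _ _ (mul_nonneg hq0.le (h.bestSum_nonneg j _)) h3
    have h5 := h.bestSum_scale j (hyx j) hc1 (Nat.le_ceil (c * x j))
    rw [le_inv_mul_iff₀ hq0]
    calc q * (c ^ 2 * P j) = c * (q * (c * bestSum W j (x j))) := by rw [hP]; ring
      _ ≤ c * (q * bestSum W j (y j)) := mul_le_mul_of_nonneg_left
          (mul_le_mul_of_nonneg_left h5 hq0.le) hc0
      _ ≤ _ := h4
  have hgP : ∀ j, 0 ≤ g j (P j) := fun j => (hg j).nonneg _ (hP0 j)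
  -- The difference between greedy set and competitor may have either sign in a single category. It
  -- is kept so that, after summation, optimality of the greedy set makes it nonnegative.
  have hmain : ∀ j, c ^ 4 * g j (P j) + c ^ 2 * (g j (q⁻¹ * ∑ i ∈ s.S, W i j) -
      g j (q⁻¹ * ∑ i ∈ T, W i j)) ≤ g j (∑ i ∈ S, W i j) := by
    intro j
    rcases le_or_gt (category W j ∩ members G 0).card r with hj | hj
    · rw [hsame j hj, sub_self, mul_zero, add_zero]
      refine le_trans (mul_le_mul_of_nonneg_right ?_ (hgP j)) (hsmall j hj)
      exact pow_le_pow_of_le_one hc0 hc1 (by norm_num)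
    · have h1 := mul_le_mul_of_nonneg_left (hbigT j hj) hc2
      have h2 := hbigS j hj
      nlinarith
  have hfinal := sum_le_sum fun j (_ : j ∈ univ) => hmain j
  rw [sum_add_distrib, ← mul_sum, ← mul_sum, sum_sub_distrib] at hfinal
  have hdiff := mul_nonneg hc2 (sub_nonneg.2 hgreedy)
  have hPsum : 0 ≤ ∑ j, g j (P j) := sum_nonneg fun j _ => hgP j
  have hpow : 1 - 8 * δ ≤ c ^ 4 := by
    have := one_add_mul_le_pow (show (-2 : ℝ) ≤ -(2 * δ) by linarith) 4
    rw [hc]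
    calc 1 - 8 * δ = 1 + (4 : ℕ) * -(2 * δ) := by push_cast; ring
      _ ≤ _ := this
      _ = _ := by ring
  calc (1 - 8 * δ) * opt g W k ≤ (1 - 8 * δ) * ∑ j, g j (P j) :=
        mul_le_mul_of_nonneg_left hoptP (by linarith)
    _ ≤ c ^ 4 * ∑ j, g j (P j) := mul_le_mul_of_nonneg_right hpow hPsum
    _ ≤ _ := by
        change _ ≤ ∑ j, g j (∑ i ∈ S, W i j)
        linarith

end Regular

end NearOptimal

/-! ### Choice of parameters and the final probability estimate -/

lemma floor_sqrt_bounds {k r : ℕ} (hr : r = Nat.sqrt k) (hk : 1 ≤ k) {x : ℝ}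
    (h : x ^ 2 ≤ k) : x ≤ 2 * r ∧ (k : ℝ) ≤ 4 * (r : ℝ) ^ 2 := by
  have h1 : k < (r + 1) * (r + 1) := by rw [hr]; exact Nat.lt_succ_sqrt k
  have h2 : 1 ≤ r := by rw [hr]; exact Nat.le_sqrt.2 (by omega)
  have h1' : (k : ℝ) ≤ (r + 1) * (r + 1) := by exact_mod_cast h1.le
  have h2' : (1 : ℝ) ≤ r := by exact_mod_cast h2
  have h3 : (k : ℝ) ≤ (2 * r) ^ 2 := h1'.trans (by nlinarith)
  exact ⟨le_of_sq_le_sq (h.trans h3) (by linarith), by linarith [mul_pow 2 (r : ℝ) 2]⟩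

/-- The exponential tail beats the number of events, in terms of `a = 1/ε`, `t = 1/τ`,
`c = 1/γ`. -/
lemma tail_bound {m a t c u : ℝ} (hm : 1 ≤ m) (ha : 1 ≤ a) (ht : 1 ≤ t) (hc : 1 ≤ c)
    (hu : 256 * Real.log (2 + m * a * t * c) ≤ u) :
    2 ^ 25 * u ^ 2 * (m * a ^ 5 * t ^ 4 * c ^ 3) ≤ Real.exp u := by
  set M := m * a * t * c with hM
  have hM1 : 1 ≤ M := by
    have h1 : 1 ≤ m * a := one_le_mul_of_one_le_of_one_le hm ha
    exact one_le_mul_of_one_le_of_one_le (one_le_mul_of_one_le_of_one_le h1 ht) hc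
  have hlog : 0 ≤ Real.log (2 + M) := Real.log_nonneg (by linarith)
  have hu0 : 0 ≤ u := by linarith
  have h1 : m * a ^ 5 * t ^ 4 * c ^ 3 ≤ M ^ 5 := by
    have e : M ^ 5 = m ^ 5 * a ^ 5 * t ^ 5 * c ^ 5 := by rw [hM]; ring
    rw [e]
    gcongr
    · exact le_self_pow₀ hm (by norm_num)
    · norm_num
    · norm_num
  have h2 : u ^ 2 ≤ 8 * Real.exp (u / 2) := by
    have := Real.quadratic_le_exp_of_nonneg (show 0 ≤ u / 2 by linarith)
    nlinarith
  have h3 : 2 ^ 28 * M ^ 5 ≤ Real.exp (u / 2) := by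
    calc 2 ^ 28 * M ^ 5 ≤ (2 + M) ^ 28 * (2 + M) ^ 5 := by gcongr <;> linarith
      _ = (2 + M) ^ 33 := by ring
      _ = Real.exp (33 * Real.log (2 + M)) := by
          rw [← Real.exp_log (show 0 < 2 + M by linarith), ← Real.exp_nat_mul, Real.log_exp]
          norm_num
      _ ≤ Real.exp (u / 2) := Real.exp_le_exp.2 (by linarith)
  have h4 : Real.exp u = Real.exp (u / 2) * Real.exp (u / 2) := by
    rw [← Real.exp_add]; congr 1; ring
  rw [h4]
  calc 2 ^ 25 * u ^ 2 * (m * a ^ 5 * t ^ 4 * c ^ 3)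
      ≤ 2 ^ 25 * (8 * Real.exp (u / 2)) * M ^ 5 := by gcongr
    _ = Real.exp (u / 2) * (2 ^ 28 * M ^ 5) := by ring
    _ ≤ _ := by gcongr

lemma uniformOn_real_eq_one {n p : ℕ} {size : Fin p → ℕ} (hs : ∑ l, size l = n)
    {Q : (Fin n → Fin p) → Prop} (hQ : ∀ G, Q G) :
    (ProbabilityTheory.uniformOn (divisions n size)).real {G | Q G} = 1 := by
  have hne : (divisions n size).Nonempty := by
    rw [← coe_divisionSet]
    exact divisionSet_nonempty hs
  have := ProbabilityTheory.isProbabilityMeasure_uniformOn (Set.toFinite (divisions n size)) hne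
  rw [show {G | Q G} = Set.univ from Set.eq_univ_of_forall hQ, MeasureTheory.probReal_univ]

lemma opt_eq_of_utility_const {n m : ℕ} {g : Fin m → ℝ → ℝ} {W : Fin n → Fin m → ℝ} {u : ℝ}
    (h : ∀ S, utility g W S = u) (k : ℕ) : opt g W k = u := by
  unfold opt
  obtain ⟨S, -, hS⟩ := exists_mem_eq_sup'
    (s := univ.filter fun S : Finset (Fin n) => S.card ≤ k) ⟨∅, by simp⟩ (utility g W)
  rw [hS, h]

/-- Disjoint groups of at least `γ * n` items number at most `1 / γ`, which removes `p` from the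
union bound. -/
lemma card_groups_mul_le {n p : ℕ} {size : Fin p → ℕ} {γ : ℝ} (hn : 0 < n)
    (hs : ∑ l, size l = n) (hsize : ∀ l, γ * n ≤ size l) : (p : ℝ) * γ ≤ 1 := by
  have hn' : (0 : ℝ) < n := by exact_mod_cast hn
  have h1 := sum_le_sum fun l (_ : l ∈ univ) => hsize l
  rw [sum_const, card_univ, Fintype.card_fin, nsmul_eq_mul] at h1
  have h2 : (∑ l, (size l : ℝ)) = n := by exact_mod_cast hs
  rw [h2, ← mul_assoc] at h1
  exact le_of_mul_le_mul_right (by linarith) hn'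

/-- The parameters are `δ = ε / 8` and `b = δ * τ ^ 2 * γ * r / 16`, small enough for the error
conditions in `Regular`. The Chernoff exponent is then `R / 2048` with `R = ε ^ 2 * τ ^ 2 * γ * r`,
and the lower bound on `k` makes `R` at least `2 ^ 19 * (m * L)`. -/
theorem fairGreedy_near_optimal {ε τ γ : ℝ} {n m p k : ℕ} [NeZero p] (hε : 0 < ε) (hε1 : ε < 1)
    (hτ : 0 < τ) (hτ1 : τ < 1) (hγ : 0 < γ) (hm : 1 ≤ m) {g : Fin m → ℝ → ℝ}
    {W : Fin n → Fin m → ℝ} {φ : Fin p → ℝ → ℝ} {size : Fin p → ℕ}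
    (hbig : (2 ^ 20 * (ε⁻¹ ^ 2 * τ⁻¹ ^ 2 * γ⁻¹ ^ 5 * (m : ℝ) ^ 4 *
      Real.log (2 + m * ε⁻¹ * τ⁻¹ * γ⁻¹))) ^ 2 ≤ k)
    (hk : 1 ≤ k) (hkn : k ≤ n) (hg : ∀ j, IsGain (g j))
    (hW : ∀ i j, W i j = 0 ∨ (τ < W i j ∧ W i j < 1 / τ))
    (hC : ∀ j j', j ≠ j' → Disjoint (category W j) (category W j')) (hφ : ∀ l, IsBias (φ l))
    (hφ₀ : ∀ x, 0 ≤ x → φ 0 x = x) (hs : ∑ l, size l = n) (hsize : ∀ l, γ * n ≤ size l) :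
    1 - ε ≤ (ProbabilityTheory.uniformOn (divisions n size)).real
      {G | (1 - ε) * opt g W k ≤
        utility g W (fairGreedy g (observed φ G W) k G (category W)).val} := by
  have hn : 0 < n := by omega
  have hpγ := card_groups_mul_le hn hs hsize
  have hp1 : (1 : ℝ) ≤ p := by exact_mod_cast Nat.one_le_iff_ne_zero.2 (NeZero.ne p)
  have hγ1 : γ ≤ 1 := le_trans (le_mul_of_one_le_left hγ.le hp1) hpγ
  set a := ε⁻¹ with ha
  set t := τ⁻¹ with ht
  set c := γ⁻¹ with hc
  have ha1 : 1 ≤ a := (one_le_inv₀ hε).2 hε1.le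
  have ht1 : 1 ≤ t := (one_le_inv₀ hτ).2 hτ1.le
  have hc1 : 1 ≤ c := (one_le_inv₀ hγ).2 hγ1
  have hm1 : (1 : ℝ) ≤ m := by exact_mod_cast hm
  set L := Real.log (2 + m * a * t * c) with hL
  have hM1 : 1 ≤ m * a * t * c := by
    have h1 : 1 ≤ m * a := one_le_mul_of_one_le_of_one_le hm1 ha1
    exact one_le_mul_of_one_le_of_one_le (one_le_mul_of_one_le_of_one_le h1 ht1) hc1
  have hL1 : 1 ≤ L := by
    rw [hL, Real.le_log_iff_exp_le (by linarith)]
    linarith [Real.exp_one_lt_d9]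
  set r := Nat.sqrt k with hr
  obtain ⟨hr1, hr2⟩ := floor_sqrt_bounds hr hk hbig
  set R := ε ^ 2 * τ ^ 2 * γ * r with hR
  have hea : ε * a = 1 := mul_inv_cancel₀ hε.ne'
  have hta : τ * t = 1 := mul_inv_cancel₀ hτ.ne'
  have hca : γ * c = 1 := mul_inv_cancel₀ hγ.ne'
  have hr0 : (0 : ℝ) ≤ r := Nat.cast_nonneg r
  have hRm : 2 ^ 19 * (m * L) ≤ R := by
    have h1 : ε ^ 2 * τ ^ 2 * γ * (2 ^ 20 * (a ^ 2 * t ^ 2 * c ^ 5 * (m : ℝ) ^ 4 * L)) ≤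
        ε ^ 2 * τ ^ 2 * γ * (2 * r) := mul_le_mul_of_nonneg_left hr1 (by positivity)
    have h2 : ε ^ 2 * τ ^ 2 * γ * (2 ^ 20 * (a ^ 2 * t ^ 2 * c ^ 5 * (m : ℝ) ^ 4 * L)) =
        (ε * a) ^ 2 * (τ * t) ^ 2 * (γ * c) * (2 ^ 20 * (c ^ 4 * m ^ 4 * L)) := by ring
    rw [h2, hea, hta, hca] at h1
    have h3 : m * L ≤ c ^ 4 * m ^ 4 * L := by
      refine mul_le_mul_of_nonneg_right ?_ (by linarith)
      calc (m : ℝ) = 1 * m := (one_mul _).symm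
        _ ≤ c ^ 4 * m ^ 4 := mul_le_mul (one_le_pow₀ hc1) (le_self_pow₀ hm1 (by norm_num))
            (by linarith) (by positivity)
    rw [hR]
    linarith
  have hLm : L ≤ m * L := le_mul_of_one_le_left (by linarith) hm1
  have hmL : (m : ℝ) ≤ m * L := le_mul_of_one_le_right (by linarith) hL1
  set b := ε / 8 * τ ^ 2 * γ * r / 16 with hb
  have hb0 : 0 ≤ b := by positivity
  have hτ2 : τ ^ 2 ≤ 1 := pow_le_one₀ hτ.le hτ1.le
  have hRb : R ≤ 128 * b := by
    have : R = ε * (128 * b) := by rw [hR, hb]; ring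
    rw [this]
    exact mul_le_of_le_one_left (by positivity) hε1.le
  have hRm' : R ≤ ε * γ * r := by
    have : R = (ε * τ ^ 2) * (ε * γ * r) := by rw [hR]; ring
    rw [this]
    exact mul_le_of_le_one_left (by positivity) (mul_le_one₀ hε1.le (by positivity) hτ2)
  refine le_uniformOn_of_concentrated W k (δ := ε / 8) (b := b) (by positivity) (by linarith) hb0
    size hs hn ?_ _ fun G hG hconc => ?_
  · have hu : b * (ε / 8) / 2 = R / 2048 := by rw [hb, hR]; ring
    rw [hu]
    have htail := tail_bound hm1 ha1 ht1 hc1 (u := R / 2048) (by linarith)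
    have hpc : (p : ℝ) ≤ c := by
      rw [hc, ← one_div, le_div_iff₀ hγ]; exact hpγ
    rw [Real.exp_neg, ← div_eq_mul_inv, div_le_iff₀ (Real.exp_pos _)]
    -- The number of events involves `k ≤ 4 * r ^ 2`. With `r` expressed through `R`, it is a
    -- polynomial in `R`, which `tail_bound` compares with the exponential.
    have hrR : (r : ℝ) = a ^ 2 * t ^ 2 * c * R := by
      have : a ^ 2 * t ^ 2 * c * R = (ε * a) ^ 2 * (τ * t) ^ 2 * (γ * c) * r := by rw [hR]; ring
      rw [this, hea, hta, hca]; ring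
    calc 2 * (m * p * k : ℝ) ≤ 2 * (m * c * (4 * (r : ℝ) ^ 2)) := by gcongr
      _ = ε * a * (2 * (m * c * (4 * (a ^ 2 * t ^ 2 * c * R) ^ 2))) := by
          rw [hea, one_mul, ← hrR]
      _ = ε * (2 ^ 25 * (R / 2048) ^ 2 * (m * a ^ 5 * t ^ 4 * c ^ 3)) := by ring
      _ ≤ ε * Real.exp (R / 2048) := mul_le_mul_of_nonneg_left htail hε.le
  · have hreg : Regular W G k r (ε / 8) τ γ b :=
      { n_pos := hn
        value := hW
        disj := hC
        δ_pos := by positivity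
        δ_le := by linarith
        τ_pos := hτ
        γ_pos := hγ
        b_nonneg := hb0
        size_ge := fun l => by rw [mem_divisionSet.1 hG l]; exact hsize l
        conc := hconc
        sq_le := Nat.sqrt_le k
        b_le := by
          have h1 : ε / 8 * τ ^ 2 * r * γ ≤ ε / 8 * τ ^ 2 * r :=
            mul_le_of_le_one_right (by positivity) hγ1
          have h2 : 16 * b = ε / 8 * τ ^ 2 * r * γ := by rw [hb]; ring
          linarith
        b_le' := by
          have h1 : ε / 8 * γ * r * τ ^ 2 ≤ ε / 8 * γ * r :=
            mul_le_of_le_one_right (by positivity) hτ2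
          have h2 : 16 * b = ε / 8 * γ * r * τ ^ 2 := by rw [hb]; ring
          linarith
        m_le := by linarith }
    have := hreg.opt_le hg hφ hφ₀ hr hk hkn
    rwa [show 8 * (ε / 8) = ε by ring] at this

end FairGreedy

open FairGreedy
theorem theorem2 :
    ∃ K d : ℕ,
      -- for every input with disjoint categories: size, proportional representation, and cost
      (∀ (n m p k : ℕ) [NeZero p] (g : Fin m → ℝ → ℝ) (What : Fin n → Fin m → ℝ)
          (G : Fin n → Fin p) (C : Fin m → Finset (Fin n)),
        (∀ j j', j ≠ j' → Disjoint (C j) (C j')) → 1 ≤ k → k ≤ n →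
          (fairGreedy g What k G C).val.card = k ∧
          IsProportional G k (fairGreedy g What k G C).val ∧
          (∀ j, (fairGreedy g What k G C).calls j ≤ K * (n * k)) ∧
          ((fairGreedy g What k G C).ops : ℝ) ≤ K * (n * k * Real.log (n + 1))) ∧
      -- for all large `k`: near-optimal latent utility with high probability
      (∀ (ε τ γ : ℝ) (m : ℕ), 0 < ε → 0 < τ → 0 < γ →
        ∀ (n p k : ℕ) [NeZero p] (g : Fin m → ℝ → ℝ) (W : Fin n → Fin m → ℝ)
          (φ : Fin p → ℝ → ℝ) (size : Fin p → ℕ),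
        (K : ℝ) * (ε⁻¹ ^ 4 * τ⁻¹ ^ 4 * γ⁻¹ ^ 10 * (m : ℝ) ^ 8) *
            Real.log (2 + m * ε⁻¹ * τ⁻¹ * γ⁻¹) ^ d ≤ k →
        1 ≤ k → k ≤ n →
        (∀ j, IsGain (g j)) →
        (∀ i j, W i j = 0 ∨ (τ < W i j ∧ W i j < 1 / τ)) →
        (∀ j j', j ≠ j' → Disjoint (category W j) (category W j')) →
        (∀ l, IsBias (φ l)) →
        (∀ x, 0 ≤ x → φ 0 x = x) →
        ∑ l, size l = n →
        (∀ l, γ * n ≤ size l) →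
        1 - ε ≤ (ProbabilityTheory.uniformOn (divisions n size)).real
          {G | (1 - ε) * opt g W k ≤
            utility g W (fairGreedy g (observed φ G W) k G (category W)).val}) := by
  -- The constants arise by squaring: `fairGreedy_near_optimal` needs a lower bound on `√k` with
  -- constant `2 ^ 20` and a single logarithm.
  refine ⟨2 ^ 40, 2, ?_, ?_⟩
  · intro n m p k _ g What G C hC hk hkn
    obtain ⟨-, h1, h2⟩ := fairGreedy_spec g What k G C hk hkn
    obtain ⟨h3, h4⟩ := costLE_fairGreedy g What k G C hC hk hkn
    refine ⟨h1, h2, fun j => (h3 j).trans (Nat.mul_le_mul_right _ (by norm_num)), ?_⟩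
    have hn : (1 : ℝ) ≤ n := by exact_mod_cast hk.trans hkn
    -- The cost is even of order `n * k`; the logarithmic factor only has to be bounded below, by
    -- `log 2`.
    have hlog : 1 / 2 ≤ Real.log (n + 1) := by
      refine le_trans ?_ (Real.log_le_log two_pos (show (2 : ℝ) ≤ n + 1 by linarith))
      linarith [Real.log_two_gt_d9]
    have h5 : ((fairGreedy g What k G C).ops : ℝ) ≤ 120 * (n * k) := by exact_mod_cast h4
    have h6 : (0 : ℝ) ≤ n * k := by positivity
    refine h5.trans ?_
    push_cast
    have h7 := mul_le_mul_of_nonneg_left hlog h6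
    nlinarith
  · intro ε τ γ m hε hτ hγ n p k _ g W φ size hbig hk hkn hg hW hC hφ hφ₀ hs hsize
    rcases le_or_gt 1 ε with hε1 | hε1
    · exact le_trans (by linarith) MeasureTheory.measureReal_nonneg
    -- Covers the degenerate cases `m = 0` and `τ ≥ 1`: no positive utility is possible, so all sets
    -- have the same value.
    have hconst : (∀ i j, W i j = 0) → 1 - ε ≤
        (ProbabilityTheory.uniformOn (divisions n size)).real {G | (1 - ε) * opt g W k ≤
          utility g W (fairGreedy g (observed φ G W) k G (category W)).val} := by
      intro h0
      have hu : ∀ S, utility g W S = ∑ j, g j 0 := fun S => by simp [utility, h0]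
      rw [uniformOn_real_eq_one hs fun G => ?_]
      · linarith
      · rw [opt_eq_of_utility_const hu, hu]
        exact mul_le_of_le_one_left (sum_nonneg fun j _ => (hg j).nonneg 0 le_rfl) (by linarith)
    rcases Nat.eq_zero_or_pos m with rfl | hm
    · exact hconst fun i j => j.elim0
    rcases le_or_gt 1 τ with hτ1 | hτ1
    · refine hconst fun i j => (hW i j).resolve_right fun h => ?_
      have : 1 / τ ≤ 1 := (div_le_one hτ).2 hτ1
      linarith [h.1, h.2]
    refine fairGreedy_near_optimal hε hε1 hτ hτ1 hγ hm (le_of_eq_of_le ?_ hbig) hk hkn hg hW hC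
      hφ hφ₀ hs hsize
    push_cast
    ring
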